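/- **Setting.** For every $n\ge 1$ let $m=m(n)\in\mathbb N$, let $\xi_\alpha=\xi_{\alpha,n}$ ($\alpha\le m$) be real random variables and $\mathbf y_\alpha=\mathbf y_{\alpha,n}$ ($\alpha\le m$) random vectors in $\mathbb R^n$, all of them mutually independent, and put $$\mathcal L_n=\sum_{\alpha\le m}\xi_\alpha\,\mathbf y_\alpha\mathbf y_\alpha^T,\qquad Q_\alpha=\mathbf E\,\mathbf y_\alpha\mathbf y_\alpha^T .$$ *Vectors.* For every sequence of deterministic real $n\times n$ matrices $D=D_n$ with $\|D_n\|_{op}=1$, $$\sup_{\alpha}\mathbf{Var}\,(D_n\mathbf y_\alpha,\mathbf y_\alpha)\to0,\qquad n\to\infty .$$ Moreover $\sup_\alpha\|Q_\alpha\|_{op}=O(n^{-1})$, $\ \sup_\alpha|\mathrm{Tr}\,Q_\alpha-1|=o(1)$, and $$\frac1m\sum_{\alpha}Q_\alpha=\frac1nI_n+B_n,\qquad \|B_n\|_{HS}=o(n^{-1/2}),\qquad n\to\infty .$$ *Weights.* For each $n$ the $\xi_{\alpha}$, $\alpha\le m$, have a common law $\sigma_n$. Moreover $$\sup_n\frac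 mn\int|\xi|^{p+1}\,d\sigma_n(\xi)<\infty,\qquad p=1,2,3,$$ and the signed measures $\widetilde\nu_n(\Delta)=\frac mn\int_\Delta\xi\,d\sigma_n(\xi)$ converge weakly to $\widetilde\nu$ in the following sense. Since the total variations of the $\widetilde\nu_n$ need not be bounded, $\widetilde\nu$ is allowed to be a generalized signed measure, that is, a real linear functional $\varphi\mapsto\int\varphi\,d\widetilde\nu$ on the space of $C^1$ functions $\varphi:\mathbb R\to\mathbb R$ that are bounded together with $\varphi'$; the convergence means $\int\varphi\,d\widetilde\nu_n\to\int\varphi\,d\widetilde\nu$ for each such $\varphi$. Complex-valued functions are integrated through their real and imaginary parts. (In particular, $\widetilde\nu$ may be any finite signed measure to which $\widetilde\nu_n$ converge weakly, that is, against all bounded continuous functions.) **Theorem.** Under these conditions there is a non-random probability measure $\mathcal N$ on $\mathbb R$ such that the empirical spectral distributions $\mathcal N_{\mathcal L_n}$ (mass $1/n$ at each eigenvalue, counted with multiplicity) converge weakly to $\mathcal N$ in probability as $n\to\infty$: for every bounded continuous $\varphi$ and every $\varepsilon>0$, $$\mathbf P\Big\{\Big|\int\varphi\,d\mathcal N_{\mathcal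 L_n}-\int\varphi\,d\mathcal N\Big|\ge\varepsilon\Big\}\to0 .$$ The Stieltjes transform $f(z)=\int(\lambda-z)^{-1}d\mathcal N(\lambda)$ satisfies $$zf(z)=-1+f(z)\int\frac{d\widetilde\nu(\xi)}{1+\xi f(z)},\qquad z\in\mathbb C\setminus\mathbb R,$$ and it is the only solution of this equation among the Stieltjes transforms of non-negative measures $M$ on $\mathbb R$ (with $\int|\lambda-z|^{-1}dM(\lambda)<\infty$ for all $z\in\mathbb C\setminus\mathbb R$). No further condition is imposed on $m$; the theorem covers in particular the regimes $m/n\to c$ and $m/n\to\infty$ with $\frac mn\mathbf E\xi_\alpha\to c$. -/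

import Mathlib

open MeasureTheory ProbabilityTheory Filter Topology Matrix
open scoped ENNReal BoundedContinuousFunction

noncomputable section

/-! ## Signed measures, generalized signed measures and weak convergence -/

/-- Real test functions on the line: bounded functions of class `C¹` with bounded derivative. -/
def testFunctions : Submodule ℝ (ℝ → ℝ) where
  carrier := {φ | ContDiff ℝ 1 φ ∧ (∃ C : ℝ, ∀ x, |φ x| ≤ C) ∧ ∃ C : ℝ, ∀ x, |deriv φ x| ≤ C}
  zero_mem' := by
    refine ⟨contDiff_const, ⟨0, fun x => by simp⟩, ⟨0, fun x => ?_⟩⟩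
    have h : deriv (0 : ℝ → ℝ) x = 0 := deriv_const x (0 : ℝ)
    simp [h]
  add_mem' := by
    rintro φ ψ ⟨hφ, ⟨A, hA⟩, ⟨A', hA'⟩⟩ ⟨hψ, ⟨B, hB⟩, ⟨B', hB'⟩⟩
    refine ⟨hφ.add hψ, ⟨A + B, fun x => ?_⟩, ⟨A' + B', fun x => ?_⟩⟩
    · exact (abs_add_le _ _).trans (add_le_add (hA x) (hB x))
    · rw [deriv_add (hφ.differentiable one_ne_zero x) (hψ.differentiable one_ne_zero x)]
      exact (abs_add_le _ _).trans (add_le_add (hA' x) (hB' x))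
  smul_mem' := by
    rintro c φ ⟨hφ, ⟨A, hA⟩, ⟨A', hA'⟩⟩
    refine ⟨hφ.const_smul c, ⟨|c| * A, fun x => ?_⟩, ⟨|c| * A', fun x => ?_⟩⟩
    · simp only [Pi.smul_apply, smul_eq_mul, abs_mul]
      exact mul_le_mul_of_nonneg_left (hA x) (abs_nonneg c)
    · rw [deriv_const_smul c (hφ.differentiable one_ne_zero x), smul_eq_mul, abs_mul]
      exact mul_le_mul_of_nonneg_left (hA' x) (abs_nonneg c)

theorem integrable_testFunction (s : SignedMeasure ℝ) (φ : testFunctions) :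
    s.Integrable (φ : ℝ → ℝ) := by
  obtain ⟨hφ, ⟨C, hC⟩, -⟩ := φ.2
  have : IsFiniteMeasure s.variation := by
    rw [← SignedMeasure.totalVariation_eq_variation]
    infer_instance
  exact Integrable.of_bound hφ.continuous.aestronglyMeasurable C
    (Eventually.of_forall fun x => by simpa using hC x)

/-- A generalized signed measure on the line: a real linear functional on the test functions.
Every finite signed measure is one (`SignedMeasure.toGeneralized`). A weak limit of signed measures
whose total variations are not bounded need not be a signed measure (an example is
`φ ↦ φ' 0`, the limit of `(δ_a - δ_{-a}) / (2a)` as `a → 0`), but it still is a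
generalized signed measure. -/
abbrev GeneralizedSignedMeasure : Type := testFunctions →ₗ[ℝ] ℝ

/-- The generalized signed measure `φ ↦ ∫ φ ds` of a finite signed measure `s`. -/
def MeasureTheory.SignedMeasure.toGeneralized (s : SignedMeasure ℝ) :
    GeneralizedSignedMeasure where
  toFun φ := ∫ᵛ x, (φ : ℝ → ℝ) x ∂<•s
  map_add' φ ψ := VectorMeasure.integral_fun_add
    (integrable_testFunction s φ) (integrable_testFunction s ψ)
  map_smul' c φ := VectorMeasure.integral_fun_smul _ _ c (φ : ℝ → ℝ)

/-- Weak convergence of finite signed measures to a generalized signed measure. -/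
def WeaklyConvergesTo (s : ℕ → SignedMeasure ℝ) (ν : GeneralizedSignedMeasure) : Prop :=
  ∀ φ : testFunctions, Tendsto (fun n => (s n).toGeneralized φ) atTop (𝓝 (ν φ))

open scoped Classical in
/-- The integral `∫ g dν` of a complex function `g` whose real and imaginary parts are test
functions. -/
def GeneralizedSignedMeasure.integral (ν : GeneralizedSignedMeasure) (g : ℝ → ℂ) : ℂ :=
  if h : (fun x => (g x).re) ∈ testFunctions ∧ (fun x => (g x).im) ∈ testFunctions then
    (ν ⟨_, h.1⟩ : ℂ) + (ν ⟨_, h.2⟩ : ℂ) * Complex.I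
  else 0

/-- The functions `ξ ↦ 1 / (1 + ξ w)` with non-real `w` can be integrated. -/
theorem kernel_mem_testFunctions {w : ℂ} (hw : w.im ≠ 0) :
    (fun x : ℝ => (1 / (1 + (x : ℂ) * w)).re) ∈ testFunctions ∧
      (fun x : ℝ => (1 / (1 + (x : ℂ) * w)).im) ∈ testFunctions := by
  set g : ℝ → ℂ := fun x => 1 / (1 + (x : ℂ) * w) with hg
  have hw0 : w ≠ 0 := fun h => hw (by simp [h])
  have hne : ∀ x : ℝ, 1 + (x : ℂ) * w ≠ 0 := by
    intro x h
    have h1 := congrArg Complex.re h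
    have h2 := congrArg Complex.im h
    simp [hw] at h1 h2
    simp [h2] at h1
  have hlow : ∀ x : ℝ, |w.im| ≤ ‖1 + (x : ℂ) * w‖ * ‖w‖ := by
    intro x
    have h : ((1 + (x : ℂ) * w) * (starRingEnd ℂ) w).im = -w.im := by
      simp [Complex.add_im, Complex.mul_im]; ring
    calc |w.im| = |((1 + (x : ℂ) * w) * (starRingEnd ℂ) w).im| := by rw [h, abs_neg]
      _ ≤ ‖(1 + (x : ℂ) * w) * (starRingEnd ℂ) w‖ := Complex.abs_im_le_norm _
      _ = _ := by rw [norm_mul, Complex.norm_conj]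
  have hb : ∀ x, ‖g x‖ ≤ ‖w‖ / |w.im| := by
    intro x
    have h0 : 0 < ‖1 + (x : ℂ) * w‖ := norm_pos_iff.2 (hne x)
    rw [hg, norm_div, norm_one, div_le_div_iff₀ h0 (abs_pos.2 hw)]
    linarith [hlow x, mul_comm ‖1 + (x : ℂ) * w‖ ‖w‖]
  have hd : ∀ x, HasDerivAt g (-w * g x ^ 2) x := by
    intro x
    have h1 : HasDerivAt (fun x : ℝ => 1 + (x : ℂ) * w) (1 * w) x :=
      ((Complex.ofRealCLM.hasDerivAt (x := x)).mul_const w).const_add 1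
    have h2 := h1.inv (hne x)
    have h3 : g = (fun x : ℝ => 1 + (x : ℂ) * w)⁻¹ := by
      ext x; simp [hg]
    rw [← h3] at h2
    have h4 : -w * g x ^ 2 = -(1 * w) / (1 + (x : ℂ) * w) ^ 2 := by
      simp [hg, div_eq_mul_inv]
    rw [h4]
    exact h2
  have hc : ContDiff ℝ 1 g := by
    have h1 : ContDiff ℝ 1 (fun x : ℝ => 1 + (x : ℂ) * w) :=
      contDiff_const.add (Complex.ofRealCLM.contDiff.mul contDiff_const)
    have h3 : g = (fun x : ℝ => 1 + (x : ℂ) * w)⁻¹ := by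
      ext x; simp [hg]
    rw [h3]
    exact h1.inv hne
  have hdb : ∀ x, ‖-w * g x ^ 2‖ ≤ ‖w‖ * (‖w‖ / |w.im|) ^ 2 := by
    intro x
    rw [norm_mul, norm_neg, norm_pow]
    gcongr
    exact hb x
  have hre : ∀ x, HasDerivAt (fun x => (g x).re) (-w * g x ^ 2).re x := fun x =>
    Complex.reCLM.hasFDerivAt.comp_hasDerivAt x (hd x)
  have him : ∀ x, HasDerivAt (fun x => (g x).im) (-w * g x ^ 2).im x := fun x =>
    Complex.imCLM.hasFDerivAt.comp_hasDerivAt x (hd x)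
  constructor
  · refine ⟨Complex.reCLM.contDiff.comp hc, ⟨‖w‖ / |w.im|, fun x => ?_⟩,
      ⟨‖w‖ * (‖w‖ / |w.im|) ^ 2, fun x => ?_⟩⟩
    · exact (Complex.abs_re_le_norm _).trans (hb x)
    · rw [(hre x).deriv]
      exact (Complex.abs_re_le_norm _).trans (hdb x)
  · refine ⟨Complex.imCLM.contDiff.comp hc, ⟨‖w‖ / |w.im|, fun x => ?_⟩,
      ⟨‖w‖ * (‖w‖ / |w.im|) ^ 2, fun x => ?_⟩⟩
    · exact (Complex.abs_im_le_norm _).trans (hb x)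
    · rw [(him x).deriv]
      exact (Complex.abs_im_le_norm _).trans (hdb x)

/-- For a finite signed measure this is the usual integral. -/
theorem MeasureTheory.SignedMeasure.integral_toGeneralized (s : SignedMeasure ℝ) (g : ℝ → ℂ)
    (hre : (fun x => (g x).re) ∈ testFunctions) (him : (fun x => (g x).im) ∈ testFunctions) :
    s.toGeneralized.integral g = ∫ᵛ x, g x ∂<•s := by
  have hsub : ∀ {E : Type} [NormedAddCommGroup E] [NormedSpace ℝ E] (φ : ℝ → E),
      (∀ t : SignedMeasure ℝ, t.Integrable φ) → ∫ᵛ x, φ x ∂<•s =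
        ∫ x, φ x ∂s.toJordanDecomposition.posPart - ∫ x, φ x ∂s.toJordanDecomposition.negPart := by
    intro E _ _ φ hφ
    conv_lhs => rw [← s.toSignedMeasure_toJordanDecomposition]
    unfold JordanDecomposition.toSignedMeasure
    rw [VectorMeasure.integral_sub_vectorMeasure (hφ _) (hφ _)]
    simp only [VectorMeasure.integral_toSignedMeasure]
  have hr : ∀ t : SignedMeasure ℝ, t.Integrable fun x => (g x).re :=
    fun t => integrable_testFunction t ⟨_, hre⟩
  have hi : ∀ t : SignedMeasure ℝ, t.Integrable fun x => (g x).im :=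
    fun t => integrable_testFunction t ⟨_, him⟩
  have hg : ∀ t : SignedMeasure ℝ, t.Integrable g := by
    intro t
    have h := (hr t).ofReal (𝕜 := ℂ) |>.add ((hi t).ofReal (𝕜 := ℂ) |>.mul_const Complex.I)
    exact h.congr (Eventually.of_forall fun x => Complex.re_add_im (g x))
  have hpq : ∀ μ : Measure ℝ, [IsFiniteMeasure μ] →
      ∫ x, g x ∂μ = ((∫ x, (g x).re ∂μ : ℝ) : ℂ) + ((∫ x, (g x).im ∂μ : ℝ) : ℂ) * Complex.I := by
    intro μ _
    have h := hg μ.toSignedMeasure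
    rw [VectorMeasure.Integrable, Measure.variation_toSignedMeasure] at h
    exact (integral_re_add_im (𝕜 := ℂ) h).symm
  rw [GeneralizedSignedMeasure.integral, dif_pos ⟨hre, him⟩, hsub g hg, hpq, hpq]
  simp only [SignedMeasure.toGeneralized, LinearMap.coe_mk, AddHom.coe_mk]
  rw [hsub _ hr, hsub _ hi]
  push_cast
  ring

/-- The signed measure `Δ ↦ (m / n) ∫_Δ ξ dσ(ξ)`. -/
def scaledSignedMeasure (m n : ℕ) (σ : Measure ℝ) : SignedMeasure ℝ :=
  σ.withDensityᵥ fun ξ => (m / n : ℝ) * ξ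

/-! ## Matrices -/

/-- The operator norm of a real square matrix with respect to the Euclidean norm. -/
def opNorm {n : ℕ} (A : Matrix (Fin n) (Fin n) ℝ) : ℝ :=
  ‖Matrix.toEuclideanCLM (n := Fin n) (𝕜 := ℝ) A‖

/-- The Hilbert-Schmidt norm of a real square matrix. -/
def hsNorm {n : ℕ} (A : Matrix (Fin n) (Fin n) ℝ) : ℝ :=
  √(∑ i, ∑ j, A i j ^ 2)

/-- The matrix `∑_α ξ_α y_α y_αᵀ`. -/
def weightedGram {m n : ℕ} (ξ : Fin m → ℝ) (y : Fin m → Fin n → ℝ) :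
    Matrix (Fin n) (Fin n) ℝ :=
  ∑ α, ξ α • vecMulVec (y α) (y α)

theorem weightedGram_isHermitian {m n : ℕ} (ξ : Fin m → ℝ) (y : Fin m → Fin n → ℝ) :
    (weightedGram ξ y).IsHermitian := by
  ext i j
  simp [weightedGram, Matrix.sum_apply, vecMulVec_apply, mul_comm]

/-- The empirical spectral distribution of a real symmetric matrix: the eigenvalues, counted with
multiplicity, each carry the mass `1 / n`. -/
def empiricalSpectralDistribution {n : ℕ} {A : Matrix (Fin n) (Fin n) ℝ} (hA : A.IsHermitian) :
    Measure ℝ :=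
  (n : ℝ≥0∞)⁻¹ • ∑ i, Measure.dirac (hA.eigenvalues i)

/-- The matrix `E Y Yᵀ` of a random vector `Y` (not centered). -/
def secondMomentMatrix {Ω : Type*} [MeasurableSpace Ω] (P : Measure Ω) {n : ℕ}
    (Y : Ω → Fin n → ℝ) : Matrix (Fin n) (Fin n) ℝ :=
  Matrix.of fun i j => ∫ ω, Y ω i * Y ω j ∂P

/-! ## Stieltjes transforms and the limiting equation -/

/-- The Stieltjes transform `z ↦ ∫ (x - z)⁻¹ dM(x)`. -/
abbrev stieltjesTransform (M : Measure ℝ) (z : ℂ) : ℂ := resolventTransform M z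

/-- `f` satisfies `z f(z) = -1 + f(z) ∫ dν(ξ) / (1 + ξ f(z))` at all non-real `z`. -/
def SolvesLimitEquation (ν : GeneralizedSignedMeasure) (f : ℂ → ℂ) : Prop :=
  ∀ z : ℂ, z.im ≠ 0 →
    z * f z = -1 + f z * GeneralizedSignedMeasure.integral ν (fun ξ : ℝ => 1 / (1 + (ξ : ℂ) * f z))

end

/-! The analysis takes place at the points `z = iη` with `η` above a constant. Let `G = (L - iη)⁻¹`,
`f = n⁻¹ E tr G`, and let `G'` be the resolvent with the term of index `α` deleted. Far out on the
imaginary axis `f` is close to `i/η`, hence `1 / (1 + ξ f)` is bounded by 2 whatever `ξ` is. Small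
imaginary parts are thus avoided, and analytic continuation recovers the other `z`.

Concentration. Deleting one term changes `tr (G D)` by at most `‖D‖ |ξ| |y|² / η²`. As `m E ξ² =
O(n)`, the Efron–Stein inequality gives `Var tr (G D) = O(n) ‖D‖²` however large `m` is
(`variance_trace_le`).

Equation. The trace of `L G D = D + iη G D` and the Sherman–Morrison relation give `tr D + iη tr (G
D) = Σ ξ (yᵀ G' D y) / (1 + ξ yᵀ G' y)`. Given the other data, `yᵀ G' y` is close to `tr (Q G')`,
hence to `E tr (Q G)`; replacing it by `f` costs an error with the factor `ξ²`, whose sum is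
controlled (`norm_sum_weight_sub_le`). The difficulty is that only the average of the `Q_α` is close
to `I/n`, so that `E tr (Q G) ≈ f tr Q` requires the mean resolvent to be nearly scalar. This comes
from a self-improving estimate. Let `Δ` be the supremum of `|n⁻¹ E tr (G D) - f n⁻¹ tr D|` over `‖D‖
≤ 1`. The equation for `D` holds up to a multiple of `Δ/η` plus `o(1)` (`norm_equation_le`).
Subtracting `n⁻¹ tr D` times the equation for the identity and dividing by `iη - κ`, where `κ =
(m/n) E ξ / (1 + ξ f)`, yields `Δ ≤ Δ/2 + o(1)` (`norm_meanTrace_equation_le`).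

Limit. The integral against `ν` is the limit of `(m/n) E ξ / (1 + ξ w)`. Total variations are not
controlled, so only differences that carry a factor `ξ²` or `ξ³` are estimated; this already makes
the limit locally Lipschitz and holomorphic off the real axis. For large `η` the limiting equation
is a contraction near `i/η` (`WeightLimit.eq_of_equation`), so `f` converges. Tightness is read off
from `1 + iη f`, realizations are chosen along which the spectral distributions converge weakly
(`exists_realizations`), and the identity theorem extends the equation to all non-real `z`.

Uniqueness. A measure whose transform solves the equation is forced to be a probability measure with
transform near `i/η` for large `η` (`WeightLimit.isProbabilityMeasure_and_inWindow`). The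
contraction identifies the transforms there, and by a Stone–Weierstrass argument they determine the
measure. -/

noncomputable section

/-! ### Resampling one coordinate of a product measure. -/

section Resampling

/-- The preimage of a box is a box, with the constraint on coordinate `i` moved to the fresh
variable. This is the form of Fubini that integrates out one index later on without splitting the
index set. -/
theorem measurePreserving_update {ι E : Type*} [Fintype ι] [DecidableEq ι] [MeasurableSpace E]
    (μ : ι → Measure E) [∀ i, IsProbabilityMeasure (μ i)] (i : ι) :
    MeasurePreserving (fun p : (ι → E) × E => Function.update p.1 i p.2)
      ((Measure.pi μ).prod (μ i)) (Measure.pi μ) := by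
  have hm : Measurable (fun p : (ι → E) × E => Function.update p.1 i p.2) := by
    refine measurable_pi_lambda _ fun j => ?_
    by_cases h : j = i
    · subst h; simpa using measurable_snd
    · simp only [Function.update_of_ne h]
      fun_prop
  refine ⟨hm, (Measure.pi_eq fun s hs => ?_).symm⟩
  rw [Measure.map_apply hm (MeasurableSet.univ_pi hs)]
  have hpre : (fun p : (ι → E) × E => Function.update p.1 i p.2) ⁻¹' Set.univ.pi s =
      (Set.univ.pi (Function.update s i Set.univ)) ×ˢ s i := by
    ext ⟨x, e⟩
    simp only [Set.mem_preimage, Set.mem_pi, Set.mem_univ, true_implies, Set.mem_prod]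
    constructor
    · refine fun h => ⟨fun j => ?_, by simpa using h i⟩
      by_cases hj : j = i
      · subst hj; simp
      · simpa [hj] using h j
    · rintro ⟨h, h'⟩ j
      by_cases hj : j = i
      · subst hj; simpa using h'
      · simpa [hj] using h j
  rw [hpre, Measure.prod_prod, Measure.pi_pi, ← Finset.prod_erase_mul _ _ (Finset.mem_univ i),
    ← Finset.prod_erase_mul Finset.univ (fun j => μ j (s j)) (Finset.mem_univ i)]
  simp only [Function.update_self, measure_univ, mul_one]
  congr 1
  refine Finset.prod_congr rfl fun j hj => ?_
  rw [Function.update_of_ne (Finset.ne_of_mem_erase hj)]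

end Resampling

/-! ### The Efron–Stein inequality. -/

section EfronStein

variable {X Y : Type*} [MeasurableSpace X] [MeasurableSpace Y]

theorem integrable_of_forall_abs_le {μ : Measure X} [IsFiniteMeasure μ] {f : X → ℝ}
    (hf : Measurable f) {C : ℝ} (hC : ∀ x, |f x| ≤ C) : Integrable f μ :=
  Integrable.of_bound hf.aestronglyMeasurable C (Eventually.of_forall hC)

theorem abs_sq_le_sq_of_abs_le {a C : ℝ} (h : |a| ≤ C) : |a ^ 2| ≤ C ^ 2 := by
  rw [abs_pow]; exact pow_le_pow_left₀ (abs_nonneg a) h 2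

theorem integral_sub_const_sq {μ : Measure X} [IsProbabilityMeasure μ] {f : X → ℝ}
    (h1 : Integrable f μ) (h2 : Integrable (fun x => f x ^ 2) μ) (c : ℝ) :
    ∫ x, (f x - c) ^ 2 ∂μ = ∫ x, f x ^ 2 ∂μ - 2 * c * ∫ x, f x ∂μ + c ^ 2 := by
  have h3 : Integrable (fun x => f x ^ 2 - 2 * c * f x) μ := h2.sub (h1.const_mul _)
  have : (fun x => (f x - c) ^ 2) = fun x => (f x ^ 2 - 2 * c * f x) + c ^ 2 := by
    ext x; ring
  rw [this, integral_add h3 (integrable_const _), integral_sub h2 (h1.const_mul _),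
    integral_const_mul]
  simp

/-- The mean minimizes the mean square deviation. The constant `c` is left free because it will be
the mean with one coordinate frozen. -/
theorem integral_sq_sub_sq_integral_le {μ : Measure X} [IsProbabilityMeasure μ] {f : X → ℝ}
    (hf : Measurable f) {C : ℝ} (hC : ∀ x, |f x| ≤ C) (c : ℝ) :
    ∫ x, f x ^ 2 ∂μ - (∫ x, f x ∂μ) ^ 2 ≤ ∫ x, (f x - c) ^ 2 ∂μ := by
  have h1 : Integrable f μ := integrable_of_forall_abs_le hf hC
  have h2 : Integrable (fun x => f x ^ 2) μ :=
    integrable_of_forall_abs_le (hf.pow_const 2) fun x => abs_sq_le_sq_of_abs_le (hC x)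
  have h3 := integral_sub_const_sq h1 h2 c
  nlinarith [sq_nonneg (∫ x, f x ∂μ - c)]

theorem sq_integral_le_integral_sq {μ : Measure X} [IsProbabilityMeasure μ] {f : X → ℝ}
    (hf : Measurable f) {C : ℝ} (hC : ∀ x, |f x| ≤ C) :
    (∫ x, f x ∂μ) ^ 2 ≤ ∫ x, f x ^ 2 ∂μ := by
  have h1 : Integrable f μ := integrable_of_forall_abs_le hf hC
  have h2 : Integrable (fun x => f x ^ 2) μ :=
    integrable_of_forall_abs_le (hf.pow_const 2) fun x => abs_sq_le_sq_of_abs_le (hC x)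
  have h0 : 0 ≤ ∫ x, (f x - ∫ x, f x ∂μ) ^ 2 ∂μ := integral_nonneg fun x => sq_nonneg _
  set c := ∫ x, f x ∂μ
  have h3 := integral_sub_const_sq h1 h2 c
  nlinarith

/-- The total variance is the mean conditional variance plus the variance of the conditional mean.
The latter is at most the mean square deviation from the conditional mean at `x₀`, and Jensen's
inequality in `y` moves the square inside. Comparing with a fixed point rather than an independent
copy fits the deletion of a term. -/
theorem variance_prod_le {μ : Measure X} {ρ : Measure Y} [IsProbabilityMeasure μ]
    [IsProbabilityMeasure ρ] {F : X × Y → ℝ} (hF : Measurable F) {C : ℝ} (hC : ∀ p, |F p| ≤ C)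
    (x₀ : X) :
    ∫ p, F p ^ 2 ∂μ.prod ρ - (∫ p, F p ∂μ.prod ρ) ^ 2 ≤
      ∫ x, (∫ y, F (x, y) ^ 2 ∂ρ - (∫ y, F (x, y) ∂ρ) ^ 2) ∂μ +
        ∫ p, (F p - F (x₀, p.2)) ^ 2 ∂μ.prod ρ := by
  have hF2 : Measurable fun p => F p ^ 2 := hF.pow_const 2
  have hC2 : ∀ p, |F p ^ 2| ≤ C ^ 2 := fun p => abs_sq_le_sq_of_abs_le (hC p)
  have i1 : Integrable F (μ.prod ρ) := integrable_of_forall_abs_le hF hC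
  have i2 : Integrable (fun p => F p ^ 2) (μ.prod ρ) := integrable_of_forall_abs_le hF2 hC2
  have hEm : Measurable fun x => ∫ y, F (x, y) ∂ρ :=
    hF.stronglyMeasurable.integral_prod_right'.measurable
  have hEb : ∀ x, |∫ y, F (x, y) ∂ρ| ≤ C := by
    intro x
    have h := norm_integral_le_of_norm_le_const (μ := ρ) (f := fun y => F (x, y))
      (Eventually.of_forall fun y => hC (x, y))
    simpa using h
  have iE2 : Integrable (fun x => (∫ y, F (x, y) ∂ρ) ^ 2) μ :=
    integrable_of_forall_abs_le (hEm.pow_const 2) fun x => abs_sq_le_sq_of_abs_le (hEb x)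
  have hd : Measurable fun p : X × Y => F p - F (x₀, p.2) :=
    hF.sub (hF.comp (measurable_const.prodMk measurable_snd))
  have hdb : ∀ p : X × Y, |F p - F (x₀, p.2)| ≤ C + C := fun p =>
    (abs_sub _ _).trans (add_le_add (hC _) (hC _))
  have id2 : Integrable (fun p : X × Y => (F p - F (x₀, p.2)) ^ 2) (μ.prod ρ) :=
    integrable_of_forall_abs_le (hd.pow_const 2) fun p => abs_sq_le_sq_of_abs_le (hdb p)
  rw [integral_prod _ i1, integral_prod _ i2, integral_prod _ id2,
    integral_sub i2.integral_prod_left iE2]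
  have hv := integral_sq_sub_sq_integral_le (μ := μ) hEm hEb (∫ y, F (x₀, y) ∂ρ)
  have hj : ∫ x, (∫ y, F (x, y) ∂ρ - ∫ y, F (x₀, y) ∂ρ) ^ 2 ∂μ ≤
      ∫ x, ∫ y, (F (x, y) - F (x₀, y)) ^ 2 ∂ρ ∂μ := by
    refine integral_mono (integrable_of_forall_abs_le ((hEm.sub_const _).pow_const 2)
      (C := (C + C) ^ 2) fun x => abs_sq_le_sq_of_abs_le ?_) id2.integral_prod_left fun x => ?_
    · exact (abs_sub _ _).trans (add_le_add (hEb _) (hEb _))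
    · have m1 : Measurable fun y => F (x, y) := hF.comp measurable_prodMk_left
      have m2 : Measurable fun y => F (x₀, y) := hF.comp measurable_prodMk_left
      rw [← integral_sub (integrable_of_forall_abs_le m1 fun y => hC _)
        (integrable_of_forall_abs_le m2 fun y => hC _)]
      exact sq_integral_le_integral_sq (m1.sub m2) fun y => hdb (x, y)
  linarith

/-- The Efron–Stein inequality for bounded functions of independent variables. -/
theorem efronStein {E : Type*} [MeasurableSpace E] (e₀ : E) {m : ℕ} (μ : Fin m → Measure E)
    [∀ i, IsProbabilityMeasure (μ i)] {F : (Fin m → E) → ℝ} (hF : Measurable F) {C : ℝ}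
    (hC : ∀ x, |F x| ≤ C) :
    ∫ x, F x ^ 2 ∂Measure.pi μ - (∫ x, F x ∂Measure.pi μ) ^ 2 ≤
      ∑ i, ∫ x, (F x - F (Function.update x i e₀)) ^ 2 ∂Measure.pi μ := by
  induction m with
  | zero =>
    have : Measure.pi μ = Measure.dirac isEmptyElim := Measure.pi_of_empty μ
    rw [this]
    simp
  | succ m ih =>
    set ρ := Measure.pi fun j => μ (Fin.succAbove 0 j) with hρ
    have hmp := (measurePreserving_piFinSuccAbove μ 0).symm
    set e := (MeasurableEquiv.piFinSuccAbove (fun _ : Fin (m + 1) => E) 0).symm with he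
    have hmp' : MeasurePreserving e ((μ 0).prod ρ) (Measure.pi μ) := hmp
    have hcv : ∀ g : (Fin (m + 1) → E) → ℝ,
        ∫ x, g x ∂Measure.pi μ = ∫ p, g (e p) ∂(μ 0).prod ρ := fun g =>
      (hmp'.integral_comp' g).symm
    have hFe : Measurable fun p => F (e p) := hF.comp e.measurable
    have hup : ∀ i, Measurable fun x : Fin (m + 1) → E => Function.update x i e₀ := fun i =>
      measurable_update_left
    have hecons : ∀ p : E × (Fin m → E), e p = Fin.cons p.1 p.2 := by
      intro p
      simp [he, MeasurableEquiv.piFinSuccAbove, Fin.insertNthEquiv]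
    rw [hcv, hcv, Fin.sum_univ_succ]
    -- Freezing coordinate `0` gives the first term of the sum; the averaged conditional variance is
    -- left to the induction hypothesis.
    refine (variance_prod_le hFe (fun p => hC _) e₀).trans ?_
    rw [add_comm]
    refine add_le_add (le_of_eq ?_) ?_
    · rw [hcv]
      congr 1
      ext p
      rw [hecons, hecons, Fin.update_cons_zero]
    · have hle : ∀ x : E, ∫ y, F (e (x, y)) ^ 2 ∂ρ - (∫ y, F (e (x, y)) ∂ρ) ^ 2 ≤
          ∑ i, ∫ y, (F (e (x, y)) - F (e (x, Function.update y i e₀))) ^ 2 ∂ρ := fun x =>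
        ih (fun j => μ (Fin.succAbove 0 j)) (F := fun y => F (e (x, y)))
          (hFe.comp measurable_prodMk_left) fun y => hC _
      have hb : ∀ i : Fin m, ∀ p : E × (Fin m → E),
          |F (e p) - F (e (p.1, Function.update p.2 i e₀))| ≤ C + C := fun i p =>
        (abs_sub _ _).trans (add_le_add (hC _) (hC _))
      have hms : ∀ i : Fin m, Measurable fun p : E × (Fin m → E) =>
          F (e p) - F (e (p.1, Function.update p.2 i e₀)) := fun i =>
        hFe.sub (hFe.comp (measurable_fst.prodMk (measurable_update_left.comp measurable_snd)))
      have hint : ∀ i : Fin m, Integrable (fun p : E × (Fin m → E) =>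
          (F (e p) - F (e (p.1, Function.update p.2 i e₀))) ^ 2) ((μ 0).prod ρ) := fun i =>
        integrable_of_forall_abs_le ((hms i).pow_const 2) fun p => abs_sq_le_sq_of_abs_le (hb i p)
      calc ∫ x, (∫ y, F (e (x, y)) ^ 2 ∂ρ - (∫ y, F (e (x, y)) ∂ρ) ^ 2) ∂μ 0
          ≤ ∫ x, ∑ i, ∫ y, (F (e (x, y)) - F (e (x, Function.update y i e₀))) ^ 2 ∂ρ ∂μ 0 := by
            refine integral_mono_of_nonneg (Eventually.of_forall fun x => ?_)
              (integrable_finsetSum _ fun i _ => (hint i).integral_prod_left)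
              (Eventually.of_forall hle)
            exact sub_nonneg.2 (sq_integral_le_integral_sq
              (hFe.comp measurable_prodMk_left) fun y => hC _)
        _ = ∑ i, ∫ p, (F (e p) - F (e (p.1, Function.update p.2 i e₀))) ^ 2 ∂(μ 0).prod ρ := by
            rw [integral_finsetSum _ fun i _ => (hint i).integral_prod_left]
            exact Finset.sum_congr rfl fun i _ => (integral_prod _ (hint i)).symm
        _ = ∑ i : Fin m, ∫ x, (F x - F (Function.update x i.succ e₀)) ^ 2 ∂Measure.pi μ := by
            refine Finset.sum_congr rfl fun i _ => ?_
            rw [hcv]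
            congr 1
            ext p
            rw [hecons, hecons, Fin.cons_update]
        _ ≤ _ := le_rfl

end EfronStein

/-! ### Quadratic forms, traces and norms of real and complex matrices. -/

section MatrixAlgebra

open scoped Matrix.Norms.L2Operator

variable {n : ℕ}

/-- The complex vector with the given real coordinates. -/
def complexVec (y : Fin n → ℝ) : Fin n → ℂ := fun i => (y i : ℂ)

/-- The bilinear form `yᵀ M y` of a complex matrix at a real vector. -/
def quadForm (M : Matrix (Fin n) (Fin n) ℂ) (y : Fin n → ℝ) : ℂ :=
  complexVec y ⬝ᵥ M *ᵥ complexVec y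

theorem quadForm_eq_sum (M : Matrix (Fin n) (Fin n) ℂ) (y : Fin n → ℝ) :
    quadForm M y = ∑ i, ∑ j, M i j * ((y i * y j : ℝ) : ℂ) := by
  simp only [quadForm, dotProduct, mulVec, complexVec, Finset.mul_sum]
  refine Finset.sum_congr rfl fun i _ => Finset.sum_congr rfl fun j _ => ?_
  push_cast; ring

theorem norm_toLp_complexVec_sq (y : Fin n → ℝ) :
    ‖WithLp.toLp 2 (complexVec y)‖ ^ 2 = y ⬝ᵥ y := by
  rw [EuclideanSpace.norm_sq_eq]
  simp [complexVec, dotProduct, sq]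

theorem dotProduct_self_nonneg' (y : Fin n → ℝ) : 0 ≤ y ⬝ᵥ y := by
  rw [← norm_toLp_complexVec_sq]; positivity

theorem norm_dotProduct_le (u v : Fin n → ℂ) :
    ‖u ⬝ᵥ v‖ ≤ ‖WithLp.toLp 2 u‖ * ‖WithLp.toLp 2 v‖ := by
  have h := norm_inner_le_norm (𝕜 := ℂ) (WithLp.toLp 2 (star u)) (WithLp.toLp 2 v)
  have h2 : ‖WithLp.toLp 2 (star u)‖ = ‖WithLp.toLp 2 u‖ := by
    simp [EuclideanSpace.norm_eq]
  rw [h2, EuclideanSpace.inner_toLp_toLp, star_star, dotProduct_comm] at h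
  exact h

theorem norm_quadForm_le (M : Matrix (Fin n) (Fin n) ℂ) (y : Fin n → ℝ) :
    ‖quadForm M y‖ ≤ ‖M‖ * (y ⬝ᵥ y) := by
  rw [← norm_toLp_complexVec_sq, quadForm]
  refine (norm_dotProduct_le _ _).trans ?_
  have h : ‖WithLp.toLp 2 (M *ᵥ complexVec y)‖ ≤ ‖M‖ * ‖WithLp.toLp 2 (complexVec y)‖ :=
    Matrix.l2_opNorm_mulVec M (WithLp.toLp 2 (complexVec y))
  nlinarith [norm_nonneg (WithLp.toLp 2 (complexVec y))]

theorem trace_vecMulVec_mul (M : Matrix (Fin n) (Fin n) ℂ) (y : Fin n → ℝ) :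
    (vecMulVec (complexVec y) (complexVec y) * M).trace = quadForm M y := by
  rw [Matrix.vecMulVec_mul, Matrix.trace_vecMulVec, quadForm, dotProduct_mulVec, dotProduct_comm]

theorem norm_apply_le (M : Matrix (Fin n) (Fin n) ℂ) (i j : Fin n) : ‖M i j‖ ≤ ‖M‖ := by
  have h := Matrix.l2_opNorm_mulVec M (EuclideanSpace.single j (1 : ℂ))
  rw [PiLp.norm_single, norm_one, mul_one] at h
  have h2 := PiLp.norm_apply_le (WithLp.toLp 2 (M *ᵥ (EuclideanSpace.single j (1 : ℂ)))) i
  refine le_trans (le_of_eq ?_) (h2.trans h)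
  simp

theorem norm_trace_le (M : Matrix (Fin n) (Fin n) ℂ) : ‖M.trace‖ ≤ n * ‖M‖ := by
  refine (norm_sum_le _ _).trans ?_
  refine (Finset.sum_le_card_nsmul _ _ ‖M‖ fun i _ => norm_apply_le M i i).trans ?_
  simp

theorem sum_norm_sq_col_le (M : Matrix (Fin n) (Fin n) ℂ) (j : Fin n) :
    ∑ i, ‖M i j‖ ^ 2 ≤ ‖M‖ ^ 2 := by
  have h := Matrix.l2_opNorm_mulVec M (EuclideanSpace.single j (1 : ℂ))
  rw [PiLp.norm_single, norm_one, mul_one] at h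
  have h2 := pow_le_pow_left₀ (norm_nonneg _) h 2
  rw [EuclideanSpace.norm_sq_eq] at h2
  refine le_trans (le_of_eq ?_) h2
  simp

/-- Cauchy–Schwarz for the Hilbert–Schmidt product; summing over the `n` columns bounds the
Hilbert–Schmidt norm of `M` by `√n ‖M‖`. The factor `√n` is exactly what the assumption `‖B‖_HS =
o(n^{-1/2})` absorbs. -/
theorem norm_trace_ofReal_mul_le (B : Matrix (Fin n) (Fin n) ℝ) (M : Matrix (Fin n) (Fin n) ℂ) :
    ‖(B.map Complex.ofReal * M).trace‖ ≤ hsNorm B * (√n * ‖M‖) := by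
  have h1 : ‖(B.map Complex.ofReal * M).trace‖ ≤
      ∑ p ∈ (Finset.univ : Finset (Fin n × Fin n)), |B p.1 p.2| * ‖M p.2 p.1‖ := by
    rw [← Finset.univ_product_univ, Finset.sum_product]
    simp only [Matrix.trace, Matrix.diag, Matrix.mul_apply, Matrix.map_apply]
    refine (norm_sum_le _ _).trans (Finset.sum_le_sum fun i _ => ?_)
    refine (norm_sum_le _ _).trans (Finset.sum_le_sum fun j _ => ?_)
    simp
  refine h1.trans ((Real.sum_mul_le_sqrt_mul_sqrt _ _ _).trans ?_)
  have e1 : √(∑ p ∈ (Finset.univ : Finset (Fin n × Fin n)), |B p.1 p.2| ^ 2) = hsNorm B := by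
    rw [hsNorm, ← Finset.univ_product_univ, Finset.sum_product]
    simp
  rw [e1]
  refine mul_le_mul_of_nonneg_left ?_ (Real.sqrt_nonneg _)
  rw [← Real.sqrt_sq (norm_nonneg M), ← Real.sqrt_mul (Nat.cast_nonneg n)]
  refine Real.sqrt_le_sqrt ?_
  rw [← Finset.univ_product_univ, Finset.sum_product]
  simp only
  refine (Finset.sum_le_card_nsmul _ _ (‖M‖ ^ 2) fun i _ => sum_norm_sq_col_le M i).trans ?_
  simp

theorem norm_one_le_one : ‖(1 : Matrix (Fin n) (Fin n) ℂ)‖ ≤ 1 := by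
  rw [← Matrix.diagonal_one, Matrix.l2_opNorm_diagonal]
  refine (pi_norm_le_iff_of_nonneg zero_le_one).2 fun i => by simp

/-! ### Real and complex matrices -/

theorem opNorm_nonneg (A : Matrix (Fin n) (Fin n) ℝ) : 0 ≤ opNorm A := norm_nonneg _

theorem norm_toLp_mulVec_le_opNorm (A : Matrix (Fin n) (Fin n) ℝ) (u : Fin n → ℝ) :
    ‖WithLp.toLp 2 (A *ᵥ u)‖ ≤ opNorm A * ‖WithLp.toLp 2 u‖ := by
  have h := (Matrix.toEuclideanCLM (n := Fin n) (𝕜 := ℝ) A).le_opNorm (WithLp.toLp 2 u)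
  rwa [Matrix.toEuclideanCLM_toLp] at h

theorem norm_sq_toLp_re_add_im (v : Fin n → ℂ) :
    ‖WithLp.toLp 2 v‖ ^ 2 = ‖WithLp.toLp 2 fun i => (v i).re‖ ^ 2 +
      ‖WithLp.toLp 2 fun i => (v i).im‖ ^ 2 := by
  rw [EuclideanSpace.norm_sq_eq, EuclideanSpace.norm_sq_eq, EuclideanSpace.norm_sq_eq,
    ← Finset.sum_add_distrib]
  refine Finset.sum_congr rfl fun i _ => ?_
  simp [Complex.sq_norm, Complex.normSq_apply]
  ring

/-- A real matrix acts separately on the real and imaginary parts of a vector, whose squared norms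
add up. -/
theorem norm_map_ofReal_le (A : Matrix (Fin n) (Fin n) ℝ) :
    ‖A.map Complex.ofReal‖ ≤ opNorm A := by
  rw [Matrix.l2_opNorm_def]
  refine ContinuousLinearMap.opNorm_le_bound _ (opNorm_nonneg A) fun v => ?_
  have hv : (Matrix.toEuclideanLin.trans LinearMap.toContinuousLinearMap)
      (A.map Complex.ofReal) v = WithLp.toLp 2 (A.map Complex.ofReal *ᵥ v.ofLp) := rfl
  rw [hv]
  refine le_of_sq_le_sq ?_ (mul_nonneg (opNorm_nonneg A) (norm_nonneg _))
  rw [norm_sq_toLp_re_add_im, mul_pow]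
  have hr : (fun i => ((A.map Complex.ofReal *ᵥ v.ofLp) i).re) = A *ᵥ fun i => (v i).re := by
    ext i; simp [mulVec, dotProduct]
  have hi : (fun i => ((A.map Complex.ofReal *ᵥ v.ofLp) i).im) = A *ᵥ fun i => (v i).im := by
    ext i; simp [mulVec, dotProduct]
  rw [hr, hi]
  have h1 := pow_le_pow_left₀ (norm_nonneg _) (norm_toLp_mulVec_le_opNorm A fun i => (v i).re) 2
  have h2 := pow_le_pow_left₀ (norm_nonneg _) (norm_toLp_mulVec_le_opNorm A fun i => (v i).im) 2
  have h3 := norm_sq_toLp_re_add_im v.ofLp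
  have h4 : WithLp.toLp 2 v.ofLp = v := rfl
  rw [h4] at h3
  rw [h3]
  rw [mul_pow] at h1 h2
  linarith

theorem norm_toLp_complexVec (u : Fin n → ℝ) :
    ‖WithLp.toLp 2 (complexVec u)‖ = ‖WithLp.toLp 2 u‖ := by
  simp [EuclideanSpace.norm_eq, complexVec]

theorem opNorm_le_of_forall {A : Matrix (Fin n) (Fin n) ℝ} {C : ℝ} (hC : 0 ≤ C)
    (h : ∀ u : Fin n → ℝ, ‖WithLp.toLp 2 (A *ᵥ u)‖ ≤ C * ‖WithLp.toLp 2 u‖) : opNorm A ≤ C := by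
  refine ContinuousLinearMap.opNorm_le_bound _ hC fun v => ?_
  have hv : Matrix.toEuclideanCLM (n := Fin n) (𝕜 := ℝ) A v = WithLp.toLp 2 (A *ᵥ v.ofLp) := rfl
  rw [hv]
  exact h v.ofLp

/-- On a real vector `u` the real part of `M u` is `(Re M) u`. This brings complex resolvents within
reach of the concentration hypothesis, which concerns real matrices. -/
theorem opNorm_map_re_le (M : Matrix (Fin n) (Fin n) ℂ) : opNorm (M.map Complex.re) ≤ ‖M‖ := by
  refine opNorm_le_of_forall (norm_nonneg _) fun u => ?_
  have h := Matrix.l2_opNorm_mulVec M (WithLp.toLp 2 (complexVec u))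
  rw [norm_toLp_complexVec] at h
  refine le_trans ?_ h
  have h2 := norm_sq_toLp_re_add_im (M *ᵥ complexVec u)
  have hr : (fun i => ((M *ᵥ complexVec u) i).re) = M.map Complex.re *ᵥ u := by
    ext i; simp [mulVec, dotProduct, complexVec]
  rw [hr] at h2
  refine le_of_sq_le_sq ?_ (norm_nonneg _)
  exact le_trans (le_add_of_nonneg_right (sq_nonneg _)) h2.ge

theorem opNorm_map_im_le (M : Matrix (Fin n) (Fin n) ℂ) : opNorm (M.map Complex.im) ≤ ‖M‖ := by
  refine opNorm_le_of_forall (norm_nonneg _) fun u => ?_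
  have h := Matrix.l2_opNorm_mulVec M (WithLp.toLp 2 (complexVec u))
  rw [norm_toLp_complexVec] at h
  refine le_trans ?_ h
  have h2 := norm_sq_toLp_re_add_im (M *ᵥ complexVec u)
  have hr : (fun i => ((M *ᵥ complexVec u) i).im) = M.map Complex.im *ᵥ u := by
    ext i; simp [mulVec, dotProduct, complexVec]
  rw [hr] at h2
  refine le_of_sq_le_sq ?_ (norm_nonneg _)
  exact le_trans (le_add_of_nonneg_left (sq_nonneg _)) h2.ge

theorem opNorm_one (hn : 1 ≤ n) : opNorm (1 : Matrix (Fin n) (Fin n) ℝ) = 1 := by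
  have : Nonempty (Fin n) := ⟨⟨0, hn⟩⟩
  rw [opNorm, map_one]
  exact norm_one

theorem opNorm_smul (c : ℝ) (A : Matrix (Fin n) (Fin n) ℝ) : opNorm (c • A) = |c| * opNorm A := by
  rw [opNorm, map_smul, norm_smul, Real.norm_eq_abs, opNorm]

theorem opNorm_eq_zero {A : Matrix (Fin n) (Fin n) ℝ} (h : opNorm A = 0) : A = 0 := by
  rw [opNorm, norm_eq_zero] at h
  exact (map_eq_zero_iff _ (Matrix.toEuclideanCLM (n := Fin n) (𝕜 := ℝ)).injective).1 h

theorem re_quadForm (M : Matrix (Fin n) (Fin n) ℂ) (y : Fin n → ℝ) :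
    (quadForm M y).re = (M.map Complex.re *ᵥ y) ⬝ᵥ y := by
  rw [quadForm_eq_sum]
  simp only [Complex.re_sum, Complex.re_mul_ofReal, dotProduct, mulVec, Matrix.map_apply,
    Finset.sum_mul]
  refine Finset.sum_congr rfl fun i _ => Finset.sum_congr rfl fun j _ => ?_
  ring

theorem im_quadForm (M : Matrix (Fin n) (Fin n) ℂ) (y : Fin n → ℝ) :
    (quadForm M y).im = (M.map Complex.im *ᵥ y) ⬝ᵥ y := by
  rw [quadForm_eq_sum]
  simp only [Complex.im_sum, Complex.im_mul_ofReal, dotProduct, mulVec, Matrix.map_apply,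
    Finset.sum_mul]
  refine Finset.sum_congr rfl fun i _ => Finset.sum_congr rfl fun j _ => ?_
  ring

end MatrixAlgebra

/-! ### Resolvents of weighted Gram matrices and rank-one deletion. -/

section Resolvent

open scoped Matrix.Norms.L2Operator

variable {n m : ℕ}

/-- The resolvent `(A - iη)⁻¹` of a real matrix. -/
def resolventAt (η : ℝ) (A : Matrix (Fin n) (Fin n) ℝ) : Matrix (Fin n) (Fin n) ℂ :=
  (A.map Complex.ofReal - ((η : ℂ) * Complex.I) • (1 : Matrix (Fin n) (Fin n) ℂ))⁻¹

theorem diagonalization {A : Matrix (Fin n) (Fin n) ℝ} (hA : A.IsHermitian) :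
    ∃ U : Matrix (Fin n) (Fin n) ℂ, U ∈ Matrix.unitaryGroup (Fin n) ℂ ∧
      A.map Complex.ofReal = U * diagonal (fun i => (hA.eigenvalues i : ℂ)) * star U := by
  set V : Matrix (Fin n) (Fin n) ℝ := (hA.eigenvectorUnitary : Matrix (Fin n) (Fin n) ℝ)
  have hspec : A = V * diagonal hA.eigenvalues * star V := by
    have h := hA.spectral_theorem
    rw [Unitary.conjStarAlgAut_apply] at h
    exact h
  have hV : V * star V = 1 := Unitary.mul_star_self_of_mem hA.eigenvectorUnitary.2
  have hstar : (star V).map Complex.ofReal = star (V.map Complex.ofReal) := by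
    ext i j; simp [Matrix.star_apply]
  have e : ∀ M N : Matrix (Fin n) (Fin n) ℝ, (M * N).map Complex.ofReal =
      M.map Complex.ofReal * N.map Complex.ofReal := fun M N =>
    Matrix.map_mul (f := Complex.ofRealHom)
  refine ⟨V.map Complex.ofReal, ?_, ?_⟩
  · rw [Matrix.mem_unitaryGroup_iff, ← hstar]
    rw [← e, hV, Matrix.map_one _ Complex.ofReal_zero Complex.ofReal_one]
  · conv_lhs => rw [hspec]
    rw [← hstar]
    rw [e, e]
    congr 2
    ext i j
    by_cases hij : i = j
    · subst hij; simp
    · simp [hij]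

theorem ofReal_sub_mul_I_ne_zero {η : ℝ} (hη : η ≠ 0) (a : ℝ) : (a : ℂ) - η * Complex.I ≠ 0 := by
  intro h
  have := congrArg Complex.im h
  simp [hη] at this

/-- The eigenvalues are real, so `λ - iη` never vanishes and the inverse is explicit in an
eigenbasis. Invertibility is recorded as well, because the matrix inverse takes the default value
zero on singular matrices. -/
theorem resolventAt_eq {A : Matrix (Fin n) (Fin n) ℝ} (hA : A.IsHermitian) {η : ℝ} (hη : η ≠ 0) :
    ∃ U : Matrix (Fin n) (Fin n) ℂ, U ∈ Matrix.unitaryGroup (Fin n) ℂ ∧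
      resolventAt η A =
        U * diagonal (fun i => ((hA.eigenvalues i : ℂ) - η * Complex.I)⁻¹) * star U ∧
      IsUnit (A.map Complex.ofReal - ((η : ℂ) * Complex.I) • (1 : Matrix (Fin n) (Fin n) ℂ)) := by
  obtain ⟨U, hU, h⟩ := diagonalization hA
  have h1 : U * star U = 1 := Unitary.mul_star_self_of_mem hU
  have h2 : star U * U = 1 := Unitary.star_mul_self_of_mem hU
  have e1 : A.map Complex.ofReal - ((η : ℂ) * Complex.I) • (1 : Matrix (Fin n) (Fin n) ℂ) =
      U * diagonal (fun i => (hA.eigenvalues i : ℂ) - η * Complex.I) * star U := by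
    have : diagonal (fun i => (hA.eigenvalues i : ℂ) - η * Complex.I) =
        diagonal (fun i => (hA.eigenvalues i : ℂ)) -
          ((η : ℂ) * Complex.I) • (1 : Matrix (Fin n) (Fin n) ℂ) := by
      rw [← Matrix.diagonal_one, ← Matrix.diagonal_smul, Matrix.diagonal_sub]
      simp
    rw [this, Matrix.mul_sub, Matrix.sub_mul, ← h]
    simp [h1]
  have e2 : (A.map Complex.ofReal - ((η : ℂ) * Complex.I) • (1 : Matrix (Fin n) (Fin n) ℂ)) *
      (U * diagonal (fun i => ((hA.eigenvalues i : ℂ) - η * Complex.I)⁻¹) * star U) = 1 := by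
    rw [e1]
    have : U * diagonal (fun i => (hA.eigenvalues i : ℂ) - η * Complex.I) * star U *
      (U * diagonal (fun i => ((hA.eigenvalues i : ℂ) - η * Complex.I)⁻¹) * star U) =
      U * (diagonal (fun i => (hA.eigenvalues i : ℂ) - η * Complex.I) * (star U * U) *
        diagonal (fun i => ((hA.eigenvalues i : ℂ) - η * Complex.I)⁻¹)) * star U := by
      simp only [Matrix.mul_assoc]
    rw [this, h2, Matrix.mul_one, Matrix.diagonal_mul_diagonal]
    have hd : (fun i => ((hA.eigenvalues i : ℂ) - η * Complex.I) *
        ((hA.eigenvalues i : ℂ) - η * Complex.I)⁻¹) = fun _ => 1 := by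
      ext i
      exact mul_inv_cancel₀ (ofReal_sub_mul_I_ne_zero hη _)
    rw [hd, Matrix.diagonal_one, Matrix.mul_one, h1]
  exact ⟨U, hU, Matrix.inv_eq_right_inv e2, IsUnit.of_mul_eq_one _ e2⟩

theorem norm_inv_ofReal_sub_mul_I_le {η : ℝ} (hη : 0 < η) (a : ℝ) :
    ‖((a : ℂ) - η * Complex.I)⁻¹‖ ≤ 1 / η := by
  rw [norm_inv, one_div]
  refine inv_anti₀ hη ?_
  have h := Complex.abs_im_le_norm ((a : ℂ) - η * Complex.I)
  simpa [abs_of_pos hη] using h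

theorem norm_resolventAt_le {A : Matrix (Fin n) (Fin n) ℝ} (hA : A.IsHermitian) {η : ℝ}
    (hη : 0 < η) : ‖resolventAt η A‖ ≤ 1 / η := by
  obtain ⟨U, hU, h, -⟩ := resolventAt_eq hA hη.ne'
  have hU' := Unitary.star_mem hU
  rw [h]
  have h1 := CStarRing.norm_mul_mem_unitary (U * diagonal (fun i => ((hA.eigenvalues i : ℂ) -
    η * Complex.I)⁻¹)) hU'
  have h2 := CStarRing.norm_mem_unitary_mul (diagonal (fun i => ((hA.eigenvalues i : ℂ) -
    η * Complex.I)⁻¹)) hU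
  rw [h1, h2, Matrix.l2_opNorm_diagonal]
  exact (pi_norm_le_iff_of_nonneg (by positivity)).2 fun i => norm_inv_ofReal_sub_mul_I_le hη _

theorem trace_resolventAt {A : Matrix (Fin n) (Fin n) ℝ} (hA : A.IsHermitian) {η : ℝ}
    (hη : η ≠ 0) :
    (resolventAt η A).trace = ∑ i, ((hA.eigenvalues i : ℂ) - η * Complex.I)⁻¹ := by
  obtain ⟨U, hU, h, -⟩ := resolventAt_eq hA hη
  have h2 : star U * U = 1 := Unitary.star_mul_self_of_mem hU
  rw [h, Matrix.trace_mul_comm, ← Matrix.mul_assoc, h2, Matrix.one_mul, Matrix.trace_diagonal]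

theorem mul_resolventAt {A : Matrix (Fin n) (Fin n) ℝ} (hA : A.IsHermitian) {η : ℝ}
    (hη : η ≠ 0) :
    A.map Complex.ofReal * resolventAt η A = 1 + ((η : ℂ) * Complex.I) • resolventAt η A := by
  obtain ⟨U, hU, -, hu⟩ := resolventAt_eq hA hη
  have h : (A.map Complex.ofReal - ((η : ℂ) * Complex.I) • (1 : Matrix (Fin n) (Fin n) ℂ)) *
      resolventAt η A = 1 := Matrix.mul_nonsing_inv _ ((Matrix.isUnit_iff_isUnit_det _).1 hu)
  rw [Matrix.sub_mul, sub_eq_iff_eq_add, smul_mul_assoc, Matrix.one_mul] at h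
  exact h

/-- The resolvent identity. -/
theorem resolventAt_sub {A B : Matrix (Fin n) (Fin n) ℝ} (hA : A.IsHermitian)
    (hB : B.IsHermitian) {η : ℝ} (hη : η ≠ 0) :
    resolventAt η A - resolventAt η B =
      resolventAt η A * (B.map Complex.ofReal - A.map Complex.ofReal) * resolventAt η B := by
  obtain ⟨-, -, -, hu⟩ := resolventAt_eq hA hη
  obtain ⟨-, -, -, hv⟩ := resolventAt_eq hB hη
  set M := A.map Complex.ofReal - ((η : ℂ) * Complex.I) • (1 : Matrix (Fin n) (Fin n) ℂ) with hM
  set N := B.map Complex.ofReal - ((η : ℂ) * Complex.I) • (1 : Matrix (Fin n) (Fin n) ℂ) with hN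
  have h1 : resolventAt η A * M = 1 :=
    Matrix.nonsing_inv_mul _ ((Matrix.isUnit_iff_isUnit_det _).1 hu)
  have h2 : N * resolventAt η B = 1 :=
    Matrix.mul_nonsing_inv _ ((Matrix.isUnit_iff_isUnit_det _).1 hv)
  have h3 : B.map Complex.ofReal - A.map Complex.ofReal = N - M := by rw [hM, hN]; abel
  rw [h3, Matrix.mul_sub, h1, Matrix.sub_mul, Matrix.mul_assoc, h2, Matrix.mul_one, Matrix.one_mul]

/-- Weights together with vectors. -/
abbrev Sample (m n : ℕ) : Type := Fin m → ℝ × (Fin n → ℝ)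

/-- The matrix `∑ ξ_α y_α y_αᵀ` of a sample. -/
def sampleGram (x : Sample m n) : Matrix (Fin n) (Fin n) ℝ :=
  weightedGram (fun α => (x α).1) fun α => (x α).2

/-- The resolvent `(L - iη)⁻¹` of the weighted Gram matrix of a sample. -/
def sampleResolvent (η : ℝ) (x : Sample m n) : Matrix (Fin n) (Fin n) ℂ :=
  resolventAt η (sampleGram x)

/-- The resolvent of the sample with one term deleted. -/
def sampleResolventErase (η : ℝ) (x : Sample m n) (α : Fin m) : Matrix (Fin n) (Fin n) ℂ :=
  sampleResolvent η (Function.update x α 0)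

theorem sampleGram_isHermitian (x : Sample m n) : (sampleGram x).IsHermitian :=
  weightedGram_isHermitian _ _

theorem norm_sampleResolvent_le {η : ℝ} (hη : 0 < η) (x : Sample m n) :
    ‖sampleResolvent η x‖ ≤ 1 / η := norm_resolventAt_le (sampleGram_isHermitian x) hη

theorem norm_sampleResolventErase_le {η : ℝ} (hη : 0 < η) (x : Sample m n) (α : Fin m) :
    ‖sampleResolventErase η x α‖ ≤ 1 / η := norm_sampleResolvent_le hη _

theorem sampleResolventErase_update (η : ℝ) (x : Sample m n) (α : Fin m) (e : ℝ × (Fin n → ℝ)) :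
    sampleResolventErase η (Function.update x α e) α = sampleResolventErase η x α := by
  simp [sampleResolventErase]

theorem sampleGram_map (x : Sample m n) : (sampleGram x).map Complex.ofReal =
    ∑ α, ((x α).1 : ℂ) • vecMulVec (complexVec (x α).2) (complexVec (x α).2) := by
  ext i j
  simp [sampleGram, weightedGram, Matrix.sum_apply, vecMulVec_apply, complexVec]

theorem sampleGram_map_sub_erase (x : Sample m n) (α : Fin m) :
    (sampleGram x).map Complex.ofReal - (sampleGram (Function.update x α 0)).map Complex.ofReal =
      ((x α).1 : ℂ) • vecMulVec (complexVec (x α).2) (complexVec (x α).2) := by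
  rw [sampleGram_map, sampleGram_map, ← Finset.sum_erase_add _ _ (Finset.mem_univ α),
    ← Finset.sum_erase_add Finset.univ (fun β => ((Function.update x α 0 β).1 : ℂ) •
      vecMulVec (complexVec (Function.update x α 0 β).2)
        (complexVec (Function.update x α 0 β).2)) (Finset.mem_univ α)]
  have : ∑ β ∈ Finset.univ.erase α, ((Function.update x α 0 β).1 : ℂ) •
      vecMulVec (complexVec (Function.update x α 0 β).2)
        (complexVec (Function.update x α 0 β).2) =
      ∑ β ∈ Finset.univ.erase α, ((x β).1 : ℂ) •
        vecMulVec (complexVec (x β).2) (complexVec (x β).2) :=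
    Finset.sum_congr rfl fun β hβ => by rw [Function.update_of_ne (Finset.ne_of_mem_erase hβ)]
  rw [this]
  simp

theorem sampleResolvent_sub_erase {η : ℝ} (hη : η ≠ 0) (x : Sample m n) (α : Fin m) :
    sampleResolvent η x - sampleResolventErase η x α =
      -((x α).1 : ℂ) • (sampleResolvent η x *
        vecMulVec (complexVec (x α).2) (complexVec (x α).2) * sampleResolventErase η x α) := by
  rw [sampleResolventErase, sampleResolvent, sampleResolvent,
    resolventAt_sub (sampleGram_isHermitian _) (sampleGram_isHermitian _) hη, ← neg_sub,
    sampleGram_map_sub_erase]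
  simp

/-- The resolvent identity with the two resolvents in the other order: with the deleted one on the
left, the form at `y_α` closes on itself, as Sherman–Morrison requires. -/
theorem sampleResolvent_sub_erase' {η : ℝ} (hη : η ≠ 0) (x : Sample m n) (α : Fin m) :
    sampleResolvent η x - sampleResolventErase η x α =
      -((x α).1 : ℂ) • (sampleResolventErase η x α *
        vecMulVec (complexVec (x α).2) (complexVec (x α).2) * sampleResolvent η x) := by
  rw [sampleResolventErase, sampleResolvent, sampleResolvent, ← neg_sub,
    resolventAt_sub (sampleGram_isHermitian _) (sampleGram_isHermitian _) hη,
    sampleGram_map_sub_erase]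
  simp

/-- Deleting one term changes a linear statistic of the resolvent by little. -/
theorem norm_trace_mul_sub_erase_le {η : ℝ} (hη : 0 < η) (x : Sample m n) (α : Fin m)
    (D : Matrix (Fin n) (Fin n) ℂ) :
    ‖(sampleResolvent η x * D).trace - (sampleResolventErase η x α * D).trace‖ ≤
      ‖D‖ / η ^ 2 * (|(x α).1| * ((x α).2 ⬝ᵥ (x α).2)) := by
  rw [← Matrix.trace_sub, ← Matrix.sub_mul, sampleResolvent_sub_erase hη.ne', smul_mul_assoc,
    Matrix.trace_smul, Matrix.mul_assoc, Matrix.mul_assoc, Matrix.trace_mul_comm, Matrix.mul_assoc,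
    trace_vecMulVec_mul, norm_smul, norm_neg, Complex.norm_real, Real.norm_eq_abs]
  have h := norm_quadForm_le (sampleResolventErase η x α * D * sampleResolvent η x) (x α).2
  have h2 : ‖sampleResolventErase η x α * D * sampleResolvent η x‖ ≤ 1 / η * ‖D‖ * (1 / η) := by
    refine (norm_mul_le _ _).trans (mul_le_mul ?_ (norm_sampleResolvent_le hη x) (norm_nonneg _)
      (by positivity))
    exact (norm_mul_le _ _).trans (mul_le_mul_of_nonneg_right
      (norm_sampleResolventErase_le hη x α) (norm_nonneg _))
  have hs := dotProduct_self_nonneg' (x α).2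
  calc |(x α).1| * ‖quadForm (sampleResolventErase η x α * D * sampleResolvent η x) (x α).2‖
      ≤ |(x α).1| * (1 / η * ‖D‖ * (1 / η) * ((x α).2 ⬝ᵥ (x α).2)) := by
        refine mul_le_mul_of_nonneg_left (h.trans ?_) (abs_nonneg _)
        exact mul_le_mul_of_nonneg_right h2 hs
    _ = _ := by field_simp

/-- The Sherman–Morrison relation between the bilinear forms of the two resolvents. -/
theorem quadForm_sampleResolvent_mul {η : ℝ} (hη : η ≠ 0) (x : Sample m n) (α : Fin m)
    (D : Matrix (Fin n) (Fin n) ℂ) :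
    quadForm (sampleResolvent η x * D) (x α).2 *
        (1 + (x α).1 * quadForm (sampleResolventErase η x α) (x α).2) =
      quadForm (sampleResolventErase η x α * D) (x α).2 := by
  have h : sampleResolvent η x = sampleResolventErase η x α + -((x α).1 : ℂ) •
      (sampleResolventErase η x α *
        vecMulVec (complexVec (x α).2) (complexVec (x α).2) * sampleResolvent η x) := by
    rw [← sampleResolvent_sub_erase' hη]; abel
  set G := sampleResolvent η x
  set G' := sampleResolventErase η x α
  set v := complexVec (x α).2 with hv
  -- The rank-one factor in the middle splits the form into a product. The relation stays
  -- multiplicative, so that no denominator has to be shown nonzero.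
  have h2 : quadForm (G' * vecMulVec v v * G * D) (x α).2 =
      quadForm G' (x α).2 * quadForm (G * D) (x α).2 := by
    rw [quadForm, ← hv, quadForm, quadForm, ← hv, Matrix.mul_assoc, Matrix.mul_assoc,
      Matrix.vecMulVec_mul, ← Matrix.mulVec_mulVec, Matrix.vecMulVec_mulVec]
    rw [← dotProduct_mulVec, Matrix.mulVec_smul]
    simp [mul_comm]
  have h3 : quadForm (G * D) (x α).2 = quadForm (G' * D) (x α).2 -
      (x α).1 * (quadForm G' (x α).2 * quadForm (G * D) (x α).2) := by
    rw [← h2]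
    conv_lhs => rw [h]
    rw [Matrix.add_mul, quadForm, quadForm, quadForm, Matrix.add_mulVec, dotProduct_add,
      smul_mul_assoc, Matrix.smul_mulVec, dotProduct_smul]
    simp [sub_eq_add_neg]
  linear_combination h3

/-- This is the trace of `L G D = D + iη G D` with `L` expanded into its rank-one terms, the
starting point of the self-consistent equation. -/
theorem trace_sampleResolvent_mul {η : ℝ} (hη : η ≠ 0) (x : Sample m n)
    (D : Matrix (Fin n) (Fin n) ℂ) :
    ∑ α, ((x α).1 : ℂ) * quadForm (sampleResolvent η x * D) (x α).2 =
      D.trace + (η * Complex.I) * (sampleResolvent η x * D).trace := by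
  have h := mul_resolventAt (sampleGram_isHermitian x) hη
  have h2 : ((sampleGram x).map Complex.ofReal * (sampleResolvent η x * D)).trace =
      D.trace + (η * Complex.I) * (sampleResolvent η x * D).trace := by
    rw [← Matrix.mul_assoc, sampleResolvent, h, Matrix.add_mul, Matrix.one_mul, Matrix.trace_add,
      smul_mul_assoc, Matrix.trace_smul, smul_eq_mul]
  rw [← h2, sampleGram_map, Finset.sum_mul, Matrix.trace_sum]
  refine Finset.sum_congr rfl fun α _ => ?_
  rw [smul_mul_assoc, Matrix.trace_smul, trace_vecMulVec_mul, smul_eq_mul]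

/-- Cramer's formula with a determinant that does not vanish. Continuity in the sample supplies all
the measurability needed later. -/
theorem continuous_sampleResolvent {η : ℝ} (hη : η ≠ 0) :
    Continuous (sampleResolvent η : Sample m n → Matrix (Fin n) (Fin n) ℂ) := by
  have hg : Continuous fun x : Sample m n => (sampleGram x).map Complex.ofReal -
      ((η : ℂ) * Complex.I) • (1 : Matrix (Fin n) (Fin n) ℂ) := by
    refine Continuous.sub ?_ continuous_const
    have : Continuous fun x : Sample m n => sampleGram x := by
      refine continuous_matrix fun i j => ?_
      simp only [sampleGram, weightedGram, Matrix.sum_apply, Matrix.smul_apply, vecMulVec_apply]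
      fun_prop
    exact this.matrix_map Complex.continuous_ofReal
  have hu : ∀ x : Sample m n, ((sampleGram x).map Complex.ofReal -
      ((η : ℂ) * Complex.I) • (1 : Matrix (Fin n) (Fin n) ℂ)).det ≠ 0 := fun x => by
    obtain ⟨-, -, -, hu⟩ := resolventAt_eq (sampleGram_isHermitian x) hη
    exact ((Matrix.isUnit_iff_isUnit_det _).1 hu).ne_zero
  have he : (sampleResolvent η : Sample m n → Matrix (Fin n) (Fin n) ℂ) = fun x =>
      ((sampleGram x).map Complex.ofReal -
        ((η : ℂ) * Complex.I) • (1 : Matrix (Fin n) (Fin n) ℂ)).det⁻¹ •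
      ((sampleGram x).map Complex.ofReal -
        ((η : ℂ) * Complex.I) • (1 : Matrix (Fin n) (Fin n) ℂ)).adjugate := by
    ext1 x
    rw [sampleResolvent, resolventAt, Matrix.inv_def, Ring.inverse_eq_inv']
  rw [he]
  exact (hg.matrix_det.inv₀ hu).smul hg.matrix_adjugate

end Resolvent

/-! ### The law of a sample and integration over one index. -/

section SampleLaw

open scoped Matrix.Norms.L2Operator

variable {n m : ℕ}

/-- The law of a sample with independent weights of law `σ` and independent vectors of laws
`μ α`. -/
def sampleLaw (σ : Measure ℝ) (μ : Fin m → Measure (Fin n → ℝ)) : Measure (Sample m n) :=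
  Measure.pi fun α => σ.prod (μ α)

variable {σ : Measure ℝ} {μ : Fin m → Measure (Fin n → ℝ)} [IsProbabilityMeasure σ]
  [∀ α, IsProbabilityMeasure (μ α)]

instance : IsProbabilityMeasure (sampleLaw σ μ) := by
  unfold sampleLaw; infer_instance

/-- The weight is made the outermost factor so that it can be integrated independently of the vector
of the same index and of all other data; the rest is a reordering of factors. -/
theorem measurePreserving_update_sample (α : Fin m) :
    MeasurePreserving
      (fun q : ℝ × (Sample m n × (Fin n → ℝ)) => Function.update q.2.1 α (q.1, q.2.2))
      (σ.prod ((sampleLaw σ μ).prod (μ α))) (sampleLaw σ μ) := by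
  have h1 := measurePreserving_update (fun α => σ.prod (μ α)) α
  have h2 : MeasurePreserving (fun q : ℝ × (Sample m n × (Fin n → ℝ)) => ((q.1, q.2.1), q.2.2))
      (σ.prod ((sampleLaw σ μ).prod (μ α))) ((σ.prod (sampleLaw σ μ)).prod (μ α)) :=
    (measurePreserving_prodAssoc σ (sampleLaw σ μ) (μ α)).symm
  have h3 : MeasurePreserving
      (fun q : (ℝ × Sample m n) × (Fin n → ℝ) => ((q.1.2, q.1.1), q.2))
      ((σ.prod (sampleLaw σ μ)).prod (μ α)) (((sampleLaw σ μ).prod σ).prod (μ α)) :=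
    (Measure.measurePreserving_swap (μ := σ) (ν := sampleLaw σ μ)).prod
      (MeasurePreserving.id (μ α))
  have h4 : MeasurePreserving
      (fun q : (Sample m n × ℝ) × (Fin n → ℝ) => (q.1.1, (q.1.2, q.2)))
      (((sampleLaw σ μ).prod σ).prod (μ α)) ((sampleLaw σ μ).prod (σ.prod (μ α))) :=
    measurePreserving_prodAssoc (sampleLaw σ μ) σ (μ α)
  exact h1.comp (h4.comp (h3.comp h2))

theorem measurePreserving_eval_sample (α : Fin m) :
    MeasurePreserving (fun x : Sample m n => x α) (sampleLaw σ μ) (σ.prod (μ α)) :=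
  measurePreserving_eval (fun α => σ.prod (μ α)) α

theorem measurePreserving_vector (α : Fin m) :
    MeasurePreserving (fun x : Sample m n => (x α).2) (sampleLaw σ μ) (μ α) :=
  measurePreserving_snd.comp (measurePreserving_eval_sample α)

theorem MeasureTheory.MeasurePreserving.integral_comp_of_aestronglyMeasurable {X Y E : Type*}
    [MeasurableSpace X]
    [MeasurableSpace Y] [NormedAddCommGroup E] [NormedSpace ℝ E] {μ : Measure X} {ν : Measure Y}
    {f : X → Y} (hf : MeasurePreserving f μ ν) {g : Y → E} (hg : AEStronglyMeasurable g ν) :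
    ∫ x, g (f x) ∂μ = ∫ y, g y ∂ν := by
  rw [← hf.map_eq] at hg ⊢
  exact (integral_map hf.aemeasurable hg).symm

/-- A weight is independent of every function of the other data. -/
theorem integral_weight_mul {𝕜 : Type*} [RCLike 𝕜] (α : Fin m) {g : ℝ → 𝕜} (hg : Measurable g)
    {U : Sample m n → 𝕜} (hUm : Measurable U)
    (hU : ∀ x a y, U (Function.update x α (a, y)) = U (Function.update x α (0, y))) :
    ∫ x, g (x α).1 * U x ∂sampleLaw σ μ = (∫ a, g a ∂σ) * ∫ x, U x ∂sampleLaw σ μ := by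
  have key : ∀ h : ℝ → 𝕜, Measurable h → ∫ x, h (x α).1 * U x ∂sampleLaw σ μ =
      (∫ a, h a ∂σ) * ∫ p, U (Function.update p.1 α (0, p.2)) ∂(sampleLaw σ μ).prod (μ α) := by
    intro h hh
    have hm : Measurable fun x : Sample m n => h (x α).1 * U x :=
      (hh.comp (measurable_fst.comp (measurable_pi_apply α))).mul hUm
    rw [← (measurePreserving_update_sample (σ := σ) (μ := μ)
      α).integral_comp_of_aestronglyMeasurable hm.aestronglyMeasurable]
    simp only [Function.update_self, hU]
    exact integral_prod_mul h fun p : Sample m n × (Fin n → ℝ) =>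
      U (Function.update p.1 α (0, p.2))
  -- The choice `g = 1` identifies the second factor with the integral of `U`.
  have h1 := key (fun _ => 1) measurable_const
  simp only [one_mul, integral_const, probReal_univ, one_smul] at h1
  rw [key g hg, h1]

theorem integrable_weight_mul {𝕜 : Type*} [RCLike 𝕜] (α : Fin m) {g : ℝ → 𝕜} (hg : Integrable g σ)
    (hgm : Measurable g) {U : Sample m n → 𝕜} (hUm : Measurable U)
    (hUi : Integrable U (sampleLaw σ μ))
    (hU : ∀ x a y, U (Function.update x α (a, y)) = U (Function.update x α (0, y))) :
    Integrable (fun x => g (x α).1 * U x) (sampleLaw σ μ) := by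
  have hT := measurePreserving_update_sample (σ := σ) (μ := μ) α
  have hm : Measurable fun x : Sample m n => g (x α).1 * U x :=
    (hgm.comp (measurable_fst.comp (measurable_pi_apply α))).mul hUm
  rw [← hT.integrable_comp hm.aestronglyMeasurable]
  have h1 := (hT.integrable_comp hUm.aestronglyMeasurable).2 hUi
  have h2 : Integrable (fun p : Sample m n × (Fin n → ℝ) => U (Function.update p.1 α (0, p.2)))
      ((sampleLaw σ μ).prod (μ α)) := by
    have hmm : Measurable fun p : Sample m n × (Fin n → ℝ) => U (Function.update p.1 α (0, p.2)) :=
      hUm.comp (hT.measurable.comp (measurable_const.prodMk measurable_id) :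
        Measurable fun p : Sample m n × (Fin n → ℝ) => Function.update p.1 α ((0 : ℝ), p.2))
    rw [← (measurePreserving_snd (μ := σ)).integrable_comp hmm.aestronglyMeasurable]
    refine h1.congr (Eventually.of_forall fun q => ?_)
    simp only [Function.comp]
    exact hU _ _ _
  refine (hg.mul_prod h2).congr (Eventually.of_forall fun q => ?_)
  simp only [Function.comp, Function.update_self]
  exact congrArg _ (hU _ _ _).symm

/-- The data attached to one index can be integrated first. -/
theorem integral_resample {E : Type*} [NormedAddCommGroup E] [NormedSpace ℝ E] (α : Fin m)
    {f : Sample m n → E} (hf : Integrable f (sampleLaw σ μ)) :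
    Integrable (fun x => ∫ e, f (Function.update x α e) ∂σ.prod (μ α)) (sampleLaw σ μ) ∧
    ∫ x, f x ∂sampleLaw σ μ =
      ∫ x, ∫ e, f (Function.update x α e) ∂σ.prod (μ α) ∂sampleLaw σ μ := by
  have hT : MeasurePreserving (fun p : Sample m n × (ℝ × (Fin n → ℝ)) => Function.update p.1 α p.2)
      ((sampleLaw σ μ).prod (σ.prod (μ α))) (sampleLaw σ μ) :=
    measurePreserving_update (fun α => σ.prod (μ α)) α
  have hi := (hT.integrable_comp hf.aestronglyMeasurable).2 hf
  refine ⟨hi.integral_prod_left, ?_⟩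
  rw [← hT.integral_comp_of_aestronglyMeasurable hf.aestronglyMeasurable]
  exact integral_prod _ hi

theorem integral_vector {E : Type*} [NormedAddCommGroup E] [NormedSpace ℝ E] (α : Fin m)
    {f : (Fin n → ℝ) → E} (hf : AEStronglyMeasurable f (μ α)) :
    ∫ e, f e.2 ∂σ.prod (μ α) = ∫ y, f y ∂μ α :=
  measurePreserving_snd.integral_comp_of_aestronglyMeasurable hf

theorem continuous_quadForm {X : Type*} [TopologicalSpace X] {M : X → Matrix (Fin n) (Fin n) ℂ}
    {y : X → Fin n → ℝ} (hM : Continuous M) (hy : Continuous y) :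
    Continuous fun x => quadForm (M x) (y x) := by
  simp only [quadForm_eq_sum]
  have h : ∀ i j, Continuous fun x => M x i j := fun i j =>
    (continuous_apply j).comp ((continuous_apply i).comp hM)
  have h' : ∀ i, Continuous fun x => y x i := fun i => (continuous_apply i).comp hy
  exact continuous_finsetSum _ fun i _ => continuous_finsetSum _ fun j _ =>
    (h i j).mul (Complex.continuous_ofReal.comp ((h' i).mul (h' j)))

theorem continuous_sampleResolventErase {η : ℝ} (hη : η ≠ 0) (α : Fin m) :
    Continuous fun x : Sample m n => sampleResolventErase η x α :=
  (continuous_sampleResolvent hη).comp (continuous_id.update α continuous_const)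

end SampleLaw

/-! ### Quantitative assumptions at fixed size and their first consequences. -/

section SampleEstimates

set_option linter.unusedSectionVars false

open scoped Matrix.Norms.L2Operator

variable {n m : ℕ}

/-- Quantitative assumptions on the laws of the weights and of the vectors at fixed size. -/
structure SampleBounds (σ : Measure ℝ) (μ : Fin m → Measure (Fin n → ℝ))
    (Q : Fin m → Matrix (Fin n) (Fin n) ℝ) (C τ : ℝ) : Prop where
  one_le_n : 1 ≤ n
  one_le_m : 1 ≤ m
  one_le_C : 1 ≤ C
  nonneg : 0 ≤ τ
  le_one : τ ≤ 1
  integrable_sq : Integrable (fun a => a ^ 2) σ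
  weight_sq : (m / n : ℝ) * ∫ a, a ^ 2 ∂σ ≤ C
  weight_mean : |(m / n : ℝ) * ∫ a, a ∂σ| ≤ C
  integrable_vector : ∀ α, Integrable (fun y => (y ⬝ᵥ y) ^ 2) (μ α)
  vector_sq : ∀ α, ∫ y, (y ⬝ᵥ y) ^ 2 ∂μ α ≤ 4
  second_moment : ∀ α i j, ∫ y, y i * y j ∂μ α = Q α i j
  concentration : ∀ α (D : Matrix (Fin n) (Fin n) ℝ), opNorm D ≤ 1 →
    ∫ y, ((D *ᵥ y) ⬝ᵥ y - ∫ y', (D *ᵥ y') ⬝ᵥ y' ∂μ α) ^ 2 ∂μ α ≤ τ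
  opNorm_le : ∀ α, opNorm (Q α) ≤ C / n
  trace_le : ∀ α, |(Q α).trace - 1| ≤ τ
  mean_le : hsNorm ((m : ℝ)⁻¹ • (∑ α, Q α) - (n : ℝ)⁻¹ • (1 : Matrix (Fin n) (Fin n) ℝ)) ≤ τ / √n

variable {σ : Measure ℝ} {μ : Fin m → Measure (Fin n → ℝ)} [IsProbabilityMeasure σ]
  [∀ α, IsProbabilityMeasure (μ α)] {Q : Fin m → Matrix (Fin n) (Fin n) ℝ} {C τ : ℝ}

namespace SampleBounds

variable (h : SampleBounds σ μ Q C τ)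
include h

theorem n_pos : (0 : ℝ) < n := by exact_mod_cast h.one_le_n

theorem m_pos : (0 : ℝ) < m := by exact_mod_cast h.one_le_m

theorem C_pos : 0 < C := zero_lt_one.trans_le h.one_le_C

theorem integrable_id : Integrable (fun a => a) σ := by
  refine (h.integrable_sq.add (integrable_const 1)).mono' measurable_id.aestronglyMeasurable
    (Eventually.of_forall fun a => ?_)
  simp only [Real.norm_eq_abs, Pi.add_apply]
  nlinarith [sq_nonneg (|a| - 1), sq_abs a]

theorem weight_sq' : m * ∫ a, a ^ 2 ∂σ ≤ C * n := by
  have := h.weight_sq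
  rw [div_mul_eq_mul_div, div_le_iff₀ h.n_pos] at this
  exact this

theorem weight_sq_le : ∫ a, a ^ 2 ∂σ ≤ C * n := by
  refine le_trans ?_ h.weight_sq'
  have h0 : 0 ≤ ∫ a, a ^ 2 ∂σ := integral_nonneg fun a => sq_nonneg a
  have : (1 : ℝ) ≤ m := by exact_mod_cast h.one_le_m
  nlinarith

/-- From `|a| ≤ (√n + a²/√n) / 2`, balanced for a second moment of order `n`, the largest that
`weight_sq` allows when `m` stays bounded. -/
theorem weight_abs_le : ∫ a, |a| ∂σ ≤ C * √n := by
  have hn := Real.sqrt_pos.2 h.n_pos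
  have hs := Real.sq_sqrt h.n_pos.le
  have h1 : ∫ a, |a| ∂σ ≤ ∫ a, (√n / 2 + (a ^ 2) * (1 / (2 * √n))) ∂σ := by
    refine integral_mono h.integrable_id.abs
      ((integrable_const _).add (h.integrable_sq.mul_const _)) fun a => ?_
    have : √n / 2 + a ^ 2 * (1 / (2 * √n)) - |a| = (√n - |a|) ^ 2 / (2 * √n) := by
      rw [← sq_abs a]; field_simp; ring
    have h2 : 0 ≤ (√n - |a|) ^ 2 / (2 * √n) := by positivity
    linarith
  rw [integral_add (integrable_const _) (h.integrable_sq.mul_const _), integral_mul_const] at h1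
  simp only [integral_const, probReal_univ, one_smul] at h1
  have h2 : (∫ a, a ^ 2 ∂σ) * (1 / (2 * √n)) ≤ C * n * (1 / (2 * √n)) :=
    mul_le_mul_of_nonneg_right h.weight_sq_le (by positivity)
  have h3 : C * n * (1 / (2 * √n)) = C * √n / 2 := by
    field_simp; rw [hs]
  nlinarith [h.one_le_C]

theorem integrable_normSq (α : Fin m) : Integrable (fun y => y ⬝ᵥ y) (μ α) := by
  have hc : Continuous fun y : Fin n → ℝ => y ⬝ᵥ y := by fun_prop
  refine ((h.integrable_vector α).add (integrable_const 1)).mono' hc.aestronglyMeasurable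
    (Eventually.of_forall fun y => ?_)
  simp only [Real.norm_eq_abs, Pi.add_apply]
  nlinarith [sq_nonneg (|y ⬝ᵥ y| - 1), sq_abs (y ⬝ᵥ y)]

theorem integral_normSq_le (α : Fin m) : ∫ y, y ⬝ᵥ y ∂μ α ≤ 2 := by
  have h1 : ∫ y, y ⬝ᵥ y ∂μ α ≤ ∫ y, (1 + (y ⬝ᵥ y) ^ 2 * (1 / 4)) ∂μ α := by
    refine integral_mono (h.integrable_normSq α)
      ((integrable_const _).add ((h.integrable_vector α).mul_const _)) fun y => ?_
    simp only
    nlinarith [sq_nonneg (y ⬝ᵥ y - 2)]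
  rw [integral_add (integrable_const _) ((h.integrable_vector α).mul_const _),
    integral_mul_const] at h1
  simp only [integral_const, probReal_univ, one_smul] at h1
  linarith [h.vector_sq α]

theorem integrable_coord_mul (α : Fin m) (i j : Fin n) :
    Integrable (fun y : Fin n → ℝ => y i * y j) (μ α) := by
  have hc : Continuous fun y : Fin n → ℝ => y i * y j := by fun_prop
  refine (h.integrable_normSq α).mono' hc.aestronglyMeasurable (Eventually.of_forall fun y => ?_)
  have hle : ∀ k, y k ^ 2 ≤ y ⬝ᵥ y := fun k => by
    rw [dotProduct, sq]
    exact Finset.single_le_sum (f := fun k => y k * y k) (fun k _ => mul_self_nonneg _)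
      (Finset.mem_univ k)
  rw [Real.norm_eq_abs, abs_mul]
  nlinarith [hle i, hle j, sq_nonneg (|y i| - |y j|), sq_abs (y i), sq_abs (y j)]

theorem Q_symm (α : Fin m) (i j : Fin n) : Q α i j = Q α j i := by
  rw [← h.second_moment, ← h.second_moment]
  simp only [mul_comm]

theorem integral_quadForm (α : Fin m) (M : Matrix (Fin n) (Fin n) ℂ) :
    ∫ y, quadForm M y ∂μ α = ((Q α).map Complex.ofReal * M).trace := by
  simp only [quadForm_eq_sum]
  have hi : ∀ i j, Integrable (fun y : Fin n → ℝ => M i j * ((y i * y j : ℝ) : ℂ)) (μ α) :=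
    fun i j => ((h.integrable_coord_mul α i j).ofReal (𝕜 := ℂ)).const_mul _
  rw [integral_finsetSum _ fun i _ => integrable_finsetSum _ fun j _ => hi i j]
  simp only [Matrix.trace, Matrix.diag, Matrix.mul_apply, Matrix.map_apply]
  rw [Finset.sum_comm]
  rw [Finset.sum_congr rfl fun i _ => integral_finsetSum _ fun j _ => hi i j]
  refine Finset.sum_congr rfl fun i _ => Finset.sum_congr rfl fun j _ => ?_
  rw [integral_const_mul, integral_complex_ofReal, h.second_moment, h.Q_symm, mul_comm]

end SampleBounds

end SampleEstimates

/-! ### Concentration of traces and of quadratic forms. -/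

section SampleConcentration

open scoped Matrix.Norms.L2Operator

set_option linter.unusedSectionVars false

variable {n m : ℕ}

/-- Splitting into real and imaginary parts makes the real Efron–Stein inequality applicable to
traces of resolvents. -/
theorem integral_norm_sub_integral_sq_eq {X : Type*} [MeasurableSpace X] {ρ : Measure X}
    [IsProbabilityMeasure ρ] {F : X → ℂ} (hF : Measurable F) {B : ℝ} (hB : ∀ x, ‖F x‖ ≤ B) :
    ∫ x, ‖F x - ∫ x', F x' ∂ρ‖ ^ 2 ∂ρ =
      (∫ x, (F x).re ^ 2 ∂ρ - (∫ x, (F x).re ∂ρ) ^ 2) +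
        (∫ x, (F x).im ^ 2 ∂ρ - (∫ x, (F x).im ∂ρ) ^ 2) := by
  have hFi : Integrable F ρ := Integrable.of_bound hF.aestronglyMeasurable B
    (Eventually.of_forall hB)
  have mr : Measurable fun x => (F x).re := Complex.measurable_re.comp hF
  have mi : Measurable fun x => (F x).im := Complex.measurable_im.comp hF
  have br : ∀ x, |(F x).re| ≤ B := fun x => (Complex.abs_re_le_norm _).trans (hB x)
  have bi : ∀ x, |(F x).im| ≤ B := fun x => (Complex.abs_im_le_norm _).trans (hB x)
  have ir := integrable_of_forall_abs_le (μ := ρ) mr br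
  have ii := integrable_of_forall_abs_le (μ := ρ) mi bi
  have ir2 : Integrable (fun x => (F x).re ^ 2) ρ := integrable_of_forall_abs_le
    (mr.pow_const 2) fun x => abs_sq_le_sq_of_abs_le (br x)
  have ii2 : Integrable (fun x => (F x).im ^ 2) ρ := integrable_of_forall_abs_le
    (mi.pow_const 2) fun x => abs_sq_le_sq_of_abs_le (bi x)
  set c := ∫ x', F x' ∂ρ
  have hcr : c.re = ∫ x, (F x).re ∂ρ := (integral_re (𝕜 := ℂ) hFi).symm
  have hci : c.im = ∫ x, (F x).im ∂ρ := (integral_im (𝕜 := ℂ) hFi).symm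
  have e : (fun x => ‖F x - c‖ ^ 2) = fun x => ((F x).re - c.re) ^ 2 + ((F x).im - c.im) ^ 2 := by
    ext x
    rw [Complex.sq_norm, Complex.normSq_apply, Complex.sub_re, Complex.sub_im]
    ring
  have ir3 : Integrable (fun x => ((F x).re - c.re) ^ 2) ρ := integrable_of_forall_abs_le
    ((mr.sub_const _).pow_const 2) (C := (B + |c.re|) ^ 2) fun x => abs_sq_le_sq_of_abs_le
      ((abs_sub _ _).trans (add_le_add_left (br x) _))
  have ii3 : Integrable (fun x => ((F x).im - c.im) ^ 2) ρ := integrable_of_forall_abs_le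
    ((mi.sub_const _).pow_const 2) (C := (B + |c.im|) ^ 2) fun x => abs_sq_le_sq_of_abs_le
      ((abs_sub _ _).trans (add_le_add_left (bi x) _))
  rw [e, integral_add ir3 ii3, integral_sub_const_sq ir ir2, integral_sub_const_sq ii ii2, hcr, hci]
  ring

variable {σ : Measure ℝ} {μ : Fin m → Measure (Fin n → ℝ)} [IsProbabilityMeasure σ]
  [∀ α, IsProbabilityMeasure (μ α)] {Q : Fin m → Matrix (Fin n) (Fin n) ℝ} {C τ : ℝ}

theorem integrable_of_continuous_of_norm_le {E : Type*} [NormedAddCommGroup E]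
    [SecondCountableTopology E] [MeasurableSpace E] [BorelSpace E]
    {f : Sample m n → E} (hf : Continuous f) {B : ℝ} (hB : ∀ x, ‖f x‖ ≤ B) :
    Integrable f (sampleLaw σ μ) :=
  Integrable.of_bound hf.measurable.aestronglyMeasurable B (Eventually.of_forall hB)

theorem continuous_trace_sampleResolvent_mul {η : ℝ} (hη : η ≠ 0) (D : Matrix (Fin n) (Fin n) ℂ) :
    Continuous fun x : Sample m n => (sampleResolvent η x * D).trace :=
  ((continuous_sampleResolvent hη).matrix_mul continuous_const).matrix_trace

theorem norm_trace_sampleResolvent_mul_le {η : ℝ} (hη : 0 < η) (D : Matrix (Fin n) (Fin n) ℂ)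
    (x : Sample m n) : ‖(sampleResolvent η x * D).trace‖ ≤ n * (1 / η * ‖D‖) := by
  refine (norm_trace_le _).trans (mul_le_mul_of_nonneg_left ?_ (Nat.cast_nonneg n))
  exact (norm_mul_le _ _).trans (mul_le_mul_of_nonneg_right (norm_sampleResolvent_le hη x)
    (norm_nonneg _))

theorem integrable_trace {η : ℝ} (hη : 0 < η) (D : Matrix (Fin n) (Fin n) ℂ) :
    Integrable (fun x : Sample m n => (sampleResolvent η x * D).trace) (sampleLaw σ μ) :=
  integrable_of_continuous_of_norm_le (continuous_trace_sampleResolvent_mul hη.ne' D)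
    (norm_trace_sampleResolvent_mul_le hη D)

theorem integrable_trace_erase {η : ℝ} (hη : 0 < η) (D : Matrix (Fin n) (Fin n) ℂ) (α : Fin m) :
    Integrable (fun x : Sample m n => (sampleResolventErase η x α * D).trace) (sampleLaw σ μ) :=
  integrable_of_continuous_of_norm_le
    ((continuous_trace_sampleResolvent_mul hη.ne' D).comp (continuous_id.update α continuous_const))
    fun _ => norm_trace_sampleResolvent_mul_le hη D _

theorem continuous_normSq (α : Fin m) :
    Continuous fun x : Sample m n => (x α).2 ⬝ᵥ (x α).2 := by fun_prop

theorem continuous_weight (α : Fin m) : Continuous fun x : Sample m n => (x α).1 := by fun_prop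

namespace SampleBounds

variable (h : SampleBounds σ μ Q C τ)
include h

theorem integrable_normSq_sq (α : Fin m) :
    Integrable (fun x : Sample m n => ((x α).2 ⬝ᵥ (x α).2) ^ 2) (sampleLaw σ μ) :=
  ((measurePreserving_vector (σ := σ) (μ := μ) α).integrable_comp
    (h.integrable_vector α).aestronglyMeasurable).2 (h.integrable_vector α)

theorem integral_normSq_sq_le (α : Fin m) :
    ∫ x : Sample m n, ((x α).2 ⬝ᵥ (x α).2) ^ 2 ∂sampleLaw σ μ ≤ 4 := by
  rw [(measurePreserving_vector (σ := σ) (μ := μ) α).integral_comp_of_aestronglyMeasurable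
    (h.integrable_vector α).aestronglyMeasurable]
  exact h.vector_sq α

theorem integrable_sample_normSq (α : Fin m) :
    Integrable (fun x : Sample m n => (x α).2 ⬝ᵥ (x α).2) (sampleLaw σ μ) :=
  ((measurePreserving_vector (σ := σ) (μ := μ) α).integrable_comp
    (h.integrable_normSq α).aestronglyMeasurable).2 (h.integrable_normSq α)

theorem integral_sample_normSq_le (α : Fin m) :
    ∫ x : Sample m n, (x α).2 ⬝ᵥ (x α).2 ∂sampleLaw σ μ ≤ 2 := by
  rw [(measurePreserving_vector (σ := σ) (μ := μ) α).integral_comp_of_aestronglyMeasurable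
    (h.integrable_normSq α).aestronglyMeasurable]
  exact h.integral_normSq_le α

theorem integrable_weight_sq_mul (α : Fin m) :
    Integrable (fun x : Sample m n => (x α).1 ^ 2 * ((x α).2 ⬝ᵥ (x α).2) ^ 2) (sampleLaw σ μ) :=
  integrable_weight_mul α h.integrable_sq (by fun_prop)
    ((continuous_normSq α).pow 2).measurable (h.integrable_normSq_sq α) (by simp)

theorem integral_weight_sq_mul_le (α : Fin m) :
    ∫ x : Sample m n, (x α).1 ^ 2 * ((x α).2 ⬝ᵥ (x α).2) ^ 2 ∂sampleLaw σ μ ≤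
      (∫ a, a ^ 2 ∂σ) * 4 := by
  rw [integral_weight_mul (𝕜 := ℝ) α (g := fun a => a ^ 2) (by fun_prop)
    (U := fun x => ((x α).2 ⬝ᵥ (x α).2) ^ 2) ((continuous_normSq α).pow 2).measurable (by simp)]
  exact mul_le_mul_of_nonneg_left (h.integral_normSq_sq_le α)
    (integral_nonneg fun a => sq_nonneg a)

theorem integral_norm_trace_sub_erase_sq_le {η : ℝ} (hη : 0 < η) (D : Matrix (Fin n) (Fin n) ℂ)
    (α : Fin m) :
    ∫ x, ‖(sampleResolvent η x * D).trace - (sampleResolventErase η x α * D).trace‖ ^ 2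
      ∂sampleLaw σ μ ≤ (‖D‖ / η ^ 2) ^ 2 * ((∫ a, a ^ 2 ∂σ) * 4) := by
  calc _ ≤ ∫ x : Sample m n, (‖D‖ / η ^ 2) ^ 2 * ((x α).1 ^ 2 * ((x α).2 ⬝ᵥ (x α).2) ^ 2)
        ∂sampleLaw σ μ := by
        refine integral_mono_of_nonneg (Eventually.of_forall fun x => sq_nonneg _)
          ((h.integrable_weight_sq_mul α).const_mul _) (Eventually.of_forall fun x => ?_)
        have := pow_le_pow_left₀ (norm_nonneg _) (norm_trace_mul_sub_erase_le hη x α D) 2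
        rw [mul_pow, mul_pow, sq_abs] at this
        exact this
    _ ≤ _ := by
        rw [integral_const_mul]
        exact mul_le_mul_of_nonneg_left (h.integral_weight_sq_mul_le α) (sq_nonneg _)

/-- By Efron–Stein each index contributes at most `(‖D‖/η²)² · 4 E ξ²`, and the `m` contributions
are controlled by `m E ξ² ≤ C n`. After normalization by `n`, or for `D = Q_α` with norm `O(1/n)`,
the variance is `O(1/n)`. -/
theorem variance_trace_le {η : ℝ} (hη : 0 < η) (D : Matrix (Fin n) (Fin n) ℂ) :
    ∫ x, ‖(sampleResolvent η x * D).trace -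
        ∫ x', (sampleResolvent η x' * D).trace ∂sampleLaw σ μ‖ ^ 2 ∂sampleLaw σ μ ≤
      (‖D‖ / η ^ 2) ^ 2 * (4 * C * n) := by
  set F : Sample m n → ℂ := fun x => (sampleResolvent η x * D).trace with hF
  have hFc : Continuous F := continuous_trace_sampleResolvent_mul hη.ne' D
  have hFb : ∀ x, ‖F x‖ ≤ n * (1 / η * ‖D‖) := norm_trace_sampleResolvent_mul_le hη D
  have hFe : ∀ α, Continuous fun x : Sample m n => F (Function.update x α 0) := fun α =>
    hFc.comp (continuous_id.update α continuous_const)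
  have hdi : ∀ α, Integrable (fun x => ‖F x - F (Function.update x α 0)‖ ^ 2)
      (sampleLaw σ μ) := fun α =>
    integrable_of_continuous_of_norm_le (((hFc.sub (hFe α)).norm).pow 2)
      (B := (n * (1 / η * ‖D‖) + n * (1 / η * ‖D‖)) ^ 2) fun x => by
        rw [norm_pow, norm_norm]
        exact pow_le_pow_left₀ (norm_nonneg _)
          ((norm_sub_le _ _).trans (add_le_add (hFb _) (hFb _))) 2
  have hri : ∀ α, Integrable (fun x => ((F x).re - (F (Function.update x α 0)).re) ^ 2)
      (sampleLaw σ μ) := fun α => (hdi α).mono'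
    ((((Complex.continuous_re.comp hFc).sub (Complex.continuous_re.comp (hFe α))).pow
      2).aestronglyMeasurable) (Eventually.of_forall fun x => by
        rw [Real.norm_eq_abs, abs_pow, ← Complex.sub_re]
        exact pow_le_pow_left₀ (abs_nonneg _) (Complex.abs_re_le_norm _) 2)
  have hii : ∀ α, Integrable (fun x => ((F x).im - (F (Function.update x α 0)).im) ^ 2)
      (sampleLaw σ μ) := fun α => (hdi α).mono'
    ((((Complex.continuous_im.comp hFc).sub (Complex.continuous_im.comp (hFe α))).pow
      2).aestronglyMeasurable) (Eventually.of_forall fun x => by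
        rw [Real.norm_eq_abs, abs_pow, ← Complex.sub_im]
        exact pow_le_pow_left₀ (abs_nonneg _) (Complex.abs_im_le_norm _) 2)
  have h1 := efronStein (0 : ℝ × (Fin n → ℝ)) (fun α => σ.prod (μ α)) (F := fun x => (F x).re)
    (Complex.continuous_re.comp hFc).measurable
    (fun x => (Complex.abs_re_le_norm _).trans (hFb x))
  have h2 := efronStein (0 : ℝ × (Fin n → ℝ)) (fun α => σ.prod (μ α)) (F := fun x => (F x).im)
    (Complex.continuous_im.comp hFc).measurable
    (fun x => (Complex.abs_im_le_norm _).trans (hFb x))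
  rw [integral_norm_sub_integral_sq_eq hFc.measurable hFb]
  refine (add_le_add h1 h2).trans ?_
  rw [← Finset.sum_add_distrib]
  have h3 : ∀ α : Fin m, (∫ x, ((F x).re - (F (Function.update x α 0)).re) ^ 2 ∂sampleLaw σ μ) +
      (∫ x, ((F x).im - (F (Function.update x α 0)).im) ^ 2 ∂sampleLaw σ μ) ≤
      (‖D‖ / η ^ 2) ^ 2 * ((∫ a, a ^ 2 ∂σ) * 4) := by
    intro α
    rw [← integral_add (hri α) (hii α)]
    refine le_trans (le_of_eq ?_) (h.integral_norm_trace_sub_erase_sq_le hη D α)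
    refine integral_congr_ae (Eventually.of_forall fun x => ?_)
    change _ = ‖F x - F (Function.update x α 0)‖ ^ 2
    rw [Complex.sq_norm, Complex.normSq_apply, Complex.sub_re, Complex.sub_im]
    simp only
    ring
  refine (Finset.sum_le_sum fun α _ => h3 α).trans ?_
  rw [Finset.sum_const, Finset.card_univ, Fintype.card_fin, nsmul_eq_mul]
  have := h.weight_sq'
  have h0 := sq_nonneg (‖D‖ / η ^ 2)
  nlinarith

theorem concentration_scaled (α : Fin m) {D : Matrix (Fin n) (Fin n) ℝ} {K : ℝ} (hK : 0 < K)
    (hD : opNorm D ≤ K) :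
    ∫ y, ((D *ᵥ y) ⬝ᵥ y - ∫ y', (D *ᵥ y') ⬝ᵥ y' ∂μ α) ^ 2 ∂μ α ≤ K ^ 2 * τ := by
  have h1 := h.concentration α (K⁻¹ • D) (by
    rw [opNorm_smul, abs_of_pos (inv_pos.2 hK), inv_mul_le_iff₀ hK, mul_one]; exact hD)
  have e : ∀ y : Fin n → ℝ, ((K⁻¹ • D) *ᵥ y) ⬝ᵥ y = K⁻¹ * ((D *ᵥ y) ⬝ᵥ y) := fun y => by
    rw [Matrix.smul_mulVec, smul_dotProduct, smul_eq_mul]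
  simp only [e, integral_const_mul, ← mul_sub, mul_pow] at h1
  rw [inv_pow, inv_mul_le_iff₀ (by positivity)] at h1
  exact h1

theorem integrable_quadForm (α : Fin m) (M : Matrix (Fin n) (Fin n) ℂ) :
    Integrable (fun y => quadForm M y) (μ α) := by
  refine ((h.integrable_normSq α).const_mul ‖M‖).mono'
    (continuous_quadForm continuous_const continuous_id).aestronglyMeasurable
    (Eventually.of_forall fun y => norm_quadForm_le M y)

/-- The factor 2 comes from treating the real and imaginary parts of `M` separately, each of
operator norm at most `K`. -/
theorem concentration_complex (α : Fin m) {M : Matrix (Fin n) (Fin n) ℂ} {K : ℝ} (hK : 0 < K)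
    (hM : ‖M‖ ≤ K) :
    ∫ y, ‖quadForm M y - ((Q α).map Complex.ofReal * M).trace‖ ^ 2 ∂μ α ≤ 2 * K ^ 2 * τ := by
  have hi := h.integrable_quadForm α M
  have hr := h.concentration_scaled α hK ((opNorm_map_re_le M).trans hM)
  have hI := h.concentration_scaled α hK ((opNorm_map_im_le M).trans hM)
  rw [← h.integral_quadForm]
  simp only [← re_quadForm, ← im_quadForm] at hr hI
  have e1 : ∫ y, (quadForm M y).re ∂μ α = (∫ y, quadForm M y ∂μ α).re := integral_re (𝕜 := ℂ) hi
  have e2 : ∫ y, (quadForm M y).im ∂μ α = (∫ y, quadForm M y ∂μ α).im := integral_im (𝕜 := ℂ) hi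
  rw [e1] at hr
  rw [e2] at hI
  set c := ∫ y, quadForm M y ∂μ α
  have hc : Continuous fun y : Fin n → ℝ => quadForm M y :=
    continuous_quadForm continuous_const continuous_id
  have hmaj : Integrable (fun y => ‖M‖ ^ 2 * (2 * (y ⬝ᵥ y) ^ 2) + 2 * ‖c‖ ^ 2) (μ α) :=
    (((h.integrable_vector α).const_mul 2).const_mul _).add (integrable_const _)
  have hb : ∀ y, ‖quadForm M y - c‖ ^ 2 ≤ ‖M‖ ^ 2 * (2 * (y ⬝ᵥ y) ^ 2) + 2 * ‖c‖ ^ 2 := by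
    intro y
    have h1 := norm_sub_le (quadForm M y) c
    have h2 := norm_quadForm_le M y
    have h3 := pow_le_pow_left₀ (norm_nonneg _) h1 2
    have h4 := pow_le_pow_left₀ (norm_nonneg _) h2 2
    nlinarith [sq_nonneg (‖quadForm M y‖ - ‖c‖)]
  have ir : Integrable (fun y => ((quadForm M y).re - c.re) ^ 2) (μ α) := hmaj.mono'
    (((Complex.continuous_re.comp hc).sub continuous_const).pow 2).aestronglyMeasurable
    (Eventually.of_forall fun y => by
      rw [Real.norm_eq_abs, abs_pow, ← Complex.sub_re]
      exact (pow_le_pow_left₀ (abs_nonneg _) (Complex.abs_re_le_norm _) 2).trans (hb y))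
  have ii : Integrable (fun y => ((quadForm M y).im - c.im) ^ 2) (μ α) := hmaj.mono'
    (((Complex.continuous_im.comp hc).sub continuous_const).pow 2).aestronglyMeasurable
    (Eventually.of_forall fun y => by
      rw [Real.norm_eq_abs, abs_pow, ← Complex.sub_im]
      exact (pow_le_pow_left₀ (abs_nonneg _) (Complex.abs_im_le_norm _) 2).trans (hb y))
  have e : (fun y => ‖quadForm M y - c‖ ^ 2) =
      fun y => ((quadForm M y).re - c.re) ^ 2 + ((quadForm M y).im - c.im) ^ 2 := by
    ext y
    rw [Complex.sq_norm, Complex.normSq_apply, Complex.sub_re, Complex.sub_im]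
    ring
  rw [e, integral_add ir ii]
  linarith

end SampleBounds

end SampleConcentration

/-! ### Replacing quadratic forms by the mean normalized trace. -/

section SelfConsistent

open scoped Matrix.Norms.L2Operator

set_option linter.unusedSectionVars false

variable {n m : ℕ}

/-- The normalized expected trace `n⁻¹ E tr (G D)`. -/
def meanTrace (σ : Measure ℝ) (μ : Fin m → Measure (Fin n → ℝ)) (η : ℝ)
    (D : Matrix (Fin n) (Fin n) ℂ) : ℂ :=
  (n : ℂ)⁻¹ * ∫ x, (sampleResolvent η x * D).trace ∂sampleLaw σ μ

/-- The bilinear form of the resolvent without `y_α` at `y_α`. -/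
def eraseForm (η : ℝ) (α : Fin m) (x : Sample m n) : ℂ :=
  quadForm (sampleResolventErase η x α) (x α).2

theorem continuous_eraseForm {η : ℝ} (hη : η ≠ 0) (α : Fin m) :
    Continuous (eraseForm η α : Sample m n → ℂ) :=
  continuous_quadForm (continuous_sampleResolventErase hη α)
    (continuous_snd.comp (continuous_apply α))

theorem norm_eraseForm_le {η : ℝ} (hη : 0 < η) (α : Fin m) (x : Sample m n) :
    ‖eraseForm η α x‖ ≤ 1 / η * ((x α).2 ⬝ᵥ (x α).2) :=
  (norm_quadForm_le _ _).trans (mul_le_mul_of_nonneg_right (norm_sampleResolventErase_le hη x α)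
    (dotProduct_self_nonneg' _))

theorem eraseForm_update (η : ℝ) (α : Fin m) (x : Sample m n) (a : ℝ) (y : Fin n → ℝ) :
    eraseForm η α (Function.update x α (a, y)) = quadForm (sampleResolventErase η x α) y := by
  rw [eraseForm, sampleResolventErase_update, Function.update_self]

theorem norm_matrix_mul_le_of_le {A D : Matrix (Fin n) (Fin n) ℂ} {a : ℝ} (hA : ‖A‖ ≤ a)
    (hD : ‖D‖ ≤ 1) : ‖A * D‖ ≤ a := by
  refine (norm_mul_le _ _).trans ?_
  nlinarith [norm_nonneg A, norm_nonneg D]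

variable {σ : Measure ℝ} {μ : Fin m → Measure (Fin n → ℝ)} [IsProbabilityMeasure σ]
  [∀ α, IsProbabilityMeasure (μ α)] {Q : Fin m → Matrix (Fin n) (Fin n) ℝ} {C τ : ℝ}

theorem norm_meanTrace_le (hn : 1 ≤ n) {η : ℝ} (hη : 0 < η) (D : Matrix (Fin n) (Fin n) ℂ) :
    ‖meanTrace σ μ η D‖ ≤ 1 / η * ‖D‖ := by
  have hn' : (0 : ℝ) < n := by exact_mod_cast hn
  have h := norm_integral_le_of_norm_le_const (μ := sampleLaw σ μ)
    (Eventually.of_forall (norm_trace_sampleResolvent_mul_le (m := m) hη D))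
  rw [probReal_univ, mul_one] at h
  rw [meanTrace, norm_mul, norm_inv, Complex.norm_natCast, inv_mul_le_iff₀ hn']
  exact h

theorem norm_sq_add_five_le (a b c d e : ℂ) :
    ‖a + b + c + d + e‖ ^ 2 ≤
      5 * (‖a‖ ^ 2 + ‖b‖ ^ 2 + ‖c‖ ^ 2 + ‖d‖ ^ 2 + ‖e‖ ^ 2) := by
  have h : ‖a + b + c + d + e‖ ≤ ‖a‖ + ‖b‖ + ‖c‖ + ‖d‖ + ‖e‖ := by
    refine (norm_add_le _ _).trans (add_le_add_left ?_ _)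
    refine (norm_add_le _ _).trans (add_le_add_left ?_ _)
    refine (norm_add_le _ _).trans (add_le_add_left ?_ _)
    exact norm_add_le _ _
  refine (pow_le_pow_left₀ (norm_nonneg _) h 2).trans ?_
  nlinarith [sq_nonneg (‖a‖ - ‖b‖), sq_nonneg (‖a‖ - ‖c‖), sq_nonneg (‖a‖ - ‖d‖),
    sq_nonneg (‖a‖ - ‖e‖), sq_nonneg (‖b‖ - ‖c‖), sq_nonneg (‖b‖ - ‖d‖), sq_nonneg (‖b‖ - ‖e‖),
    sq_nonneg (‖c‖ - ‖d‖), sq_nonneg (‖c‖ - ‖e‖), sq_nonneg (‖d‖ - ‖e‖)]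

namespace SampleBounds

variable (h : SampleBounds σ μ Q C τ)
include h

theorem norm_Q_le (α : Fin m) : ‖(Q α).map Complex.ofReal‖ ≤ C / n :=
  (norm_map_ofReal_le _).trans (h.opNorm_le α)

theorem integrable_eraseForm_sub_sq {η : ℝ} (hη : 0 < η) (α : Fin m) {g : Sample m n → ℂ}
    (hg : Continuous g) {B : ℝ} (hB : ∀ x, ‖g x‖ ≤ B) :
    Integrable (fun x => ‖eraseForm η α x - g x‖ ^ 2) (sampleLaw σ μ) := by
  refine (((h.integrable_normSq_sq α).const_mul (2 * (1 / η) ^ 2)).add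
    (integrable_const (2 * B ^ 2))).mono'
    (((continuous_eraseForm hη.ne' α).sub hg).norm.pow 2).aestronglyMeasurable
    (Eventually.of_forall fun x => ?_)
  rw [norm_pow, norm_norm]
  have h1 := norm_sub_le (eraseForm η α x) (g x)
  have h2 := norm_eraseForm_le hη α x
  have h3 : ‖eraseForm η α x - g x‖ ≤ 1 / η * ((x α).2 ⬝ᵥ (x α).2) + B :=
    h1.trans (add_le_add h2 (hB x))
  have h4 := pow_le_pow_left₀ (norm_nonneg _) h3 2
  simp only [Pi.add_apply]
  nlinarith [sq_nonneg (1 / η * ((x α).2 ⬝ᵥ (x α).2) - B)]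

/-- Concentration of the quadratic forms given the other data. -/
theorem integral_eraseForm_sub_trace_sq_le {η : ℝ} (hη : 0 < η) (α : Fin m) :
    ∫ x, ‖eraseForm η α x - (sampleResolventErase η x α * (Q α).map Complex.ofReal).trace‖ ^ 2
      ∂sampleLaw σ μ ≤ 2 * (1 / η) ^ 2 * τ := by
  have hc : Continuous fun x : Sample m n =>
      (sampleResolventErase η x α * (Q α).map Complex.ofReal).trace :=
    ((continuous_sampleResolventErase hη.ne' α).matrix_mul continuous_const).matrix_trace
  have hi := h.integrable_eraseForm_sub_sq hη α hc
    fun x => norm_trace_sampleResolvent_mul_le hη _ _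
  obtain ⟨hi2, he⟩ := integral_resample α hi
  rw [he]
  -- With the other data fixed, the deleted resolvent is a deterministic matrix and only `y_α` is
  -- random.
  have hle : ∀ x : Sample m n, ∫ e, ‖eraseForm η α (Function.update x α e) -
      (sampleResolventErase η (Function.update x α e) α * (Q α).map Complex.ofReal).trace‖ ^ 2
      ∂σ.prod (μ α) ≤ 2 * (1 / η) ^ 2 * τ := by
    intro x
    simp only [sampleResolventErase_update]
    have e1 : ∀ e : ℝ × (Fin n → ℝ), eraseForm η α (Function.update x α e) =
        quadForm (sampleResolventErase η x α) e.2 := fun e => eraseForm_update η α x e.1 e.2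
    simp only [e1]
    rw [integral_vector (σ := σ) α (f := fun y => ‖quadForm (sampleResolventErase η x α) y -
      (sampleResolventErase η x α * (Q α).map Complex.ofReal).trace‖ ^ 2)
      (((continuous_quadForm continuous_const continuous_id).sub
        continuous_const).norm.pow 2).aestronglyMeasurable, Matrix.trace_mul_comm]
    exact h.concentration_complex α (by positivity) (norm_sampleResolventErase_le hη x α)
  refine (integral_mono hi2 (integrable_const _) hle).trans ?_
  simp

theorem integrable_quadForm_erase_mul {η : ℝ} (hη : 0 < η) (α : Fin m)
    (D : Matrix (Fin n) (Fin n) ℂ) :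
    Integrable (fun x : Sample m n => quadForm (sampleResolventErase η x α * D) (x α).2)
      (sampleLaw σ μ) := by
  refine ((h.integrable_sample_normSq α).const_mul (1 / η * ‖D‖)).mono'
    (continuous_quadForm ((continuous_sampleResolventErase hη.ne' α).matrix_mul continuous_const)
      (continuous_snd.comp (continuous_apply α))).aestronglyMeasurable
    (Eventually.of_forall fun x => (norm_quadForm_le _ _).trans ?_)
  refine mul_le_mul_of_nonneg_right ?_ (dotProduct_self_nonneg' _)
  exact (norm_mul_le _ _).trans (mul_le_mul_of_nonneg_right (norm_sampleResolventErase_le hη x α)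
    (norm_nonneg _))

/-- The deleted resolvent does not involve `y_α`, so integrating over `y_α` replaces `y_α y_αᵀ` by
`Q_α`. -/
theorem integral_quadForm_erase_mul {η : ℝ} (hη : 0 < η) (α : Fin m)
    (D : Matrix (Fin n) (Fin n) ℂ) :
    ∫ x : Sample m n, quadForm (sampleResolventErase η x α * D) (x α).2 ∂sampleLaw σ μ =
      ∫ x, (sampleResolventErase η x α * (D * (Q α).map Complex.ofReal)).trace ∂sampleLaw σ μ := by
  rw [(integral_resample α (h.integrable_quadForm_erase_mul hη α D)).2]
  congr 1
  ext x
  simp only [sampleResolventErase_update, Function.update_self]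
  rw [integral_vector (σ := σ) α (f := fun y => quadForm (sampleResolventErase η x α * D) y)
    (continuous_quadForm continuous_const continuous_id).aestronglyMeasurable,
    h.integral_quadForm, Matrix.trace_mul_comm, Matrix.mul_assoc]

/-- The bilinear forms are close to the mean normalized trace as soon as the mean resolvent is
close to a multiple of the identity. -/
theorem integral_eraseForm_sub_sq_le {η : ℝ} (hη : 1 ≤ η) {Δ : ℝ}
    (hΔ : ∀ D : Matrix (Fin n) (Fin n) ℂ, ‖D‖ ≤ 1 →
      ‖meanTrace σ μ η D - meanTrace σ μ η 1 * (D.trace / n)‖ ≤ Δ) (α : Fin m) :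
    ∫ x, ‖eraseForm η α x - meanTrace σ μ η 1‖ ^ 2 ∂sampleLaw σ μ ≤
      5 * C ^ 2 * Δ ^ 2 + (15 * τ + 40 * C ^ 3 / n) := by
  have hη0 : 0 < η := zero_lt_one.trans_le hη
  have hn := h.n_pos
  have hCp := h.C_pos
  have hn1 : (1 : ℝ) ≤ n := by exact_mod_cast h.one_le_n
  have hinv : 1 / η ≤ 1 := by rw [div_le_one hη0]; exact hη
  set f := meanTrace σ μ η 1 with hf
  set Qc := (Q α).map Complex.ofReal with hQc
  have hQn : ‖Qc‖ ≤ C / n := h.norm_Q_le α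
  have hQ2 : (‖Qc‖ / η ^ 2) ^ 2 ≤ (C / n) ^ 2 := by
    refine pow_le_pow_left₀ (by positivity) ?_ 2
    refine (div_le_self (norm_nonneg _) (one_le_pow₀ hη)).trans hQn
  set T : Sample m n → ℂ := fun x => (sampleResolvent η x * Qc).trace with hT
  set T' : Sample m n → ℂ := fun x => (sampleResolventErase η x α * Qc).trace with hT'
  set c := ∫ x, T x ∂sampleLaw σ μ with hc
  have hTc : Continuous T := continuous_trace_sampleResolvent_mul hη0.ne' Qc
  have hTb : ∀ x, ‖T x‖ ≤ n * (1 / η * ‖Qc‖) := norm_trace_sampleResolvent_mul_le hη0 Qc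
  have hTc' : Continuous T' := hTc.comp (continuous_id.update α continuous_const)
  have hTb' : ∀ x, ‖T' x‖ ≤ n * (1 / η * ‖Qc‖) := fun x => hTb _
  have b1 := h.integral_eraseForm_sub_trace_sq_le hη0 α
  have b2 := h.integral_norm_trace_sub_erase_sq_le hη0 Qc α
  have b3 := h.variance_trace_le hη0 Qc
  have i1 : Integrable (fun x => ‖eraseForm η α x - T' x‖ ^ 2) (sampleLaw σ μ) :=
    h.integrable_eraseForm_sub_sq hη0 α hTc' hTb'
  have i2 : Integrable (fun x => ‖T x - T' x‖ ^ 2) (sampleLaw σ μ) :=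
    integrable_of_continuous_of_norm_le ((hTc.sub hTc').norm.pow 2)
      (B := (n * (1 / η * ‖Qc‖) + n * (1 / η * ‖Qc‖)) ^ 2) fun x => by
        rw [norm_pow, norm_norm]
        exact pow_le_pow_left₀ (norm_nonneg _)
          ((norm_sub_le _ _).trans (add_le_add (hTb _) (hTb' _))) 2
  have i3 : Integrable (fun x => ‖T x - c‖ ^ 2) (sampleLaw σ μ) :=
    integrable_of_continuous_of_norm_le ((hTc.sub continuous_const).norm.pow 2)
      (B := (n * (1 / η * ‖Qc‖) + ‖c‖) ^ 2) fun x => by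
        rw [norm_pow, norm_norm]
        exact pow_le_pow_left₀ (norm_nonneg _)
          ((norm_sub_le _ _).trans (add_le_add_left (hTb _) _)) 2
  -- The matrix `(n/C) Q_α` has norm at most 1 and is therefore an admissible test matrix for `Δ`;
  -- undoing the scaling gives `C Δ`.
  have b4 : ‖c - f * Qc.trace‖ ≤ C * Δ := by
    have h1 := hΔ (((n / C : ℝ) : ℂ) • Qc) (by
      rw [norm_smul, Complex.norm_real, Real.norm_of_nonneg (by positivity)]
      calc n / C * ‖Qc‖ ≤ n / C * (C / n) := by gcongr
        _ = 1 := by field_simp)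
    have e : meanTrace σ μ η (((n / C : ℝ) : ℂ) • Qc) -
        f * ((((n / C : ℝ) : ℂ) • Qc).trace / n) = (C : ℂ)⁻¹ * (c - f * Qc.trace) := by
      have hC' : (C : ℂ) ≠ 0 := by exact_mod_cast hCp.ne'
      have hn' : (n : ℂ) ≠ 0 := by exact_mod_cast hn.ne'
      rw [meanTrace, Matrix.trace_smul]
      simp only [Matrix.mul_smul, Matrix.trace_smul, smul_eq_mul]
      rw [integral_const_mul]
      push_cast
      field_simp
      ring
    rw [e, norm_mul, norm_inv, Complex.norm_real, Real.norm_of_nonneg hCp.le,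
      inv_mul_le_iff₀ hCp] at h1
    exact h1
  have b5 : ‖f * (Qc.trace - 1)‖ ≤ τ := by
    have h1 : ‖f‖ ≤ 1 := (norm_meanTrace_le h.one_le_n hη0 1).trans
      (by nlinarith [norm_one_le_one (n := n), norm_nonneg (1 : Matrix (Fin n) (Fin n) ℂ),
        one_div_pos.2 hη0])
    have h2 : ‖Qc.trace - 1‖ ≤ τ := by
      have : Qc.trace - 1 = (((Q α).trace - 1 : ℝ) : ℂ) := by
        simp [hQc, Matrix.trace]
      rw [this, Complex.norm_real]
      exact h.trace_le α
    rw [norm_mul]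
    nlinarith [norm_nonneg f, norm_nonneg (Qc.trace - 1)]
  -- Telescoping `yᵀ G' y → tr (G' Q) → tr (G Q) → E tr (G Q) → f tr Q → f`. The five steps are
  -- bounded by concentration of `y_α`, deletion of one term, the variance of the trace, `Δ`, and
  -- the trace condition on `Q_α`.
  have hmain : ∀ x, ‖eraseForm η α x - f‖ ^ 2 ≤ 5 * (‖eraseForm η α x - T' x‖ ^ 2 +
      ‖T x - T' x‖ ^ 2 + ‖T x - c‖ ^ 2 + (C * Δ) ^ 2 + τ ^ 2) := by
    intro x
    have h1 := norm_sq_add_five_le (eraseForm η α x - T' x) (T' x - T x) (T x - c)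
      (c - f * Qc.trace) (f * (Qc.trace - 1))
    have e : eraseForm η α x - T' x + (T' x - T x) + (T x - c) + (c - f * Qc.trace) +
      f * (Qc.trace - 1) = eraseForm η α x - f := by ring
    rw [e, norm_sub_rev (T' x)] at h1
    have h4 := pow_le_pow_left₀ (norm_nonneg _) b4 2
    have h5 := pow_le_pow_left₀ (norm_nonneg _) b5 2
    linarith
  have i12 := i1.add i2
  have i123 := i12.add i3
  have i1234 := i123.add (integrable_const ((C * Δ) ^ 2))
  have i12345 := i1234.add (integrable_const (τ ^ 2))
  have hint : ∫ x, ‖eraseForm η α x - f‖ ^ 2 ∂sampleLaw σ μ ≤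
      ∫ x, 5 * (‖eraseForm η α x - T' x‖ ^ 2 +
      ‖T x - T' x‖ ^ 2 + ‖T x - c‖ ^ 2 + (C * Δ) ^ 2 + τ ^ 2) ∂sampleLaw σ μ :=
    integral_mono_of_nonneg (Eventually.of_forall fun x => sq_nonneg _)
      (i12345.const_mul 5) (Eventually.of_forall hmain)
  rw [integral_const_mul] at hint
  have e1 := integral_add i1234 (integrable_const (τ ^ 2))
  have e2 := integral_add i123 (integrable_const ((C * Δ) ^ 2))
  have e3 := integral_add i12 i3
  have e4 := integral_add i1 i2
  simp only [Pi.add_apply, integral_const, probReal_univ, one_smul] at e1 e2 e3 e4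
  rw [e1, e2, e3, e4] at hint
  have hs := h.weight_sq_le
  have hs0 : 0 ≤ ∫ a, a ^ 2 ∂σ := integral_nonneg fun a => sq_nonneg a
  have c2 : (‖Qc‖ / η ^ 2) ^ 2 * ((∫ a, a ^ 2 ∂σ) * 4) ≤ 4 * C ^ 3 / n := by
    calc _ ≤ (C / n) ^ 2 * ((C * n) * 4) := by gcongr
      _ = _ := by field_simp
  have c3 : (‖Qc‖ / η ^ 2) ^ 2 * (4 * C * n) ≤ 4 * C ^ 3 / n := by
    calc _ ≤ (C / n) ^ 2 * (4 * C * n) := by gcongr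
      _ = _ := by field_simp
  have c1 : 2 * (1 / η) ^ 2 * τ ≤ 2 * τ := by
    have : (1 / η) ^ 2 ≤ 1 := pow_le_one₀ (by positivity) hinv
    nlinarith [h.nonneg]
  have c5 : τ ^ 2 ≤ τ := by nlinarith [h.nonneg, h.le_one]
  have b1' := b1.trans c1
  have b2' := b2.trans c2
  have b3' := b3.trans c3
  calc _ ≤ _ := hint
    _ ≤ 5 * (2 * τ + 4 * C ^ 3 / n + 4 * C ^ 3 / n + (C * Δ) ^ 2 + τ) := by
        refine mul_le_mul_of_nonneg_left ?_ (by norm_num)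
        refine add_le_add (add_le_add (add_le_add (add_le_add b1' b2') b3') le_rfl) c5
    _ = _ := by ring

theorem integrable_normSq_mul_norm_sub {η : ℝ} (hη : 0 < η) (α : Fin m) (w : ℂ) :
    Integrable (fun x : Sample m n => ((x α).2 ⬝ᵥ (x α).2) * ‖eraseForm η α x - w‖)
      (sampleLaw σ μ) := by
  refine (((h.integrable_normSq_sq α).const_mul (1 / η)).add
    ((h.integrable_sample_normSq α).mul_const ‖w‖)).mono'
    ((continuous_normSq α).mul
      ((continuous_eraseForm hη.ne' α).sub continuous_const).norm).aestronglyMeasurable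
    (Eventually.of_forall fun x => ?_)
  have hs := dotProduct_self_nonneg' (x α).2
  rw [norm_mul, norm_norm, Real.norm_of_nonneg hs]
  simp only [Pi.add_apply]
  have h1 := norm_sub_le (eraseForm η α x) w
  have h2 := norm_eraseForm_le hη α x
  nlinarith

/-- Cauchy–Schwarz in the form `s a ≤ (√v/4) s² + a²/√v`; with `E s² ≤ 4` and `E a² ≤ v` each part
contributes `√v`. -/
theorem integral_normSq_mul_norm_sub_le {η : ℝ} (hη : 0 < η) (α : Fin m) (w : ℂ) {v : ℝ}
    (hv : 0 < v) (hle : ∫ x, ‖eraseForm η α x - w‖ ^ 2 ∂sampleLaw σ μ ≤ v) :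
    ∫ x : Sample m n, ((x α).2 ⬝ᵥ (x α).2) * ‖eraseForm η α x - w‖ ∂sampleLaw σ μ ≤ 2 * √v := by
  have hr := Real.sqrt_pos.2 hv
  have hr2 := Real.sq_sqrt hv.le
  have i1 := (h.integrable_normSq_sq α).const_mul (√v / 4)
  have i2 : Integrable (fun x => (1 / √v) * ‖eraseForm η α x - w‖ ^ 2) (sampleLaw σ μ) :=
    (h.integrable_eraseForm_sub_sq hη α (g := fun _ => w) continuous_const
      (B := ‖w‖) fun _ => le_rfl).const_mul _
  have h1 := integral_mono (h.integrable_normSq_mul_norm_sub hη α w) (i1.add i2) fun x => by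
    simp only [Pi.add_apply]
    set s := (x α).2 ⬝ᵥ (x α).2
    set a := ‖eraseForm η α x - w‖
    have : √v / 4 * s ^ 2 + 1 / √v * a ^ 2 - s * a = (√v * s / 2 - a) ^ 2 / √v := by
      field_simp; ring
    have h2 : 0 ≤ (√v * s / 2 - a) ^ 2 / √v := by positivity
    linarith
  have h2 := integral_add i1 i2
  simp only [Pi.add_apply] at h1
  rw [h2, integral_const_mul, integral_const_mul] at h1
  have h3 := mul_le_mul_of_nonneg_left (h.integral_normSq_sq_le α) (by positivity : 0 ≤ √v / 4)
  have h4 := mul_le_mul_of_nonneg_left hle (by positivity : 0 ≤ 1 / √v)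
  have h5 : 1 / √v * v = √v := by
    field_simp; exact hr2.symm
  linarith

end SampleBounds

end SelfConsistent

/-! ### Linearizing the denominators and the size of the mean trace. -/

section SelfConsistentEquation

open scoped Matrix.Norms.L2Operator

set_option linter.unusedSectionVars false

variable {n m : ℕ}

/-- The integral `(m / n) ∫ ξ / (1 + ξ w) dσ(ξ)`. -/
def weightTransform (m n : ℕ) (σ : Measure ℝ) (w : ℂ) : ℂ :=
  (m / n : ℂ) * ∫ a : ℝ, (a : ℂ) * (1 / (1 + (a : ℂ) * w)) ∂σ

theorem one_add_ofReal_mul_ne_zero {w : ℂ} (hw : w.im ≠ 0) (a : ℝ) : 1 + (a : ℂ) * w ≠ 0 := by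
  intro h
  have h1 := congrArg Complex.re h
  have h2 := congrArg Complex.im h
  simp [hw] at h1 h2
  simp [h2] at h1

/-- In `(1 + a w) w̄ = w̄ + a |w|²` the imaginary part does not depend on `a`, so the bound is
uniform in `a`. -/
theorem norm_one_div_one_add_le {w : ℂ} (hw : w.im ≠ 0) (a : ℝ) :
    ‖1 / (1 + (a : ℂ) * w)‖ ≤ ‖w‖ / |w.im| := by
  have h0 : 0 < ‖1 + (a : ℂ) * w‖ := norm_pos_iff.2 (one_add_ofReal_mul_ne_zero hw a)
  have h : ((1 + (a : ℂ) * w) * (starRingEnd ℂ) w).im = -w.im := by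
    simp [Complex.add_im, Complex.mul_im]; ring
  have h1 : |w.im| ≤ ‖1 + (a : ℂ) * w‖ * ‖w‖ := by
    calc |w.im| = |((1 + (a : ℂ) * w) * (starRingEnd ℂ) w).im| := by rw [h, abs_neg]
      _ ≤ ‖(1 + (a : ℂ) * w) * (starRingEnd ℂ) w‖ := Complex.abs_im_le_norm _
      _ = _ := by rw [norm_mul, Complex.norm_conj]
  rw [norm_div, norm_one, div_le_div_iff₀ h0 (abs_pos.2 hw)]
  linarith [mul_comm ‖1 + (a : ℂ) * w‖ ‖w‖]

theorem measurable_one_div_one_add (w : ℂ) : Measurable fun a : ℝ => 1 / (1 + (a : ℂ) * w) := by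
  fun_prop

variable {σ : Measure ℝ} {μ : Fin m → Measure (Fin n → ℝ)} [IsProbabilityMeasure σ]
  [∀ α, IsProbabilityMeasure (μ α)] {Q : Fin m → Matrix (Fin n) (Fin n) ℝ} {C τ : ℝ}

namespace SampleBounds

variable (h : SampleBounds σ μ Q C τ)
include h

theorem integrable_weight_mul_of_le {c : ℝ → ℂ} (hc : Measurable c) (hc2 : ∀ a, ‖c a‖ ≤ 2) :
    Integrable (fun a : ℝ => (a : ℂ) * c a) σ := by
  refine (h.integrable_id.abs.mul_const 2).mono'
    ((Complex.measurable_ofReal.mul hc).aestronglyMeasurable) (Eventually.of_forall fun a => ?_)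
  rw [norm_mul, Complex.norm_real]
  exact mul_le_mul_of_nonneg_left (hc2 a) (abs_nonneg a)

/-- Write `V (1 + ξ e) = U` for Sherman–Morrison and `c = 1 / (1 + ξ w)`. Then `ξ V - ξ c U = ξ² V c
(w - e)`, so replacing the random denominator by a fixed one costs `ξ² |y|² |e - w|` up to
constants, and these costs sum thanks to `m E ξ² ≤ C n`. In the main term the weight is independent
of `U`, so the expectation factorizes. A general `w` is allowed because the lemma serves with `w =
0` before anything is known about `f`. -/
theorem norm_sum_weight_sub_le {η : ℝ} (hη : 0 < η) {D : Matrix (Fin n) (Fin n) ℂ}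
    (hD : ‖D‖ ≤ 1) {w : ℂ} {c : ℝ → ℂ} (hc : Measurable c) (hc2 : ∀ a, ‖c a‖ ≤ 2)
    (hcw : ∀ a : ℝ, c a * (1 + a * w) = 1) {W : ℝ}
    (hW : ∀ α, ∫ x : Sample m n, ((x α).2 ⬝ᵥ (x α).2) * ‖eraseForm η α x - w‖
      ∂sampleLaw σ μ ≤ W) :
    ‖D.trace + (η * Complex.I) * ∫ x, (sampleResolvent η x * D).trace ∂sampleLaw σ μ -
      ∑ α, (∫ a : ℝ, (a : ℂ) * c a ∂σ) *
        ∫ x, (sampleResolventErase η x α * (D * (Q α).map Complex.ofReal)).trace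
          ∂sampleLaw σ μ‖ ≤ n * (2 * C / η * W) := by
  set V : Fin m → Sample m n → ℂ := fun α x => quadForm (sampleResolvent η x * D) (x α).2
  set U : Fin m → Sample m n → ℂ := fun α x => quadForm (sampleResolventErase η x α * D) (x α).2
  have hVc : ∀ α, Continuous (V α) := fun α => continuous_quadForm
    ((continuous_sampleResolvent hη.ne').matrix_mul continuous_const)
    (continuous_snd.comp (continuous_apply α))
  have hUc : ∀ α, Continuous (U α) := fun α => continuous_quadForm
    ((continuous_sampleResolventErase hη.ne' α).matrix_mul continuous_const)
    (continuous_snd.comp (continuous_apply α))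
  have hVb : ∀ α x, ‖V α x‖ ≤ 1 / η * ((x α).2 ⬝ᵥ (x α).2) := fun α x =>
    (norm_quadForm_le _ _).trans (mul_le_mul_of_nonneg_right
      (norm_matrix_mul_le_of_le (norm_sampleResolvent_le hη x) hD) (dotProduct_self_nonneg' _))
  have hUV : ∀ α x, V α x * (1 + (x α).1 * eraseForm η α x) = U α x := fun α x =>
    quadForm_sampleResolvent_mul hη.ne' x α D
  have hUi : ∀ α, Integrable (U α) (sampleLaw σ μ) := fun α =>
    h.integrable_quadForm_erase_mul hη α D
  have hUu : ∀ α (x : Sample m n) (a : ℝ) (y : Fin n → ℝ),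
      U α (Function.update x α (a, y)) = U α (Function.update x α (0, y)) := fun α x a y => by
    simp only [U, sampleResolventErase_update, Function.update_self]
  have hVi : ∀ α, Integrable (fun x => ((x α).1 : ℂ) * V α x) (sampleLaw σ μ) := by
    intro α
    have hi : Integrable (fun x : Sample m n => |(x α).1| * (1 / η * ((x α).2 ⬝ᵥ (x α).2)))
        (sampleLaw σ μ) :=
      integrable_weight_mul (𝕜 := ℝ) α (g := fun a => |a|)
        (U := fun x => 1 / η * ((x α).2 ⬝ᵥ (x α).2)) h.integrable_id.abs
        (by fun_prop) (continuous_const.mul (continuous_normSq α)).measurable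
        ((h.integrable_sample_normSq α).const_mul _) (by simp)
    refine hi.mono' ((Complex.continuous_ofReal.comp (continuous_weight α)).mul
      (hVc α)).aestronglyMeasurable (Eventually.of_forall fun x => ?_)
    rw [norm_mul, Complex.norm_real]
    exact mul_le_mul_of_nonneg_left (hVb α x) (abs_nonneg _)
  have hcUi : ∀ α, Integrable (fun x => (((x α).1 : ℂ) * c (x α).1) * U α x) (sampleLaw σ μ) :=
    fun α => integrable_weight_mul (𝕜 := ℂ) α (g := fun a : ℝ => (a : ℂ) * c a)
      (h.integrable_weight_mul_of_le hc hc2) (Complex.measurable_ofReal.mul hc)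
      (hUc α).measurable (hUi α) (hUu α)
  have e1 : D.trace + (η * Complex.I) * ∫ x, (sampleResolvent η x * D).trace ∂sampleLaw σ μ =
      ∑ α, ∫ x, ((x α).1 : ℂ) * V α x ∂sampleLaw σ μ := by
    rw [← integral_finsetSum _ fun α _ => hVi α]
    simp only [V, trace_sampleResolvent_mul hη.ne']
    rw [integral_add (integrable_const _) ((integrable_trace hη D).const_mul _),
      integral_const_mul]
    simp
  have e2 : ∀ α, (∫ a : ℝ, (a : ℂ) * c a ∂σ) *
        ∫ x, (sampleResolventErase η x α * (D * (Q α).map Complex.ofReal)).trace ∂sampleLaw σ μ =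
      ∫ x, (((x α).1 : ℂ) * c (x α).1) * U α x ∂sampleLaw σ μ := by
    intro α
    rw [← h.integral_quadForm_erase_mul hη α D]
    exact (integral_weight_mul (𝕜 := ℂ) α (g := fun a : ℝ => (a : ℂ) * c a)
      (Complex.measurable_ofReal.mul hc) (hUc α).measurable (hUu α)).symm
  rw [e1, Finset.sum_congr rfl fun α _ => e2 α, ← Finset.sum_sub_distrib]
  have hterm : ∀ α, ‖∫ x, ((x α).1 : ℂ) * V α x ∂sampleLaw σ μ -
      ∫ x, (((x α).1 : ℂ) * c (x α).1) * U α x ∂sampleLaw σ μ‖ ≤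
      (∫ a, a ^ 2 ∂σ) * (2 / η * W) := by
    intro α
    rw [← integral_sub (hVi α) (hcUi α)]
    set R : Sample m n → ℝ := fun x => 2 / η * (((x α).2 ⬝ᵥ (x α).2) * ‖eraseForm η α x - w‖)
    have hRc : Continuous R := continuous_const.mul ((continuous_normSq α).mul
      ((continuous_eraseForm hη.ne' α).sub continuous_const).norm)
    have hRi : Integrable R (sampleLaw σ μ) := (h.integrable_normSq_mul_norm_sub hη α w).const_mul _
    have hRu : ∀ (x : Sample m n) (a : ℝ) (y : Fin n → ℝ),
        R (Function.update x α (a, y)) = R (Function.update x α (0, y)) := fun x a y => by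
      simp only [R, eraseForm_update, Function.update_self]
    have hgi := integrable_weight_mul (𝕜 := ℝ) α (g := fun a => a ^ 2) h.integrable_sq
      (by fun_prop) hRc.measurable hRi hRu
    refine (norm_integral_le_of_norm_le hgi (Eventually.of_forall fun x => ?_)).trans ?_
    · have e : ((x α).1 : ℂ) * V α x - ((x α).1 : ℂ) * c (x α).1 * U α x =
          ((x α).1 : ℂ) ^ 2 * (V α x * c (x α).1 * (w - eraseForm η α x)) := by
        rw [← hUV]
        linear_combination (-((x α).1 : ℂ) * V α x) * hcw (x α).1
      rw [e, norm_mul, norm_pow, Complex.norm_real, Real.norm_eq_abs, sq_abs, norm_mul, norm_mul,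
        norm_sub_rev w]
      refine mul_le_mul_of_nonneg_left ?_ (sq_nonneg _)
      have hs := dotProduct_self_nonneg' (x α).2
      calc ‖V α x‖ * ‖c (x α).1‖ * ‖eraseForm η α x - w‖
          ≤ (1 / η * ((x α).2 ⬝ᵥ (x α).2)) * 2 * ‖eraseForm η α x - w‖ := by
            gcongr
            · exact hVb α x
            · exact hc2 _
        _ = R x := by simp only [R]; ring
    · rw [integral_weight_mul (𝕜 := ℝ) α (g := fun a => a ^ 2) (by fun_prop) hRc.measurable hRu,
        integral_const_mul]
      exact mul_le_mul_of_nonneg_left (mul_le_mul_of_nonneg_left (hW α) (by positivity))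
        (integral_nonneg fun a => sq_nonneg a)
  refine (norm_sum_le _ _).trans ((Finset.sum_le_sum fun α _ => hterm α).trans ?_)
  rw [Finset.sum_const, Finset.card_univ, Fintype.card_fin, nsmul_eq_mul]
  have hW0 : 0 ≤ W := by
    obtain ⟨α⟩ : Nonempty (Fin m) := ⟨⟨0, h.one_le_m⟩⟩
    exact (integral_nonneg fun x => mul_nonneg (dotProduct_self_nonneg' _)
      (norm_nonneg _)).trans (hW α)
  calc (m : ℝ) * ((∫ a, a ^ 2 ∂σ) * (2 / η * W)) = (m * ∫ a, a ^ 2 ∂σ) * (2 / η * W) := by ring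
    _ ≤ (C * n) * (2 / η * W) := mul_le_mul_of_nonneg_right h.weight_sq' (by positivity)
    _ = _ := by ring

/-- A first bound: the mean resolvent behaves like `-1 / z`. -/
theorem norm_one_add_meanTrace_le {η : ℝ} (hη : 1 ≤ η) :
    ‖1 + (η * Complex.I) * meanTrace σ μ η 1‖ ≤ 10 * C / η := by
  have hη0 : 0 < η := zero_lt_one.trans_le hη
  have hn := h.n_pos
  have hm := h.m_pos
  have hCp := h.C_pos
  have hnC : (n : ℂ) ≠ 0 := by exact_mod_cast hn.ne'
  have hW : ∀ α, ∫ x : Sample m n, ((x α).2 ⬝ᵥ (x α).2) * ‖eraseForm η α x - 0‖ ∂sampleLaw σ μ ≤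
      4 / η := by
    intro α
    calc _ ≤ ∫ x : Sample m n, 1 / η * ((x α).2 ⬝ᵥ (x α).2) ^ 2 ∂sampleLaw σ μ := by
          refine integral_mono (h.integrable_normSq_mul_norm_sub hη0 α 0)
            ((h.integrable_normSq_sq α).const_mul _) fun x => ?_
          simp only [sub_zero]
          have := norm_eraseForm_le hη0 α x
          nlinarith [dotProduct_self_nonneg' (x α).2]
      _ ≤ _ := by
          rw [integral_const_mul]
          have := h.integral_normSq_sq_le α
          rw [one_div_mul_eq_div]
          gcongr
  -- With `w = 0` and `c = 1` no information on the imaginary part of `f` is needed. The error is at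
  -- most `8 C/η`, and the sum of the main terms, bounded next, adds `2 C/η`.
  have h1 := h.norm_sum_weight_sub_le hη0 (D := 1) norm_one_le_one (w := 0) (c := fun _ => 1)
    measurable_const (by simp) (by simp) hW
  have h2 : ‖∑ α, (∫ a : ℝ, (a : ℂ) * 1 ∂σ) *
        ∫ x, (sampleResolventErase η x α * (1 * (Q α).map Complex.ofReal)).trace
          ∂sampleLaw σ μ‖ ≤ n * (2 * C / η) := by
    rw [← Finset.mul_sum, norm_mul]
    simp only [mul_one, Matrix.one_mul]
    rw [integral_complex_ofReal, Complex.norm_real, Real.norm_eq_abs]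
    have h3 : ∀ α, ‖∫ x, (sampleResolventErase η x α * (Q α).map Complex.ofReal).trace
        ∂sampleLaw σ μ‖ ≤ 2 / η := by
      intro α
      have e := h.integral_quadForm_erase_mul hη0 α 1
      rw [Matrix.one_mul] at e
      rw [← e]
      calc _ ≤ ∫ x : Sample m n, 1 / η * ((x α).2 ⬝ᵥ (x α).2) ∂sampleLaw σ μ := by
            refine norm_integral_le_of_norm_le ((h.integrable_sample_normSq α).const_mul _)
              (Eventually.of_forall fun x => ?_)
            simp only [Matrix.mul_one]
            exact norm_eraseForm_le hη0 α x
        _ ≤ _ := by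
            rw [integral_const_mul, one_div_mul_eq_div]
            have := h.integral_sample_normSq_le α
            gcongr
    have h4 : ‖∑ α, ∫ x, (sampleResolventErase η x α * (Q α).map Complex.ofReal).trace
        ∂sampleLaw σ μ‖ ≤ m * (2 / η) := by
      refine (norm_sum_le _ _).trans ((Finset.sum_le_sum fun α _ => h3 α).trans ?_)
      simp
    have h5 := h.weight_mean
    rw [abs_mul, abs_of_nonneg (by positivity : (0 : ℝ) ≤ m / n), div_mul_eq_mul_div,
      div_le_iff₀ hn] at h5
    calc _ ≤ |∫ a, a ∂σ| * (m * (2 / η)) := mul_le_mul_of_nonneg_left h4 (abs_nonneg _)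
      _ = (m * |∫ a, a ∂σ|) * (2 / η) := by ring
      _ ≤ (C * n) * (2 / η) := mul_le_mul_of_nonneg_right h5 (by positivity)
      _ = _ := by ring
  have h6 := norm_le_norm_sub_add ((1 : Matrix (Fin n) (Fin n) ℂ).trace + (η * Complex.I) *
    ∫ x, (sampleResolvent η x * 1).trace ∂sampleLaw σ μ) (∑ α, (∫ a : ℝ, (a : ℂ) * 1 ∂σ) *
        ∫ x, (sampleResolventErase η x α * (1 * (Q α).map Complex.ofReal)).trace ∂sampleLaw σ μ)
  have e : (1 : Matrix (Fin n) (Fin n) ℂ).trace + (η * Complex.I) *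
      ∫ x, (sampleResolvent η x * 1).trace ∂sampleLaw σ μ =
      n * (1 + (η * Complex.I) * meanTrace σ μ η 1) := by
    rw [meanTrace, Matrix.trace_one, Fintype.card_fin]
    field_simp
  have h7 := h6.trans (add_le_add h1 h2)
  rw [e, norm_mul, Complex.norm_natCast] at h7
  have h8 : ‖1 + (η * Complex.I) * meanTrace σ μ η 1‖ ≤ 2 * C / η * (4 / η) + 2 * C / η := by
    refine le_of_mul_le_mul_left ?_ hn
    linarith
  have h9 : 4 / η ≤ 4 := by
    rw [div_le_iff₀ hη0]; linarith
  have h10 : 2 * C / η * (4 / η) ≤ 2 * C / η * 4 := mul_le_mul_of_nonneg_left h9 (by positivity)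
  have h11 : 2 * C / η * 4 + 2 * C / η = 10 * C / η := by ring
  linarith

/-- Here `20 C` is chosen so that `10 C/η ≤ 1/2`. Together with `‖f‖ ≤ 1/η` this lower bound gives
`‖f‖ / Im f ≤ 2`, which bounds the kernel `1 / (1 + ξ f)` for all real `ξ`. -/
theorem half_le_im_meanTrace {η : ℝ} (hη : 20 * C ≤ η) :
    1 / (2 * η) ≤ (meanTrace σ μ η 1).im := by
  have hC := h.one_le_C
  have hη1 : 1 ≤ η := by linarith
  have hη0 : 0 < η := by linarith
  have h1 := h.norm_one_add_meanTrace_le hη1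
  have h2 := (Complex.abs_re_le_norm _).trans h1
  have h3 : 10 * C / η ≤ 1 / 2 := by rw [div_le_iff₀ hη0]; linarith
  have h4 : (1 + (η * Complex.I) * meanTrace σ μ η 1).re = 1 - η * (meanTrace σ μ η 1).im := by
    simp [sub_eq_add_neg]
  rw [h4] at h2
  have h5 := (abs_le.1 (h2.trans h3)).2
  rw [div_le_iff₀ (by positivity)]
  linarith

end SampleBounds

end SelfConsistentEquation

/-! ### The approximate equation and the bootstrap for the mean resolvent. -/

section ApproximateEquation

open scoped Matrix.Norms.L2Operator

set_option linter.unusedSectionVars false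

variable {n m : ℕ}

/-- The error in the approximate equation for the mean Stieltjes transform. -/
def equationError (C τ : ℝ) (n : ℕ) : ℝ :=
  4 * C * √(15 * τ + 40 * C ^ 3 / n) + 3 * C * τ + 6 * C ^ 3 / √n

variable {σ : Measure ℝ} {μ : Fin m → Measure (Fin n → ℝ)} [IsProbabilityMeasure σ]
  [∀ α, IsProbabilityMeasure (μ α)] {Q : Fin m → Matrix (Fin n) (Fin n) ℝ} {C τ : ℝ}

namespace SampleBounds

variable (h : SampleBounds σ μ Q C τ)
include h

theorem norm_meanTrace_one_le {η : ℝ} (hη : 0 < η) : ‖meanTrace σ μ η 1‖ ≤ 1 / η := by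
  refine (norm_meanTrace_le h.one_le_n hη 1).trans ?_
  have := mul_le_mul_of_nonneg_left (norm_one_le_one (n := n)) (one_div_pos.2 hη).le
  linarith

theorem im_meanTrace_pos {η : ℝ} (hη : 20 * C ≤ η) : 0 < (meanTrace σ μ η 1).im := by
  have hη0 : 0 < η := by linarith [h.one_le_C]
  exact lt_of_lt_of_le (by positivity) (h.half_le_im_meanTrace hη)

theorem norm_kernel_le {η : ℝ} (hη : 20 * C ≤ η) (a : ℝ) :
    ‖1 / (1 + (a : ℂ) * meanTrace σ μ η 1)‖ ≤ 2 := by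
  have hη0 : 0 < η := by linarith [h.one_le_C]
  have h1 := h.half_le_im_meanTrace hη
  have h2 := h.im_meanTrace_pos hη
  refine (norm_one_div_one_add_le h2.ne' a).trans ?_
  rw [abs_of_pos h2, div_le_iff₀ h2]
  have h3 := h.norm_meanTrace_one_le hη0
  have h4 : 1 / η = 2 * (1 / (2 * η)) := by field_simp
  linarith

/-- The measure `(m/n) ξ σ` may have large total variation, so absolute values cannot be put inside.
The expansion `a / (1 + a f) = a - f a² / (1 + a f)` leaves the scaled mean, bounded by `C`, and a
second-moment term, bounded by `2 C`. -/
theorem norm_weightTransform_le {η : ℝ} (hη : 20 * C ≤ η) :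
    ‖weightTransform m n σ (meanTrace σ μ η 1)‖ ≤ 3 * C := by
  have hη1 : 1 ≤ η := by linarith [h.one_le_C]
  have hη0 : 0 < η := by linarith
  have hn := h.n_pos
  set f := meanTrace σ μ η 1
  set c : ℝ → ℂ := fun a => 1 / (1 + (a : ℂ) * f) with hc
  have hcm : Measurable c := measurable_one_div_one_add f
  have hc2 : ∀ a, ‖c a‖ ≤ 2 := h.norm_kernel_le hη
  have hf : ‖f‖ ≤ 1 := (h.norm_meanTrace_one_le hη0).trans (by rw [div_le_one hη0]; exact hη1)
  have e : ∀ a : ℝ, (a : ℂ) * c a = a - f * ((a : ℂ) ^ 2 * c a) := by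
    intro a
    have := one_add_ofReal_mul_ne_zero (h.im_meanTrace_pos hη).ne' a
    have h1 : c a * (1 + a * f) = 1 := one_div_mul_cancel this
    linear_combination (a : ℂ) * h1
  have hi : Integrable (fun a : ℝ => (a : ℂ) ^ 2 * c a) σ := by
    refine (h.integrable_sq.mul_const 2).mono'
      (((Complex.measurable_ofReal.pow_const 2).mul hcm).aestronglyMeasurable)
      (Eventually.of_forall fun a => ?_)
    rw [norm_mul, norm_pow, Complex.norm_real, Real.norm_eq_abs, sq_abs]
    exact mul_le_mul_of_nonneg_left (hc2 a) (sq_nonneg a)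
  have hb : ‖∫ a : ℝ, (a : ℂ) ^ 2 * c a ∂σ‖ ≤ 2 * ∫ a, a ^ 2 ∂σ := by
    rw [mul_comm, ← integral_mul_const]
    refine norm_integral_le_of_norm_le (h.integrable_sq.mul_const 2)
      (Eventually.of_forall fun a => ?_)
    rw [norm_mul, norm_pow, Complex.norm_real, Real.norm_eq_abs, sq_abs]
    exact mul_le_mul_of_nonneg_left (hc2 a) (sq_nonneg a)
  have e2 : weightTransform m n σ f = ((m / n * ∫ a, a ∂σ : ℝ) : ℂ) -
      (m / n : ℂ) * (f * ∫ a : ℝ, (a : ℂ) ^ 2 * c a ∂σ) := by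
    have : weightTransform m n σ f = (m / n : ℂ) * ∫ a : ℝ, (a : ℂ) * c a ∂σ := rfl
    rw [this]
    simp only [e]
    have hid : Integrable (fun a : ℝ => (a : ℂ)) σ := h.integrable_id.ofReal
    rw [integral_sub hid (hi.const_mul _), integral_const_mul]
    have : ∫ a : ℝ, (a : ℂ) ∂σ = ((∫ a, a ∂σ : ℝ) : ℂ) := integral_complex_ofReal
    rw [this]
    push_cast
    ring
  rw [e2]
  refine (norm_sub_le _ _).trans ?_
  rw [Complex.norm_real, Real.norm_eq_abs, norm_mul, norm_mul, norm_div, Complex.norm_natCast,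
    Complex.norm_natCast]
  have h1 := h.weight_mean
  have h2 := h.weight_sq
  have h3 : (m / n : ℝ) * (‖f‖ * ‖∫ a : ℝ, (a : ℂ) ^ 2 * c a ∂σ‖) ≤
      (m / n : ℝ) * (1 * (2 * ∫ a, a ^ 2 ∂σ)) := by gcongr
  linarith

/-- The linearized sum with `w = f` becomes `n κ n⁻¹ E tr (G D)` after two corrections: `e1`
restores the deleted terms, `e2` replaces the average of the `Q_α` by `I/n`. What matters is that
`Δ` enters with the factor `1/η`, so that it can be absorbed afterwards. -/
theorem norm_equation_le {η : ℝ} (hη : 20 * C ≤ η) {Δ : ℝ}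
    (hΔ : ∀ D : Matrix (Fin n) (Fin n) ℂ, ‖D‖ ≤ 1 →
      ‖meanTrace σ μ η D - meanTrace σ μ η 1 * (D.trace / n)‖ ≤ Δ)
    {D : Matrix (Fin n) (Fin n) ℂ} (hD : ‖D‖ ≤ 1) :
    ‖D.trace / n + (η * Complex.I) * meanTrace σ μ η D -
      weightTransform m n σ (meanTrace σ μ η 1) * meanTrace σ μ η D‖ ≤
      12 * C ^ 2 / η * Δ + equationError C τ n := by
  have hC1 := h.one_le_C
  have hη1 : 1 ≤ η := by linarith
  have hη0 : 0 < η := by linarith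
  have hn := h.n_pos
  have hm := h.m_pos
  have hCp := h.C_pos
  have hnC : (n : ℂ) ≠ 0 := by exact_mod_cast hn.ne'
  have hmC : (m : ℂ) ≠ 0 := by exact_mod_cast hm.ne'
  have hinv : 1 / η ≤ 1 := by rw [div_le_one hη0]; exact hη1
  have hΔ0 : 0 ≤ Δ := (norm_nonneg _).trans (hΔ D hD)
  have hκ := h.norm_weightTransform_le hη
  set f := meanTrace σ μ η 1
  set κ := weightTransform m n σ f with hκdef
  set c : ℝ → ℂ := fun a => 1 / (1 + (a : ℂ) * f) with hc
  set k : ℂ := ∫ a : ℝ, (a : ℂ) * c a ∂σ with hk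
  have hκk : κ = (m / n : ℂ) * k := rfl
  have hcw : ∀ a : ℝ, c a * (1 + a * f) = 1 := fun a =>
    one_div_mul_cancel (one_add_ofReal_mul_ne_zero (h.im_meanTrace_pos hη).ne' a)
  set ρ := 15 * τ + 40 * C ^ 3 / n with hρ
  have hρ0 : 0 < ρ := by
    have := h.nonneg
    positivity
  have hv : 0 < 5 * C ^ 2 * Δ ^ 2 + ρ := by positivity
  -- The sum of a square root and a linear term keeps `Δ` linear; `5 ≤ 3²` suffices.
  have hsq : √(5 * C ^ 2 * Δ ^ 2 + ρ) ≤ 3 * C * Δ + √ρ := by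
    rw [Real.sqrt_le_left (by positivity)]
    have := Real.sq_sqrt hρ0.le
    nlinarith [Real.sqrt_nonneg ρ, mul_nonneg (mul_nonneg hCp.le hΔ0) (Real.sqrt_nonneg ρ),
      sq_nonneg (C * Δ)]
  have hW : ∀ α, ∫ x : Sample m n, ((x α).2 ⬝ᵥ (x α).2) * ‖eraseForm η α x - f‖ ∂sampleLaw σ μ ≤
      2 * (3 * C * Δ + √ρ) := fun α =>
    (h.integral_normSq_mul_norm_sub_le hη0 α f hv
      (h.integral_eraseForm_sub_sq_le hη1 hΔ α)).trans (by linarith)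
  have h1 := h.norm_sum_weight_sub_le hη0 hD (measurable_one_div_one_add f) (h.norm_kernel_le hη)
    hcw hW
  set B : Matrix (Fin n) (Fin n) ℝ := (m : ℝ)⁻¹ • (∑ α, Q α) -
    (n : ℝ)⁻¹ • (1 : Matrix (Fin n) (Fin n) ℝ) with hB
  set Bc := B.map Complex.ofReal with hBc
  -- All weights have the same law, so the scalar `k` is common to all indices and only the average
  -- of the `Q α` enters.
  have hQsum : ∑ α, (Q α).map Complex.ofReal = (m : ℂ) • ((n : ℂ)⁻¹ • 1 + Bc) := by
    ext i j
    simp only [hBc, hB, Matrix.sum_apply, Matrix.map_apply, Matrix.smul_apply, Matrix.add_apply,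
      Matrix.sub_apply, smul_eq_mul, Complex.ofReal_sub, Complex.ofReal_mul, Complex.ofReal_inv,
      Complex.ofReal_natCast, Complex.ofReal_sum, Matrix.one_apply]
    split_ifs <;> · push_cast; field_simp; ring
  set e1 : ℂ := ∑ α, k * (∫ x, (sampleResolvent η x * (D * (Q α).map Complex.ofReal)).trace
      ∂sampleLaw σ μ - ∫ x, (sampleResolventErase η x α * (D * (Q α).map Complex.ofReal)).trace
      ∂sampleLaw σ μ) with he1
  set e2 : ℂ := ∫ x, (sampleResolvent η x * (D * Bc)).trace ∂sampleLaw σ μ with he2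
  have hs : ∑ α, k * ∫ x, (sampleResolvent η x * (D * (Q α).map Complex.ofReal)).trace
      ∂sampleLaw σ μ = n * κ * (meanTrace σ μ η D + e2) := by
    rw [← Finset.mul_sum, ← integral_finsetSum _ fun α _ => integrable_trace hη0 _]
    have e : ∀ x : Sample m n, ∑ α, (sampleResolvent η x *
        (D * (Q α).map Complex.ofReal)).trace = m * ((n : ℂ)⁻¹ * (sampleResolvent η x * D).trace +
        (sampleResolvent η x * (D * Bc)).trace) := by
      intro x
      rw [← Matrix.trace_sum, ← Matrix.mul_sum, ← Matrix.mul_sum, hQsum]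
      simp only [Matrix.mul_smul, Matrix.mul_add, Matrix.trace_smul, Matrix.trace_add,
        Matrix.mul_one, smul_eq_mul]
    simp only [e]
    rw [integral_const_mul, integral_add ((integrable_trace hη0 _).const_mul _)
      (integrable_trace hη0 _), integral_const_mul, ← he2, meanTrace, hκk]
    field_simp
  -- The first moment `E |ξ| ≤ C √n` meets `‖Q_α‖ ≤ C/n`, and `m ‖k‖ ≤ 3 C n`; the outcome is
  -- `O(√n)`, negligible against `n`.
  have hb1 : ‖e1‖ ≤ n * (6 * C ^ 3 / √n) := by
    have hterm : ∀ α, ‖∫ x, (sampleResolvent η x * (D * (Q α).map Complex.ofReal)).trace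
        ∂sampleLaw σ μ - ∫ x, (sampleResolventErase η x α *
          (D * (Q α).map Complex.ofReal)).trace ∂sampleLaw σ μ‖ ≤ C / n * (C * √n * 2) := by
      intro α
      rw [← integral_sub (integrable_trace hη0 _) (integrable_trace_erase hη0 _ α)]
      have hi : Integrable (fun x : Sample m n => |(x α).1| * ((x α).2 ⬝ᵥ (x α).2))
          (sampleLaw σ μ) :=
        integrable_weight_mul (𝕜 := ℝ) α (g := fun a => |a|) h.integrable_id.abs
          (by fun_prop) (continuous_normSq α).measurable (h.integrable_sample_normSq α) (by simp)
      refine (norm_integral_le_of_norm_le (hi.const_mul (C / n))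
        (Eventually.of_forall fun x => ?_)).trans ?_
      · refine (norm_trace_mul_sub_erase_le hη0 x α _).trans (mul_le_mul_of_nonneg_right ?_
          (mul_nonneg (abs_nonneg _) (dotProduct_self_nonneg' _)))
        refine (div_le_self (norm_nonneg _) (one_le_pow₀ hη1)).trans ?_
        refine (norm_mul_le _ _).trans ?_
        have := h.norm_Q_le α
        nlinarith [norm_nonneg ((Q α).map Complex.ofReal), norm_nonneg D]
      · rw [integral_const_mul, integral_weight_mul (𝕜 := ℝ) α (g := fun a => |a|) (by fun_prop)
          (U := fun x => (x α).2 ⬝ᵥ (x α).2) (continuous_normSq α).measurable (by simp)]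
        refine mul_le_mul_of_nonneg_left ?_ (by positivity)
        exact mul_le_mul h.weight_abs_le (h.integral_sample_normSq_le α)
          (integral_nonneg fun x => dotProduct_self_nonneg' _) (by positivity)
    have hkm : m * ‖k‖ ≤ n * (3 * C) := by
      rw [hκk, norm_mul, norm_div, Complex.norm_natCast, Complex.norm_natCast,
        div_mul_eq_mul_div, div_le_iff₀ hn] at hκ
      linarith
    rw [he1, ← Finset.mul_sum, norm_mul]
    calc _ ≤ ‖k‖ * (m * (C / n * (C * √n * 2))) := by
          refine mul_le_mul_of_nonneg_left ?_ (norm_nonneg _)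
          refine (norm_sum_le _ _).trans ((Finset.sum_le_sum fun α _ => hterm α).trans ?_)
          simp
      _ = (m * ‖k‖) * (C / n * (C * √n * 2)) := by ring
      _ ≤ (n * (3 * C)) * (C / n * (C * √n * 2)) := mul_le_mul_of_nonneg_right hkm (by positivity)
      _ = n * (6 * C ^ 3 / √n) := by
          have h2 := Real.sq_sqrt hn.le
          have h3 : √(n : ℝ) ≠ 0 := (Real.sqrt_pos.2 hn).ne'
          field_simp
          rw [h2]
          ring
  have hb2 : ‖e2‖ ≤ τ := by
    have hb : ∀ x : Sample m n, ‖(sampleResolvent η x * (D * Bc)).trace‖ ≤ τ := by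
      intro x
      rw [← Matrix.mul_assoc, Matrix.trace_mul_comm]
      refine (norm_trace_ofReal_mul_le B _).trans ?_
      have h2 := norm_matrix_mul_le_of_le ((norm_sampleResolvent_le hη0 x).trans hinv) hD
      have h3 : √(n : ℝ) * ‖sampleResolvent η x * D‖ ≤ √n * 1 :=
        mul_le_mul_of_nonneg_left h2 (Real.sqrt_nonneg _)
      have h4 := Real.sqrt_pos.2 hn
      calc hsNorm B * (√n * ‖sampleResolvent η x * D‖) ≤ τ / √n * (√n * 1) :=
            mul_le_mul h.mean_le h3 (by positivity) (by have := h.nonneg; positivity)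
        _ = τ := by field_simp
    refine (norm_integral_le_of_norm_le_const (Eventually.of_forall hb)).trans ?_
    simp
  have hsum : ∑ α, k * ∫ x, (sampleResolventErase η x α * (D * (Q α).map Complex.ofReal)).trace
      ∂sampleLaw σ μ = n * κ * (meanTrace σ μ η D + e2) - e1 := by
    rw [← hs, he1, ← Finset.sum_sub_distrib]
    refine Finset.sum_congr rfl fun α _ => ?_
    ring
  rw [hsum] at h1
  have hfin : D.trace + (η * Complex.I) * ∫ x, (sampleResolvent η x * D).trace ∂sampleLaw σ μ -
      (n * κ * (meanTrace σ μ η D + e2) - e1) =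
      n * (D.trace / n + (η * Complex.I) * meanTrace σ μ η D - κ * meanTrace σ μ η D) +
      (e1 - n * κ * e2) := by
    rw [meanTrace]
    field_simp
    ring
  rw [hfin] at h1
  set X := D.trace / n + (η * Complex.I) * meanTrace σ μ η D - κ * meanTrace σ μ η D
  have h2 : ‖(n : ℂ) * X‖ ≤ n * (2 * C / η * (2 * (3 * C * Δ + √ρ))) +
      (n * (6 * C ^ 3 / √n) + n * (3 * C * τ)) := by
    have h3 : ‖e1 - n * κ * e2‖ ≤ n * (6 * C ^ 3 / √n) + n * (3 * C * τ) := by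
      refine (norm_sub_le _ _).trans (add_le_add hb1 ?_)
      rw [norm_mul, norm_mul, Complex.norm_natCast, mul_assoc]
      exact mul_le_mul_of_nonneg_left (mul_le_mul hκ hb2 (norm_nonneg _) (by positivity)) hn.le
    have h4 := norm_le_add_norm_add (n * X) (e1 - n * κ * e2)
    linarith
  rw [norm_mul, Complex.norm_natCast] at h2
  have h3 : ‖X‖ ≤ 2 * C / η * (2 * (3 * C * Δ + √ρ)) + (6 * C ^ 3 / √n + 3 * C * τ) := by
    refine le_of_mul_le_mul_left ?_ hn
    linarith
  have h4 : 4 * C / η * √ρ ≤ 4 * C * √ρ :=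
    mul_le_mul_of_nonneg_right (div_le_self (by positivity) hη1) (Real.sqrt_nonneg _)
  have h5 : 2 * C / η * (2 * (3 * C * Δ + √ρ)) = 12 * C ^ 2 / η * Δ + 4 * C / η * √ρ := by
    field_simp; ring
  rw [equationError]
  linarith

theorem equationError_nonneg : 0 ≤ equationError C τ n := by
  have := h.C_pos
  have := h.nonneg
  rw [equationError]
  positivity

/-- The mean Stieltjes transform satisfies the limiting equation up to a small error. -/
theorem norm_meanTrace_equation_le {η : ℝ} (hη : 20 * C ≤ η) :
    ‖1 + (η * Complex.I) * meanTrace σ μ η 1 -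
      weightTransform m n σ (meanTrace σ μ η 1) * meanTrace σ μ η 1‖ ≤
      6 * C * equationError C τ n := by
  have hC1 := h.one_le_C
  have hη1 : 1 ≤ η := by linarith
  have hη0 : 0 < η := by linarith
  have hn := h.n_pos
  have hnC : (n : ℂ) ≠ 0 := by exact_mod_cast hn.ne'
  have hinv : 1 / η ≤ 1 := by rw [div_le_one hη0]; exact hη1
  set f := meanTrace σ μ η 1 with hf
  set κ := weightTransform m n σ f with hκdef
  set R := equationError C τ n with hR
  have hR0 : 0 ≤ R := h.equationError_nonneg
  have hκ : ‖κ‖ ≤ 3 * C := h.norm_weightTransform_le hη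
  -- No trace-free structure of the mean resolvent is known in advance, so the deviation from a
  -- scalar matrix is measured in the weak sense over the whole unit ball, where it is at most 2.
  set S : Set ℝ := (fun D : Matrix (Fin n) (Fin n) ℂ =>
    ‖meanTrace σ μ η D - f * (D.trace / n)‖) '' {D | ‖D‖ ≤ 1} with hS
  have htr : ∀ D : Matrix (Fin n) (Fin n) ℂ, ‖D‖ ≤ 1 → ‖D.trace / n‖ ≤ 1 := by
    intro D hD
    rw [norm_div, Complex.norm_natCast, div_le_one hn]
    exact (norm_trace_le D).trans (by nlinarith)
  have hfn : ‖f‖ ≤ 1 := (h.norm_meanTrace_one_le hη0).trans hinv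
  have hbdd : BddAbove S := by
    refine ⟨2, ?_⟩
    rintro _ ⟨D, hD, rfl⟩
    have hD' : ‖D‖ ≤ 1 := hD
    have h1 : ‖meanTrace σ μ η D‖ ≤ 1 := (norm_meanTrace_le h.one_le_n hη0 D).trans
      (by nlinarith [norm_nonneg D, one_div_pos.2 hη0])
    have h2 : ‖f * (D.trace / n)‖ ≤ 1 := by
      rw [norm_mul]
      nlinarith [htr D hD, norm_nonneg f, norm_nonneg (D.trace / (n : ℂ))]
    exact (norm_sub_le _ _).trans (by linarith)
  have hne : S.Nonempty := ⟨_, 1, norm_one_le_one, rfl⟩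
  set Δ := sSup S with hΔdef
  have hΔ : ∀ D : Matrix (Fin n) (Fin n) ℂ, ‖D‖ ≤ 1 →
      ‖meanTrace σ μ η D - f * (D.trace / n)‖ ≤ Δ := fun D hD => le_csSup hbdd ⟨D, hD, rfl⟩
  have hΔ0 : 0 ≤ Δ := (norm_nonneg _).trans (hΔ 1 norm_one_le_one)
  have hone := h.norm_equation_le hη hΔ (D := 1) norm_one_le_one
  have e1 : (1 : Matrix (Fin n) (Fin n) ℂ).trace / n = 1 := by
    rw [Matrix.trace_one, Fintype.card_fin]; field_simp
  rw [e1, ← hf, ← hκdef, ← hR] at hone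
  have hC2 : 12 * C ^ 2 / η ≤ 12 / 20 * C := by
    rw [div_le_iff₀ hη0]; nlinarith
  have hlow : η / 2 ≤ ‖(η * Complex.I : ℂ) - κ‖ := by
    have h1 := norm_sub_norm_le (η * Complex.I : ℂ) κ
    rw [norm_mul, Complex.norm_I, mul_one, Complex.norm_real, Real.norm_of_nonneg hη0.le] at h1
    linarith
  have hstep : ∀ D : Matrix (Fin n) (Fin n) ℂ, ‖D‖ ≤ 1 →
      ‖meanTrace σ μ η D - f * (D.trace / n)‖ ≤ Δ / 2 + 4 * R := by
    intro D hD
    have hDq := h.norm_equation_le hη hΔ hD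
    rw [← hf, ← hκdef, ← hR] at hDq
    -- Subtracting `n⁻¹ tr D` times the equation for the identity cancels the inhomogeneous term and
    -- leaves the deviation multiplied by `iη - κ`, of modulus at least `η/2`.
    have e : ((η * Complex.I : ℂ) - κ) * (meanTrace σ μ η D - f * (D.trace / n)) =
        (D.trace / n + (η * Complex.I) * meanTrace σ μ η D - κ * meanTrace σ μ η D) -
        (D.trace / n) * (1 + (η * Complex.I) * f - κ * f) := by ring
    have h1 : ‖((η * Complex.I : ℂ) - κ) * (meanTrace σ μ η D - f * (D.trace / n))‖ ≤
        2 * (12 * C ^ 2 / η * Δ + R) := by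
      rw [e]
      refine (norm_sub_le _ _).trans ?_
      rw [norm_mul]
      nlinarith [htr D hD, norm_nonneg (1 + (η * Complex.I) * f - κ * f)]
    rw [norm_mul] at h1
    set t := ‖meanTrace σ μ η D - f * (D.trace / n)‖
    have ht : 0 ≤ t := norm_nonneg _
    -- Since `η ≥ 20 C`, division by `η/2` leaves a coefficient of `Δ` well below `1/2`. The
    -- supremum then yields `Δ ≤ 8 R`, and the final constant comes from `(12/20) · 8 C R + R ≤ 6 C
    -- R`.
    have h2 : η / 2 * t ≤ 2 * (12 / 20 * C * Δ + R) := by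
      nlinarith
    have h3 : η / 2 * t ≤ η / 2 * (Δ / 2 + 4 * R) := by
      nlinarith
    exact le_of_mul_le_mul_left h3 (by positivity)
  have hΔR : Δ ≤ 8 * R := by
    have : Δ ≤ Δ / 2 + 4 * R := by
      refine csSup_le hne ?_
      rintro _ ⟨D, hD, rfl⟩
      exact hstep D hD
    linarith
  refine hone.trans ?_
  nlinarith

/-- The normalized trace of the resolvent concentrates around its mean. -/
theorem integral_norm_normalizedTrace_sub_sq_le {η : ℝ} (hη : 1 ≤ η) :
    ∫ x, ‖(n : ℂ)⁻¹ * (sampleResolvent η x).trace - meanTrace σ μ η 1‖ ^ 2 ∂sampleLaw σ μ ≤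
      4 * C / n := by
  have hη0 : 0 < η := zero_lt_one.trans_le hη
  have hn := h.n_pos
  have hC := h.C_pos
  have h1 := h.variance_trace_le hη0 1
  simp only [Matrix.mul_one] at h1
  simp only [meanTrace, Matrix.mul_one, ← mul_sub, norm_mul, mul_pow]
  rw [integral_const_mul, norm_inv, Complex.norm_natCast]
  have h2 : (‖(1 : Matrix (Fin n) (Fin n) ℂ)‖ / η ^ 2) ^ 2 ≤ 1 := by
    refine pow_le_one₀ (by positivity) ?_
    rw [div_le_one (by positivity)]
    exact norm_one_le_one.trans (one_le_pow₀ hη)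
  calc _ ≤ ((n : ℝ)⁻¹) ^ 2 * (1 * (4 * C * n)) := by
        refine mul_le_mul_of_nonneg_left (h1.trans ?_) (by positivity)
        exact mul_le_mul_of_nonneg_right h2 (by positivity)
    _ = _ := by field_simp

end SampleBounds

end ApproximateEquation

/-! ### Stieltjes transforms: determination of measures, tightness, compactness. -/

section Stieltjes

theorem stieltjesTransform_eq (M : Measure ℝ) (z : ℂ) :
    stieltjesTransform M z = ∫ x : ℝ, ((x : ℂ) - z)⁻¹ ∂M := by
  simp [stieltjesTransform, resolventTransform_apply, resolvent, Ring.inverse_eq_inv']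

theorem ofReal_sub_ne_zero {z : ℂ} (hz : z.im ≠ 0) (x : ℝ) : (x : ℂ) - z ≠ 0 := by
  intro h
  have := congrArg Complex.im h
  simp [hz] at this

theorem norm_inv_ofReal_sub_le {z : ℂ} (hz : z.im ≠ 0) (x : ℝ) :
    ‖((x : ℂ) - z)⁻¹‖ ≤ |z.im|⁻¹ := by
  rw [norm_inv]
  refine inv_anti₀ (abs_pos.2 hz) ?_
  have h := Complex.abs_im_le_norm ((x : ℂ) - z)
  simpa using h

theorem continuous_inv_ofReal_sub {z : ℂ} (hz : z.im ≠ 0) :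
    Continuous fun x : ℝ => ((x : ℂ) - z)⁻¹ :=
  (Complex.continuous_ofReal.sub continuous_const).inv₀ (ofReal_sub_ne_zero hz)

/-- The function `x ↦ (x - z)⁻¹` on the real line. -/
def resolventBCF (z : ℂ) (hz : z.im ≠ 0) : ℝ →ᵇ ℂ :=
  BoundedContinuousFunction.ofNormedAddCommGroup (fun x : ℝ => ((x : ℂ) - z)⁻¹)
    (continuous_inv_ofReal_sub hz) |z.im|⁻¹ (norm_inv_ofReal_sub_le hz)

@[simp] theorem resolventBCF_apply (z : ℂ) (hz : z.im ≠ 0) (x : ℝ) :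
    resolventBCF z hz x = ((x : ℂ) - z)⁻¹ := rfl

theorem integrable_inv_ofReal_sub (M : Measure ℝ) [IsFiniteMeasure M] {z : ℂ} (hz : z.im ≠ 0) :
    Integrable (fun x : ℝ => ((x : ℂ) - z)⁻¹) M :=
  (resolventBCF z hz).integrable M

theorem stieltjesTransform_conj (M : Measure ℝ) (z : ℂ) :
    stieltjesTransform M (starRingEnd ℂ z) = starRingEnd ℂ (stieltjesTransform M z) := by
  rw [stieltjesTransform_eq, stieltjesTransform_eq, ← integral_conj]
  simp

/-- The points of the imaginary axis at distance at least `η₀` from `0`. -/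
def imaginaryRays (η₀ : ℝ) : Set ℂ := {z | z.re = 0 ∧ η₀ ≤ |z.im|}

theorem im_ne_zero_of_mem_imaginaryRays {η₀ : ℝ} (h0 : 0 < η₀) {z : ℂ}
    (hz : z ∈ imaginaryRays η₀) : z.im ≠ 0 := by
  intro h
  have := hz.2
  rw [h, abs_zero] at this
  linarith

section Uniqueness

set_option linter.unusedSectionVars false

variable (M N : Measure ℝ) [IsFiniteMeasure M] [IsFiniteMeasure N]

/-- The integrals of `g` and of `g / (x - z)`, for `z` in the set `Z`, agree for two measures. -/
def ResolventIntegralsAgree (Z : Set ℂ) (g : ℝ →ᵇ ℂ) : Prop :=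
  ∫ x, g x ∂M = ∫ x, g x ∂N ∧
    ∀ z ∈ Z, ∫ x, g x * ((x : ℂ) - z)⁻¹ ∂M = ∫ x, g x * ((x : ℂ) - z)⁻¹ ∂N

variable {M N}

theorem integrable_bcf_mul_inv (L : Measure ℝ) [IsFiniteMeasure L] (g : ℝ →ᵇ ℂ) {z : ℂ}
    (hz : z.im ≠ 0) : Integrable (fun x : ℝ => g x * ((x : ℂ) - z)⁻¹) L :=
  (g * resolventBCF z hz).integrable L

theorem ResolventIntegralsAgree.add {Z : Set ℂ} (hZ : ∀ z ∈ Z, z.im ≠ 0) {g g' : ℝ →ᵇ ℂ}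
    (h : ResolventIntegralsAgree M N Z g) (h' : ResolventIntegralsAgree M N Z g') :
    ResolventIntegralsAgree M N Z (g + g') := by
  refine ⟨?_, fun z hz => ?_⟩
  · simp only [BoundedContinuousFunction.add_apply]
    rw [integral_add (g.integrable M) (g'.integrable M), integral_add (g.integrable N)
      (g'.integrable N), h.1, h'.1]
  · simp only [BoundedContinuousFunction.add_apply, add_mul]
    rw [integral_add (integrable_bcf_mul_inv M g (hZ z hz)) (integrable_bcf_mul_inv M g' (hZ z hz)),
      integral_add (integrable_bcf_mul_inv N g (hZ z hz)) (integrable_bcf_mul_inv N g' (hZ z hz)),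
      h.2 z hz, h'.2 z hz]

theorem ResolventIntegralsAgree.smul {Z : Set ℂ} {g : ℝ →ᵇ ℂ} (c : ℂ)
    (h : ResolventIntegralsAgree M N Z g) : ResolventIntegralsAgree M N Z (c • g) := by
  refine ⟨?_, fun z hz => ?_⟩
  · simp only [BoundedContinuousFunction.smul_apply, smul_eq_mul]
    rw [integral_const_mul, integral_const_mul, h.1]
  · simp only [BoundedContinuousFunction.smul_apply, smul_eq_mul, mul_assoc]
    rw [integral_const_mul, integral_const_mul, h.2 z hz]

theorem ResolventIntegralsAgree.star {Z : Set ℂ} (hZ : ∀ z ∈ Z, starRingEnd ℂ z ∈ Z)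
    {g : ℝ →ᵇ ℂ} (h : ResolventIntegralsAgree M N Z g) :
    ResolventIntegralsAgree M N Z (star g) := by
  refine ⟨?_, fun z hz => ?_⟩
  · simp only [BoundedContinuousFunction.star_apply]
    have := congrArg (starRingEnd ℂ) h.1
    rwa [← integral_conj, ← integral_conj] at this
  · have := congrArg (starRingEnd ℂ) (h.2 _ (hZ z hz))
    rw [← integral_conj, ← integral_conj] at this
    simpa using this

/-- For `z ≠ w` partial fractions reduce the product of two resolvent kernels to single ones; the
case `z = w` follows by continuity. Closure under such products is what produces an algebra. -/
theorem ResolventIntegralsAgree.resolvent_mul {η₀ : ℝ} (h0 : 0 < η₀) {g : ℝ →ᵇ ℂ}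
    (h : ResolventIntegralsAgree M N (imaginaryRays η₀) g) {w : ℂ} (hw : w ∈ imaginaryRays η₀) :
    ResolventIntegralsAgree M N (imaginaryRays η₀)
      (resolventBCF w (im_ne_zero_of_mem_imaginaryRays h0 hw) * g) := by
  have hwi := im_ne_zero_of_mem_imaginaryRays h0 hw
  have hne : ∀ z ∈ imaginaryRays η₀, z ≠ w → ∫ x : ℝ, ((x : ℂ) - w)⁻¹ * g x * ((x : ℂ) - z)⁻¹ ∂M =
      ∫ x : ℝ, ((x : ℂ) - w)⁻¹ * g x * ((x : ℂ) - z)⁻¹ ∂N := by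
    intro z hz hzw
    have hzi := im_ne_zero_of_mem_imaginaryRays h0 hz
    have hd : w - z ≠ 0 := sub_ne_zero.2 hzw.symm
    have e : ∀ x : ℝ, ((x : ℂ) - w)⁻¹ * g x * ((x : ℂ) - z)⁻¹ =
        (w - z)⁻¹ * (g x * ((x : ℂ) - w)⁻¹ - g x * ((x : ℂ) - z)⁻¹) := by
      intro x
      have h1 := ofReal_sub_ne_zero hwi x
      have h2 := ofReal_sub_ne_zero hzi x
      field_simp
      ring
    simp only [e]
    rw [integral_const_mul, integral_const_mul, integral_sub (integrable_bcf_mul_inv M g hwi)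
      (integrable_bcf_mul_inv M g hzi), integral_sub (integrable_bcf_mul_inv N g hwi)
      (integrable_bcf_mul_inv N g hzi), h.2 w hw, h.2 z hz]
  refine ⟨?_, fun z hz => ?_⟩
  · have := h.2 w hw
    simpa only [BoundedContinuousFunction.mul_apply, resolventBCF_apply, mul_comm] using this
  · simp only [BoundedContinuousFunction.mul_apply, resolventBCF_apply]
    by_cases hzw : z = w
    · subst hzw
      -- These points lie on the ray of `z`, farther from `0`, so they stay in `imaginaryRays η₀`,
      -- differ from `z`, and have kernels bounded by the same constant.
      set u : ℕ → ℂ := fun k => ((1 + 1 / ((k : ℝ) + 1) : ℝ) : ℂ) * z with hu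
      have hone : ∀ k : ℕ, (1 : ℝ) < 1 + 1 / ((k : ℝ) + 1) := fun k => by
        have : (0 : ℝ) < 1 / ((k : ℝ) + 1) := by positivity
        linarith
      have huim : ∀ k, |z.im| ≤ |(u k).im| := by
        intro k
        rw [hu]
        simp only [Complex.im_ofReal_mul, abs_mul]
        rw [abs_of_pos (by linarith [hone k] : (0 : ℝ) < 1 + 1 / ((k : ℝ) + 1))]
        nlinarith [hone k, abs_nonneg z.im]
      have hmem : ∀ k, u k ∈ imaginaryRays η₀ := fun k =>
        ⟨by simp only [hu, Complex.re_ofReal_mul, hz.1, mul_zero], hz.2.trans (huim k)⟩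
      have hune : ∀ k, u k ≠ z := by
        intro k hk
        have h1 := congrArg Complex.im hk
        simp only [hu, Complex.im_ofReal_mul] at h1
        have h2 : (1 + 1 / ((k : ℝ) + 1)) = 1 := by
          have := mul_right_cancel₀ hwi (h1.trans (one_mul _).symm)
          exact this
        linarith [hone k]
      have hulim : Tendsto u atTop (𝓝 z) := by
        have h1 : Tendsto (fun k : ℕ => 1 + 1 / ((k : ℝ) + 1)) atTop (𝓝 (1 + 0)) :=
          tendsto_one_div_add_atTop_nhds_zero_nat.const_add 1
        have h2 := ((Complex.continuous_ofReal.tendsto _).comp h1).mul_const z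
        simp only [add_zero, Complex.ofReal_one, one_mul] at h2
        exact h2
      have hlim : ∀ L : Measure ℝ, [IsFiniteMeasure L] →
          Tendsto (fun k => ∫ x : ℝ, ((x : ℂ) - z)⁻¹ * g x * ((x : ℂ) - u k)⁻¹ ∂L) atTop
            (𝓝 (∫ x : ℝ, ((x : ℂ) - z)⁻¹ * g x * ((x : ℂ) - z)⁻¹ ∂L)) := by
        intro L _
        refine tendsto_integral_of_dominated_convergence (fun _ => |z.im|⁻¹ * ‖g‖ * |z.im|⁻¹)
          (fun k => ?_) (integrable_const _) (fun k => Eventually.of_forall fun x => ?_)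
          (Eventually.of_forall fun x => ?_)
        · have huk := im_ne_zero_of_mem_imaginaryRays h0 (hmem k)
          exact (((continuous_inv_ofReal_sub hwi).mul g.continuous).mul
            (continuous_inv_ofReal_sub huk)).aestronglyMeasurable
        · have huk := im_ne_zero_of_mem_imaginaryRays h0 (hmem k)
          rw [norm_mul, norm_mul]
          have h1 := norm_inv_ofReal_sub_le hwi x
          have h2 := g.norm_coe_le_norm x
          have h3 : ‖((x : ℂ) - u k)⁻¹‖ ≤ |z.im|⁻¹ :=
            (norm_inv_ofReal_sub_le huk x).trans (inv_anti₀ (abs_pos.2 hwi) (huim k))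
          gcongr
        · refine Tendsto.mul tendsto_const_nhds ?_
          exact (tendsto_const_nhds.sub hulim).inv₀ (ofReal_sub_ne_zero hwi x)
      refine tendsto_nhds_unique (hlim M) ?_
      refine (hlim N).congr fun k => ?_
      exact (hne (u k) (hmem k) (hune k)).symm
    · exact hne z hz hzw

/-- A finite measure is determined by its mass and its Stieltjes transform far out on the imaginary
axis. -/
theorem ext_of_stieltjesTransform_eq {η₀ : ℝ} (h0 : 0 < η₀)
    (hmass : M.real Set.univ = N.real Set.univ)
    (h : ∀ η : ℝ, η₀ ≤ η →
      stieltjesTransform M (η * Complex.I) = stieltjesTransform N (η * Complex.I)) : M = N := by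
  set Z := imaginaryRays η₀ with hZ
  have hZi : ∀ z ∈ Z, z.im ≠ 0 := fun z hz => im_ne_zero_of_mem_imaginaryRays h0 hz
  have hZc : ∀ z ∈ Z, starRingEnd ℂ z ∈ Z := by
    intro z hz
    refine ⟨by simpa using hz.1, by simpa using hz.2⟩
  have hst : ∀ z ∈ Z, stieltjesTransform M z = stieltjesTransform N z := by
    intro z hz
    have hz' : z = (z.im : ℂ) * Complex.I := by
      apply Complex.ext <;> simp [hz.1]
    rcases le_total 0 z.im with hpos | hneg
    · rw [hz']
      exact h _ (by simpa [abs_of_nonneg hpos] using hz.2)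
    · have h1 := h (-z.im) (by simpa [abs_of_nonpos hneg] using hz.2)
      have h2 : (((-z.im : ℝ) : ℂ) * Complex.I) = starRingEnd ℂ z := by
        apply Complex.ext <;> simp [hz.1]
      rw [h2, stieltjesTransform_conj, stieltjesTransform_conj] at h1
      exact (starRingEnd ℂ).injective h1
  have hone : ResolventIntegralsAgree M N Z 1 := by
    refine ⟨?_, fun z hz => ?_⟩
    · simp [hmass]
    · have := hst z hz
      rw [stieltjesTransform_eq, stieltjesTransform_eq] at this
      simpa using this
  -- The multipliers that preserve agreement form a star subalgebra. Applied to the constant `1`,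
  -- where agreement is equality of masses and transforms, it gives equal integrals on all of `A`;
  -- one resolvent kernel already separates points.
  let A : StarSubalgebra ℂ (ℝ →ᵇ ℂ) :=
    { carrier := {a | ∀ g, ResolventIntegralsAgree M N Z g → ResolventIntegralsAgree M N Z (a * g)}
      mul_mem' := by
        intro a b ha hb g hg
        rw [mul_assoc]
        exact ha _ (hb _ hg)
      one_mem' := by
        intro g hg
        rwa [one_mul]
      add_mem' := by
        intro a b ha hb g hg
        rw [add_mul]
        exact (ha _ hg).add hZi (hb _ hg)
      zero_mem' := by
        intro g hg
        have := hg.smul (0 : ℂ)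
        rw [zero_smul] at this
        rwa [zero_mul]
      algebraMap_mem' := by
        intro c g hg
        rw [← Algebra.smul_def]
        exact hg.smul c
      star_mem' := by
        intro a ha g hg
        have h1 := (ha _ (hg.star hZc)).star hZc
        rwa [star_mul', star_star] at h1 }
  have hA : ∀ w (hw : w ∈ Z), resolventBCF w (hZi w hw) ∈ A := fun w hw g hg =>
    hg.resolvent_mul h0 hw
  refine ext_of_forall_mem_subalgebra_integral_eq_of_polish (𝕜 := ℂ) (A := A) ?_ ?_
  · have hmem : (η₀ : ℂ) * Complex.I ∈ Z := by
      refine ⟨by simp, by simp [le_abs_self]⟩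
    intro x y hxy
    refine ⟨resolventBCF _ (hZi _ hmem), ⟨_, ⟨_, hA _ hmem, rfl⟩, rfl⟩, ?_⟩
    simp only [resolventBCF_apply, ne_eq, _root_.inv_inj, sub_left_inj, Complex.ofReal_inj]
    exact hxy
  · intro g hg
    have := (hg 1 hone).1
    simpa using this

end Uniqueness

theorem tendsto_stieltjesTransform_mass (M : Measure ℝ) [IsFiniteMeasure M] :
    Tendsto (fun η : ℝ => -(η * Complex.I) * stieltjesTransform M (η * Complex.I)) atTop
      (𝓝 (M.real Set.univ)) := by
  have e : ∀ η : ℝ, -(η * Complex.I) * stieltjesTransform M (η * Complex.I) =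
      ∫ x : ℝ, -(η * Complex.I) * ((x : ℂ) - η * Complex.I)⁻¹ ∂M := fun η => by
    rw [stieltjesTransform_eq, integral_const_mul]
  simp only [e]
  have h1 : ((M.real Set.univ : ℝ) : ℂ) = ∫ x : ℝ, (1 : ℂ) ∂M := by simp
  rw [h1]
  refine tendsto_integral_filter_of_dominated_convergence (fun _ => 1)
    (Eventually.of_forall fun η => ?_) ?_ (integrable_const _) (Eventually.of_forall fun x => ?_)
  · exact (measurable_const.mul ((Complex.measurable_ofReal.sub
      measurable_const).inv)).aestronglyMeasurable
  · filter_upwards [eventually_gt_atTop (0 : ℝ)] with η hη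
    refine Eventually.of_forall fun x => ?_
    have h2 := norm_inv_ofReal_sub_le (z := η * Complex.I) (by simpa using hη.ne') x
    rw [norm_mul, norm_neg, norm_mul, Complex.norm_I, mul_one, Complex.norm_real,
      Real.norm_of_nonneg hη.le]
    have h3 : (η * Complex.I : ℂ).im = η := by simp
    rw [h3, abs_of_pos hη] at h2
    calc η * ‖((x : ℂ) - η * Complex.I)⁻¹‖ ≤ η * η⁻¹ := mul_le_mul_of_nonneg_left h2 hη.le
      _ = 1 := mul_inv_cancel₀ hη.ne'
  · have h2 : Tendsto (fun η : ℝ => 1 - (x : ℂ) * ((η : ℂ)⁻¹ * (Complex.I)⁻¹)) atTop (𝓝 (1 - x *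
        (0 * Complex.I⁻¹))) := by
      refine tendsto_const_nhds.sub (tendsto_const_nhds.mul (Tendsto.mul_const _ ?_))
      have := (Complex.continuous_ofReal.tendsto 0).comp tendsto_inv_atTop_zero
      simpa [Function.comp_def] using this
    have h3 := h2.inv₀ (by simp)
    simp only [zero_mul, mul_zero, sub_zero, inv_one] at h3
    refine h3.congr' ?_
    filter_upwards [eventually_gt_atTop (0 : ℝ)] with η hη
    have h4 : (η : ℂ) ≠ 0 := by exact_mod_cast hη.ne'
    have h5 := ofReal_sub_ne_zero (z := η * Complex.I) (by simpa using hη.ne') x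
    have h6 : (1 - (x : ℂ) * ((η : ℂ)⁻¹ * (Complex.I)⁻¹)) =
        ((x : ℂ) - η * Complex.I) * (-(η * Complex.I))⁻¹ := by
      field_simp
      ring
    rw [h6, mul_inv, inv_inv, mul_comm]

theorem continuousOn_stieltjesTransform_axis (M : Measure ℝ) [IsFiniteMeasure M] :
    ContinuousOn (fun η : ℝ => stieltjesTransform M (η * Complex.I)) (Set.Ioi 0) := by
  intro η hη
  have hη' : 0 < η := hη
  refine ContinuousAt.continuousWithinAt ?_
  simp only [stieltjesTransform_eq]
  refine tendsto_integral_filter_of_dominated_convergence (fun _ => (η / 2)⁻¹)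
    (Eventually.of_forall fun η => ?_) ?_ (integrable_const _) (Eventually.of_forall fun x => ?_)
  · exact ((Complex.measurable_ofReal.sub measurable_const).inv).aestronglyMeasurable
  · filter_upwards [lt_mem_nhds (half_lt_self hη')] with t ht
    refine Eventually.of_forall fun x => ?_
    have ht0 : 0 < t := (half_pos hη').trans ht
    refine (norm_inv_ofReal_sub_le (by simpa using ht0.ne') x).trans ?_
    refine inv_anti₀ (half_pos hη') ?_
    simpa [abs_of_pos ht0] using ht.le
  · refine Tendsto.inv₀ ?_ (ofReal_sub_ne_zero (by simpa using hη'.ne') x)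
    exact (Continuous.tendsto (by fun_prop) η)

/-- The tails of a probability measure are controlled by its Stieltjes transform. -/
theorem measure_abs_gt_le (μ : Measure ℝ) [IsProbabilityMeasure μ] {η : ℝ} (hη : 0 < η) :
    μ {x | η < ‖x‖} ≤
      ENNReal.ofReal (2 * ‖1 + (η * Complex.I) * stieltjesTransform μ (η * Complex.I)‖) := by
  have hzi : ((η : ℂ) * Complex.I).im ≠ 0 := by simpa using hη.ne'
  have hi := integrable_inv_ofReal_sub μ hzi
  have hi2 : Integrable (fun x : ℝ => 1 + (η * Complex.I) * ((x : ℂ) - η * Complex.I)⁻¹) μ :=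
    (integrable_const _).add (hi.const_mul _)
  have e1 : 1 + (η * Complex.I) * stieltjesTransform μ (η * Complex.I) =
      ∫ x : ℝ, (1 + (η * Complex.I) * ((x : ℂ) - η * Complex.I)⁻¹) ∂μ := by
    rw [integral_add (integrable_const _) (hi.const_mul _), integral_const_mul,
      stieltjesTransform_eq]
    simp
  -- The real part is at least `1/2` where `|x| > η`, so Markov's inequality bounds the tail with
  -- the constant 2.
  have e2 : ∀ x : ℝ, (1 + (η * Complex.I) * ((x : ℂ) - η * Complex.I)⁻¹).re =
      x ^ 2 / (x ^ 2 + η ^ 2) := by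
    intro x
    have h1 := ofReal_sub_ne_zero hzi x
    have h2 : 1 + (η * Complex.I) * ((x : ℂ) - η * Complex.I)⁻¹ =
        (x : ℂ) * ((x : ℂ) - η * Complex.I)⁻¹ := by
      field_simp
      ring
    rw [h2, Complex.re_ofReal_mul, Complex.inv_re, Complex.normSq_apply]
    simp
    ring
  have hi3 : Integrable (fun x : ℝ => x ^ 2 / (x ^ 2 + η ^ 2)) μ := by
    refine hi2.re.congr (Eventually.of_forall fun x => ?_)
    exact e2 x
  have h3 : ∫ x : ℝ, x ^ 2 / (x ^ 2 + η ^ 2) ∂μ ≤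
      ‖1 + (η * Complex.I) * stieltjesTransform μ (η * Complex.I)‖ := by
    refine le_trans (le_of_eq ?_) (Complex.re_le_norm _)
    rw [e1]
    have := integral_re (𝕜 := ℂ) hi2
    refine Eq.trans ?_ this
    exact integral_congr_ae (Eventually.of_forall fun x => (e2 x).symm)
  have h4 := mul_meas_ge_le_integral_of_nonneg (μ := μ)
    (f := fun x : ℝ => x ^ 2 / (x ^ 2 + η ^ 2))
    (Eventually.of_forall fun x => by positivity) hi3 (1 / 2)
  have h5 : μ.real {x | η < ‖x‖} ≤ 2 * ∫ x : ℝ, x ^ 2 / (x ^ 2 + η ^ 2) ∂μ := by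
    have hsub : {x : ℝ | η < ‖x‖} ⊆ {x | 1 / 2 ≤ x ^ 2 / (x ^ 2 + η ^ 2)} := by
      intro x hx
      have hx' : η < |x| := hx
      have hpos : 0 < x ^ 2 + η ^ 2 := by positivity
      have : 1 / 2 ≤ x ^ 2 / (x ^ 2 + η ^ 2) := by
        rw [le_div_iff₀ hpos]
        nlinarith [sq_abs x]
      exact this
    have := measureReal_mono (μ := μ) hsub
    linarith
  rw [← ofReal_measureReal]
  exact ENNReal.ofReal_le_ofReal (by linarith)

theorem tendsto_stieltjesTransform {μ : ℕ → ProbabilityMeasure ℝ} {N : ProbabilityMeasure ℝ}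
    (h : Tendsto μ atTop (𝓝 N)) {z : ℂ} (hz : z.im ≠ 0) :
    Tendsto (fun j => stieltjesTransform (μ j : Measure ℝ) z) atTop
      (𝓝 (stieltjesTransform (N : Measure ℝ) z)) := by
  rw [ProbabilityMeasure.tendsto_iff_forall_integral_rclike_tendsto ℂ] at h
  simp only [stieltjesTransform_eq]
  exact h (resolventBCF z hz)

/-- Compactness: pointwise convergence of Stieltjes transforms of probability measures to a
function which behaves like `-1 / z` yields a weakly convergent subsequence. -/
theorem exists_subseq_tendsto_of_stieltjesTransform {μ : ℕ → ProbabilityMeasure ℝ} {f : ℝ → ℂ}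
    {η₀ : ℝ} (h0 : 0 < η₀)
    (hlim : ∀ q : ℚ, η₀ ≤ q → Tendsto
      (fun j => stieltjesTransform (μ j : Measure ℝ) ((q : ℝ) * Complex.I)) atTop (𝓝 (f q)))
    (hf : ∀ ε > 0, ∃ q : ℚ, η₀ ≤ q ∧ ‖1 + ((q : ℝ) * Complex.I) * f q‖ < ε) :
    ∃ (N : ProbabilityMeasure ℝ) (φ : ℕ → ℕ), StrictMono φ ∧ Tendsto (μ ∘ φ) atTop (𝓝 N) ∧
      ∀ q : ℚ, η₀ ≤ q → stieltjesTransform (N : Measure ℝ) ((q : ℝ) * Complex.I) = f q := by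
  -- At a `q` with `‖1 + iq f(q)‖ < δ` all but finitely many of the measures put mass at most `2 δ`
  -- on `|x| > q`.
  have htight : IsTightMeasureSet (Set.range fun j => (μ j : Measure ℝ)) := by
    refine isTightMeasureSet_range_of_tendsto_limsup_measure_norm_gt ?_
    rw [ENNReal.tendsto_nhds_zero]
    intro ε hε
    obtain ⟨δ, hδ0, hδ⟩ : ∃ δ : ℝ, 0 < δ ∧ ENNReal.ofReal (2 * δ) ≤ ε := by
      by_cases ht : ε = ⊤
      · exact ⟨1, one_pos, by simp [ht]⟩
      · refine ⟨ε.toReal / 2, half_pos (ENNReal.toReal_pos hε.ne' ht), ?_⟩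
        rw [mul_div_cancel₀ _ two_ne_zero, ENNReal.ofReal_toReal ht]
    obtain ⟨q, hq, hqf⟩ := hf δ hδ0
    have hq0 : (0 : ℝ) < q := h0.trans_le hq
    have hcont : Tendsto (fun j => ‖1 + ((q : ℝ) * Complex.I) *
        stieltjesTransform (μ j : Measure ℝ) ((q : ℝ) * Complex.I)‖) atTop
        (𝓝 ‖1 + ((q : ℝ) * Complex.I) * f q‖) :=
      (tendsto_const_nhds.add (tendsto_const_nhds.mul (hlim q hq))).norm
    filter_upwards [eventually_ge_atTop (q : ℝ)] with r hr
    refine limsup_le_of_le (by isBoundedDefault) ?_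
    filter_upwards [hcont.eventually (gt_mem_nhds hqf)] with j hj
    have hsub : {x : ℝ | r < ‖x‖} ⊆ {x | (q : ℝ) < ‖x‖} := fun x hx => hr.trans_lt hx
    refine (measure_mono hsub).trans ((measure_abs_gt_le (μ j : Measure ℝ) hq0).trans ?_)
    exact (ENNReal.ofReal_le_ofReal (by linarith)).trans hδ
  have hcomp : IsCompact (closure (Set.range μ)) := by
    refine isCompact_closure_of_isTightMeasureSet ?_
    convert htight using 1
    ext ρ
    simp
  obtain ⟨N, -, φ, hφ, hN⟩ := hcomp.tendsto_subseq fun j => subset_closure (Set.mem_range_self j)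
  refine ⟨N, φ, hφ, hN, fun q hq => ?_⟩
  have hq0 : (0 : ℝ) < q := h0.trans_le hq
  exact tendsto_nhds_unique (tendsto_stieltjesTransform hN (by simpa using hq0.ne'))
    ((hlim q hq).comp hφ.tendsto_atTop)

end Stieltjes

/-! ### The weight transform and its limit as a holomorphic function. -/

section LimitFunctional

theorem toGeneralized_withDensity {σ : Measure ℝ} {f : ℝ → ℝ} (hfm : Measurable f)
    (hf : Integrable f σ) (φ : testFunctions) :
    SignedMeasure.toGeneralized (σ.withDensityᵥ f) φ = ∫ x, f x * (φ : ℝ → ℝ) x ∂σ := by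
  have hp : ∀ x, ENNReal.ofReal (f x) = ((Real.toNNReal (f x) : NNReal) : ℝ≥0∞) := fun x => rfl
  have hq : ∀ x, ENNReal.ofReal (-f x) = ((Real.toNNReal (-f x) : NNReal) : ℝ≥0∞) := fun x => rfl
  have h1 := withDensityᵥ_eq_withDensity_pos_part_sub_withDensity_neg_part hf
  have : IsFiniteMeasure (σ.withDensity fun x => ENNReal.ofReal (f x)) :=
    isFiniteMeasure_withDensity_ofReal hf.2
  have : IsFiniteMeasure (σ.withDensity fun x => ENNReal.ofReal (-f x)) :=
    isFiniteMeasure_withDensity_ofReal hf.neg.2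
  have hi := fun t : SignedMeasure ℝ => integrable_testFunction t φ
  change ∫ᵛ x, (φ : ℝ → ℝ) x ∂<•(σ.withDensityᵥ f) = _
  rw [h1, VectorMeasure.integral_sub_vectorMeasure (hi _) (hi _)]
  simp only [VectorMeasure.integral_toSignedMeasure]
  have hφ : Continuous (φ : ℝ → ℝ) := φ.2.1.continuous
  obtain ⟨B, hB⟩ := φ.2.2.1
  have e1 : ∫ x, (φ : ℝ → ℝ) x ∂σ.withDensity (fun x => ENNReal.ofReal (f x)) =
      ∫ x, max (f x) 0 * (φ : ℝ → ℝ) x ∂σ := by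
    simp only [hp]
    rw [integral_withDensity_eq_integral_smul hfm.real_toNNReal]
    simp only [NNReal.smul_def, Real.coe_toNNReal', smul_eq_mul]
  have e2 : ∫ x, (φ : ℝ → ℝ) x ∂σ.withDensity (fun x => ENNReal.ofReal (-f x)) =
      ∫ x, max (-f x) 0 * (φ : ℝ → ℝ) x ∂σ := by
    simp only [hq]
    have hm : Measurable fun x => (-f x).toNNReal := hfm.neg.real_toNNReal
    rw [integral_withDensity_eq_integral_smul hm]
    simp only [NNReal.smul_def, Real.coe_toNNReal', smul_eq_mul]
  rw [e1, e2, ← integral_sub (hf.pos_part.mul_bdd (c := B) hφ.aestronglyMeasurable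
    (Eventually.of_forall hB)) (hf.neg_part.mul_bdd (c := B) hφ.aestronglyMeasurable
    (Eventually.of_forall hB))]
  congr 1
  ext x
  rw [← sub_mul, max_zero_sub_max_neg_zero_eq_self]

/-- The weights have bounded scaled second and third moments, and the scaled signed measures
converge weakly. -/
structure WeightLimit (m : ℕ → ℕ) (σ : ℕ → Measure ℝ) (ν : GeneralizedSignedMeasure) (C : ℝ) :
    Prop where
  nonneg : 0 ≤ C
  integrable_id : ∀ᶠ n in atTop, Integrable (fun a => a) (σ n)
  integrable_sq : ∀ᶠ n in atTop, Integrable (fun a => a ^ 2) (σ n)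
  integrable_cube : ∀ᶠ n in atTop, Integrable (fun a => |a| ^ 3) (σ n)
  sq_le : ∀ᶠ n in atTop, (m n / n : ℝ) * ∫ a, a ^ 2 ∂σ n ≤ C
  cube_le : ∀ᶠ n in atTop, (m n / n : ℝ) * ∫ a, |a| ^ 3 ∂σ n ≤ C
  weak : WeaklyConvergesTo (fun n => scaledSignedMeasure (m n) n (σ n)) ν

/-- The transform `∫ dν(ξ) / (1 + ξ w)`. -/
def limitTransform (ν : GeneralizedSignedMeasure) (w : ℂ) : ℂ :=
  ν.integral fun ξ : ℝ => 1 / (1 + (ξ : ℂ) * w)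

theorem norm_mul_integral_le {m n : ℕ} {σ : Measure ℝ} {g : ℝ → ℂ} {p : ℝ → ℝ}
    (hp : Integrable p σ) (hg : ∀ a, ‖g a‖ ≤ p a) {B : ℝ} (hB : (m / n : ℝ) * ∫ a, p a ∂σ ≤ B) :
    ‖(m / n : ℂ) * ∫ a, g a ∂σ‖ ≤ B := by
  rw [norm_mul, norm_div, Complex.norm_natCast, Complex.norm_natCast]
  refine le_trans ?_ hB
  exact mul_le_mul_of_nonneg_left (norm_integral_le_of_norm_le hp (Eventually.of_forall hg))
    (by positivity)

theorem integrable_ofReal_mul_kernel {σ : Measure ℝ} (hi : Integrable (fun a => a) σ) {w : ℂ}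
    (hw : w.im ≠ 0) : Integrable (fun a : ℝ => (a : ℂ) * (1 / (1 + (a : ℂ) * w))) σ := by
  have hid : Integrable (fun a : ℝ => (a : ℂ)) σ := hi.ofReal
  exact hid.mul_bdd (c := ‖w‖ / |w.im|) (measurable_one_div_one_add w).aestronglyMeasurable
    (Eventually.of_forall (norm_one_div_one_add_le hw))

/-- The difference of two kernels brings out another factor `a`, so the second moment suffices where
the total variation of `(m/n) ξ σ` is out of control. The bound is uniform in `n` and passes to the
limit. -/
theorem norm_weightTransform_sub_le {m n : ℕ} {σ : Measure ℝ} {C : ℝ}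
    (hi : Integrable (fun a => a) σ) (hi2 : Integrable (fun a => a ^ 2) σ)
    (hC : (m / n : ℝ) * ∫ a, a ^ 2 ∂σ ≤ C) {w w' : ℂ} (hw : w.im ≠ 0) (hw' : w'.im ≠ 0) :
    ‖weightTransform m n σ w - weightTransform m n σ w'‖ ≤
      ‖w‖ / |w.im| * (‖w'‖ / |w'.im|) * ‖w - w'‖ * C := by
  rw [weightTransform, weightTransform, ← mul_sub, ← integral_sub
    (integrable_ofReal_mul_kernel hi hw) (integrable_ofReal_mul_kernel hi hw')]
  refine norm_mul_integral_le
    (hi2.const_mul (‖w‖ / |w.im| * (‖w'‖ / |w'.im|) * ‖w - w'‖)) (fun a => ?_) ?_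
  · have h1 := one_add_ofReal_mul_ne_zero hw a
    have h2 := one_add_ofReal_mul_ne_zero hw' a
    have e : (a : ℂ) * (1 / (1 + (a : ℂ) * w)) - (a : ℂ) * (1 / (1 + (a : ℂ) * w')) =
        (1 / (1 + (a : ℂ) * w)) * (1 / (1 + (a : ℂ) * w')) * (w' - w) * (a : ℂ) ^ 2 := by
      field_simp
      ring
    rw [e, norm_mul, norm_mul, norm_mul, norm_pow, Complex.norm_real, Real.norm_eq_abs, sq_abs,
      norm_sub_rev w']
    have h3 := norm_one_div_one_add_le hw a
    have h4 := norm_one_div_one_add_le hw' a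
    gcongr
  · rw [integral_const_mul]
    have : 0 ≤ ‖w‖ / |w.im| * (‖w'‖ / |w'.im|) * ‖w - w'‖ := by positivity
    nlinarith

/-- Meant for small `w` with possibly much smaller imaginary part, as for the transform of an
unknown solution: the ratio `‖w‖ / |Im w|` appears only together with extra powers of `‖w‖`. -/
theorem norm_weightTransform_sub_mean_le {m n : ℕ} {σ : Measure ℝ} {C : ℝ}
    (hi : Integrable (fun a => a) σ) (hi2 : Integrable (fun a => a ^ 2) σ)
    (hi3 : Integrable (fun a => |a| ^ 3) σ) (hC : (m / n : ℝ) * ∫ a, a ^ 2 ∂σ ≤ C)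
    (hC' : (m / n : ℝ) * ∫ a, |a| ^ 3 ∂σ ≤ C) {w : ℂ} (hw : w.im ≠ 0) :
    ‖weightTransform m n σ w - (m / n : ℂ) * ∫ a : ℝ, (a : ℂ) ∂σ‖ ≤
      2 * C * ‖w‖ + 2 * C * ‖w‖ ^ 3 / |w.im| := by
  have hid : Integrable (fun a : ℝ => (a : ℂ)) σ := hi.ofReal
  rw [weightTransform, ← mul_sub, ← integral_sub (integrable_ofReal_mul_kernel hi hw) hid]
  refine norm_mul_integral_le
    ((hi2.const_mul (2 * ‖w‖)).add (hi3.const_mul (2 * ‖w‖ ^ 3 / |w.im|))) (fun a => ?_) ?_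
  · have h1 := one_add_ofReal_mul_ne_zero hw a
    have e : (a : ℂ) * (1 / (1 + (a : ℂ) * w)) - (a : ℂ) =
        -(w * (a : ℂ) ^ 2 * (1 / (1 + (a : ℂ) * w))) := by
      field_simp
      ring
    rw [e, norm_neg, norm_mul, norm_mul, norm_pow, Complex.norm_real, Real.norm_eq_abs, sq_abs]
    have hpos : 0 < |w.im| := abs_pos.2 hw
    -- For `|a w| ≤ 1/2` the kernel is at most 2; otherwise `1 ≤ 2 |a w|` is inserted into the
    -- uniform bound, at the price of a third moment.
    have hk : ‖1 / (1 + (a : ℂ) * w)‖ ≤ 2 + 2 * (|a| * ‖w‖) * (‖w‖ / |w.im|) := by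
      rcases le_total (|a| * ‖w‖) (1 / 2) with hs | hs
      · have h2 : 1 / 2 ≤ ‖1 + (a : ℂ) * w‖ := by
          have := norm_sub_le_norm_add (1 : ℂ) ((a : ℂ) * w)
          rw [norm_one, norm_mul, Complex.norm_real, Real.norm_eq_abs] at this
          linarith
        rw [norm_div, norm_one, div_le_iff₀ (by linarith)]
        have : 0 ≤ 2 * (|a| * ‖w‖) * (‖w‖ / |w.im|) := by positivity
        nlinarith
      · have h3 := norm_one_div_one_add_le hw a
        have h4 : 0 ≤ ‖w‖ / |w.im| := by positivity
        nlinarith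
    calc ‖w‖ * a ^ 2 * ‖1 / (1 + (a : ℂ) * w)‖
        ≤ ‖w‖ * a ^ 2 * (2 + 2 * (|a| * ‖w‖) * (‖w‖ / |w.im|)) := by gcongr
      _ = _ := by
          rw [← sq_abs a]
          simp only [Pi.add_apply]
          rw [sq_abs]
          field_simp
          rw [← sq_abs a]
          ring
  · have e := integral_add (hi2.const_mul (2 * ‖w‖)) (hi3.const_mul (2 * ‖w‖ ^ 3 / |w.im|))
    simp only [Pi.add_apply] at e ⊢
    rw [e, integral_const_mul, integral_const_mul]
    have h1 : 2 * ‖w‖ * ((m / n : ℝ) * ∫ a, a ^ 2 ∂σ) ≤ 2 * ‖w‖ * C := by gcongr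
    have h2 : 2 * ‖w‖ ^ 3 / |w.im| * ((m / n : ℝ) * ∫ a, |a| ^ 3 ∂σ) ≤
      2 * ‖w‖ ^ 3 / |w.im| * C := by gcongr
    have h3 : 2 * ‖w‖ ^ 3 / |w.im| * C = 2 * C * ‖w‖ ^ 3 / |w.im| := by ring
    nlinarith

/-- The exact remainder of the first-order expansion is `(w - w₀)² a³` times three kernels. Third
moments bound it uniformly in `n`, which gives differentiability of the limit although `ν` need not
be a measure. -/
theorem norm_weightTransform_taylor_le {m n : ℕ} {σ : Measure ℝ} {C : ℝ}
    (hi : Integrable (fun a => a) σ) (hi2 : Integrable (fun a => a ^ 2) σ)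
    (hi3 : Integrable (fun a => |a| ^ 3) σ)
    (hC' : (m / n : ℝ) * ∫ a, |a| ^ 3 ∂σ ≤ C) {w w₀ : ℂ} (hw : w.im ≠ 0) (hw₀ : w₀.im ≠ 0) :
    ‖weightTransform m n σ w - weightTransform m n σ w₀ - (w - w₀) *
        ((m / n : ℂ) * ∫ a : ℝ, -((a : ℂ) ^ 2 * (1 / (1 + (a : ℂ) * w₀)) ^ 2) ∂σ)‖ ≤
      ‖w‖ / |w.im| * (‖w₀‖ / |w₀.im|) ^ 2 * ‖w - w₀‖ ^ 2 * C := by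
  have hD : Integrable (fun a : ℝ => -((a : ℂ) ^ 2 * (1 / (1 + (a : ℂ) * w₀)) ^ 2)) σ := by
    have hid : Integrable (fun a : ℝ => ((a ^ 2 : ℝ) : ℂ)) σ := hi2.ofReal
    simp only [Complex.ofReal_pow] at hid
    refine (hid.mul_bdd (c := (‖w₀‖ / |w₀.im|) ^ 2)
      ((measurable_one_div_one_add w₀).pow_const 2).aestronglyMeasurable
      (Eventually.of_forall fun a => ?_)).neg
    rw [norm_pow]
    exact pow_le_pow_left₀ (norm_nonneg _) (norm_one_div_one_add_le hw₀ a) 2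
  have hAB : Integrable (fun a : ℝ => (a : ℂ) * (1 / (1 + (a : ℂ) * w)) -
      (a : ℂ) * (1 / (1 + (a : ℂ) * w₀))) σ :=
    (integrable_ofReal_mul_kernel hi hw).sub (integrable_ofReal_mul_kernel hi hw₀)
  rw [weightTransform, weightTransform, ← mul_sub, ← integral_sub
    (integrable_ofReal_mul_kernel hi hw) (integrable_ofReal_mul_kernel hi hw₀), mul_left_comm,
    ← mul_sub, ← integral_const_mul, ← integral_sub hAB (hD.const_mul _)]
  refine norm_mul_integral_le
    (hi3.const_mul (‖w‖ / |w.im| * (‖w₀‖ / |w₀.im|) ^ 2 * ‖w - w₀‖ ^ 2)) (fun a => ?_) ?_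
  · have h1 := one_add_ofReal_mul_ne_zero hw a
    have h2 := one_add_ofReal_mul_ne_zero hw₀ a
    have e : (a : ℂ) * (1 / (1 + (a : ℂ) * w)) - (a : ℂ) * (1 / (1 + (a : ℂ) * w₀)) -
        (w - w₀) * -((a : ℂ) ^ 2 * (1 / (1 + (a : ℂ) * w₀)) ^ 2) =
        (1 / (1 + (a : ℂ) * w)) * (1 / (1 + (a : ℂ) * w₀)) ^ 2 * (w - w₀) ^ 2 * (a : ℂ) ^ 3 := by
      field_simp
      ring
    rw [e, norm_mul, norm_mul, norm_mul, norm_pow, norm_pow, norm_pow, Complex.norm_real,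
      Real.norm_eq_abs]
    have h3 := norm_one_div_one_add_le hw a
    have h4 := norm_one_div_one_add_le hw₀ a
    gcongr
  · rw [integral_const_mul]
    have : 0 ≤ ‖w‖ / |w.im| * (‖w₀‖ / |w₀.im|) ^ 2 * ‖w - w₀‖ ^ 2 := by positivity
    nlinarith

namespace WeightLimit

variable {m : ℕ → ℕ} {σ : ℕ → Measure ℝ} {ν : GeneralizedSignedMeasure} {C : ℝ}
  (h : WeightLimit m σ ν C)
include h

theorem tendsto_integral {g : ℝ → ℂ} (hre : (fun x => (g x).re) ∈ testFunctions)
    (him : (fun x => (g x).im) ∈ testFunctions) :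
    Tendsto (fun n => (m n / n : ℂ) * ∫ a : ℝ, (a : ℂ) * g a ∂σ n) atTop (𝓝 (ν.integral g)) := by
  rw [GeneralizedSignedMeasure.integral, dif_pos ⟨hre, him⟩]
  have h1 := (Complex.continuous_ofReal.tendsto _).comp (h.weak ⟨_, hre⟩)
  have h2 := (Complex.continuous_ofReal.tendsto _).comp (h.weak ⟨_, him⟩)
  refine (h1.add (h2.mul_const Complex.I)).congr' ?_
  filter_upwards [h.integrable_id] with n hn
  have hf : Integrable (fun ξ : ℝ => (m n / n : ℝ) * ξ) (σ n) := hn.const_mul _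
  have hm : Measurable (fun ξ : ℝ => (m n / n : ℝ) * ξ) := by fun_prop
  simp only [Function.comp, scaledSignedMeasure]
  rw [toGeneralized_withDensity hm hf, toGeneralized_withDensity hm hf]
  simp only [mul_assoc, integral_const_mul]
  obtain ⟨hcr, ⟨B, hB⟩, -⟩ := hre
  obtain ⟨hci, ⟨B', hB'⟩, -⟩ := him
  have i1 : Integrable (fun a => a * (g a).re) (σ n) :=
    hn.mul_bdd (c := B) hcr.continuous.aestronglyMeasurable (Eventually.of_forall hB)
  have i2 : Integrable (fun a => a * (g a).im) (σ n) :=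
    hn.mul_bdd (c := B') hci.continuous.aestronglyMeasurable (Eventually.of_forall hB')
  have e : ∫ a : ℝ, (a : ℂ) * g a ∂σ n = ((∫ a, a * (g a).re ∂σ n : ℝ) : ℂ) +
      ((∫ a, a * (g a).im ∂σ n : ℝ) : ℂ) * Complex.I := by
    rw [← integral_complex_ofReal, ← integral_complex_ofReal, ← integral_mul_const]
    have i1' : Integrable (fun a => ((a * (g a).re : ℝ) : ℂ)) (σ n) := i1.ofReal
    have i2' : Integrable (fun a => ((a * (g a).im : ℝ) : ℂ)) (σ n) := i2.ofReal
    rw [← integral_add i1' (i2'.mul_const _)]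
    congr 1
    ext a
    conv_lhs => rw [← Complex.re_add_im (g a)]
    push_cast
    ring
  rw [e]
  push_cast
  ring

theorem tendsto_weightTransform {w : ℂ} (hw : w.im ≠ 0) :
    Tendsto (fun n => weightTransform (m n) n (σ n) w) atTop (𝓝 (limitTransform ν w)) :=
  h.tendsto_integral (kernel_mem_testFunctions hw).1 (kernel_mem_testFunctions hw).2

/-- Constants are test functions, so weak convergence includes that of the total masses. -/
theorem tendsto_mean : Tendsto (fun n => (m n / n : ℂ) * ∫ a : ℝ, (a : ℂ) ∂σ n) atTop
    (𝓝 (ν.integral fun _ => 1)) := by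
  have hconst : ∀ c : ℝ, (fun _ : ℝ => c) ∈ testFunctions := fun c =>
    ⟨contDiff_const, ⟨|c|, fun _ => le_rfl⟩, ⟨0, fun x => by simp⟩⟩
  have := h.tendsto_integral (g := fun _ => 1) (by simpa using hconst 1) (by simpa using hconst 0)
  simpa using this

theorem norm_limitTransform_sub_le {w w' : ℂ} (hw : w.im ≠ 0) (hw' : w'.im ≠ 0) :
    ‖limitTransform ν w - limitTransform ν w'‖ ≤
      ‖w‖ / |w.im| * (‖w'‖ / |w'.im|) * ‖w - w'‖ * C := by
  refine le_of_tendsto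
    ((h.tendsto_weightTransform hw).sub (h.tendsto_weightTransform hw')).norm ?_
  filter_upwards [h.integrable_id, h.integrable_sq, h.sq_le] with n h1 h2 h3
  exact norm_weightTransform_sub_le h1 h2 h3 hw hw'

theorem norm_limitTransform_le {w : ℂ} (hw : w.im ≠ 0) :
    ‖limitTransform ν w‖ ≤
      ‖ν.integral fun _ => 1‖ + (2 * C * ‖w‖ + 2 * C * ‖w‖ ^ 3 / |w.im|) := by
  have h1 : ‖limitTransform ν w - ν.integral fun _ => 1‖ ≤
      2 * C * ‖w‖ + 2 * C * ‖w‖ ^ 3 / |w.im| := by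
    refine le_of_tendsto ((h.tendsto_weightTransform hw).sub h.tendsto_mean).norm ?_
    filter_upwards [h.integrable_id, h.integrable_sq, h.integrable_cube, h.sq_le, h.cube_le]
      with n h1 h2 h3 h4 h5
    exact norm_weightTransform_sub_mean_le h1 h2 h3 h4 h5 hw
  have h2 := norm_le_norm_add_norm_sub' (limitTransform ν w) (ν.integral fun _ => 1)
  linarith

theorem limitTransform_conj {w : ℂ} (hw : w.im ≠ 0) :
    limitTransform ν (starRingEnd ℂ w) = starRingEnd ℂ (limitTransform ν w) := by
  have hw' : (starRingEnd ℂ w).im ≠ 0 := by simpa using hw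
  refine tendsto_nhds_unique (h.tendsto_weightTransform hw') ?_
  have h1 := (Complex.continuous_conj.tendsto _).comp (h.tendsto_weightTransform hw)
  refine h1.congr fun n => ?_
  simp only [Function.comp, weightTransform, map_mul, map_div₀, map_natCast, ← integral_conj,
    Complex.conj_ofReal, map_one, map_add]

/-- The derivatives at `w₀` are bounded by second moments, hence converge along a subsequence; the
Taylor bound passes to the limit along it. One subsequence is enough because the function values
converge along the full sequence. -/
theorem differentiableAt_limitTransform {w₀ : ℂ} (hw₀ : w₀.im ≠ 0) :
    DifferentiableAt ℂ (limitTransform ν) w₀ := by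
  set b₀ := ‖w₀‖ / |w₀.im| with hb₀
  set d : ℕ → ℂ := fun n =>
    (m n / n : ℂ) * ∫ a : ℝ, -((a : ℂ) ^ 2 * (1 / (1 + (a : ℂ) * w₀)) ^ 2) ∂σ n with hd
  have hdb : ∀ᶠ n in atTop, d n ∈ Metric.closedBall (0 : ℂ) (b₀ ^ 2 * C) := by
    filter_upwards [h.integrable_sq, h.sq_le] with n h1 h2
    rw [mem_closedBall_zero_iff]
    refine norm_mul_integral_le (h1.mul_const (b₀ ^ 2)) (fun a => ?_) ?_
    · rw [norm_neg, norm_mul, norm_pow, norm_pow, Complex.norm_real, Real.norm_eq_abs, sq_abs]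
      exact mul_le_mul_of_nonneg_left
        (pow_le_pow_left₀ (norm_nonneg _) (norm_one_div_one_add_le hw₀ a) 2) (sq_nonneg a)
    · rw [integral_mul_const]
      nlinarith [sq_nonneg b₀]
  obtain ⟨D, -, φ, hφ, hD⟩ := (isCompact_closedBall (0 : ℂ) (b₀ ^ 2 * C)).tendsto_subseq'
    hdb.frequently
  have hquad : ∀ w : ℂ, w.im ≠ 0 → ‖limitTransform ν w - limitTransform ν w₀ - (w - w₀) * D‖ ≤
      ‖w‖ / |w.im| * b₀ ^ 2 * ‖w - w₀‖ ^ 2 * C := by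
    intro w hw
    refine le_of_tendsto ((((h.tendsto_weightTransform hw).comp hφ.tendsto_atTop).sub
      ((h.tendsto_weightTransform hw₀).comp hφ.tendsto_atTop)).sub (hD.const_mul (w - w₀))).norm ?_
    filter_upwards [hφ.tendsto_atTop.eventually h.integrable_id,
      hφ.tendsto_atTop.eventually h.integrable_sq, hφ.tendsto_atTop.eventually h.integrable_cube,
      hφ.tendsto_atTop.eventually h.cube_le] with n h1 h2 h3 h5
    exact norm_weightTransform_taylor_le h1 h2 h3 h5 hw hw₀
  have hcont : ContinuousAt (fun w : ℂ => ‖w‖ / |w.im|) w₀ :=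
    continuousAt_id.norm.div Complex.continuous_im.continuousAt.abs (abs_ne_zero.2 hw₀)
  have hev : ∀ᶠ w in 𝓝 w₀, w.im ≠ 0 ∧ ‖w‖ / |w.im| < b₀ + 1 :=
    (Complex.continuous_im.continuousAt.eventually_ne hw₀).and
      (hcont.eventually (gt_mem_nhds (lt_add_one _)))
  have hO : (fun w => limitTransform ν w - limitTransform ν w₀ - (w - w₀) * D) =O[𝓝 w₀]
      fun w => ‖w - w₀‖ ^ 2 := by
    refine Asymptotics.IsBigO.of_bound ((b₀ + 1) * b₀ ^ 2 * C) ?_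
    filter_upwards [hev] with w hw
    refine (hquad w hw.1).trans ?_
    rw [norm_pow, norm_norm]
    have h1 : ‖w‖ / |w.im| * b₀ ^ 2 * ‖w - w₀‖ ^ 2 * C =
      ‖w‖ / |w.im| * (b₀ ^ 2 * C * ‖w - w₀‖ ^ 2) := by ring
    have h2 : (b₀ + 1) * b₀ ^ 2 * C * ‖w - w₀‖ ^ 2 = (b₀ + 1) * (b₀ ^ 2 * C * ‖w - w₀‖ ^ 2) := by
      ring
    rw [h1, h2]
    exact mul_le_mul_of_nonneg_right hw.2.le
      (mul_nonneg (mul_nonneg (sq_nonneg _) h.nonneg) (sq_nonneg _))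
  have ho := hO.trans_isLittleO (Asymptotics.isLittleO_pow_sub_sub w₀ one_lt_two)
  have hder : HasDerivAt (limitTransform ν) D w₀ := by
    rw [hasDerivAt_iff_isLittleO]
    simpa only [smul_eq_mul] using ho
  exact hder.differentiableAt

end WeightLimit

end LimitFunctional

/-! ### Uniqueness of the solution of the limiting equation. -/

section Uniqueness

/-- The region around `I / η` that contains the values of Stieltjes transforms at `η I`. -/
def InWindow (η : ℝ) (w : ℂ) : Prop :=
  ‖w‖ ≤ 3 / (2 * η) ∧ 1 / (2 * η) ≤ w.im

theorem InWindow.of_norm_le {η : ℝ} (hη : 0 < η) {w : ℂ}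
    (h : ‖1 + ((η : ℂ) * Complex.I) * w‖ ≤ 1 / 2) : InWindow η w := by
  constructor
  · have h1 : ‖((η : ℂ) * Complex.I) * w‖ = η * ‖w‖ := by
      simp [abs_of_pos hη]
    have h2 := norm_sub_le (1 + ((η : ℂ) * Complex.I) * w) 1
    rw [add_sub_cancel_left, h1, norm_one] at h2
    rw [le_div_iff₀ (by positivity)]
    linarith
  · have h1 := (Complex.abs_re_le_norm _).trans h
    have h2 : (1 + ((η : ℂ) * Complex.I) * w).re = 1 - η * w.im := by
      simp
      ring
    rw [h2] at h1
    have h3 := (abs_le.1 h1).2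
    rw [div_le_iff₀ (by positivity)]
    linarith

theorem InWindow.im_pos {η : ℝ} (hη : 0 < η) {w : ℂ} (h : InWindow η w) : 0 < w.im :=
  lt_of_lt_of_le (by positivity) h.2

theorem InWindow.norm_div_le {η : ℝ} (hη : 0 < η) {w : ℂ} (h : InWindow η w) :
    ‖w‖ / |w.im| ≤ 3 := by
  have h1 := h.im_pos hη
  rw [abs_of_pos h1, div_le_iff₀ h1]
  have h2 := h.2
  refine h.1.trans ?_
  have : 3 / (2 * η) = 3 * (1 / (2 * η)) := by ring
  rw [this]
  gcongr

theorem InWindow.norm_le {η : ℝ} (hη : 1 ≤ η) {w : ℂ} (h : InWindow η w) : ‖w‖ ≤ 3 / 2 :=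
  h.1.trans (div_le_div_of_nonneg_left (by norm_num) (by norm_num) (by linarith))

/-- Subtracting the equations gives `η ‖f - g‖ ≤ (‖κ(f)‖ + ‖g‖ Lip) ‖f - g‖`, with `κ` the limit
transform and `Lip` its Lipschitz constant on the window. There `‖w‖ ≤ 3/2` and `‖w‖ / Im w ≤ 3`, so
`‖κ(f)‖` is at most the total mass in absolute value plus `33/2 C`, and `‖g‖ Lip ≤ 27/2 C`. Together
this is `30 C`, and the extra `1` makes the inequality strict. -/
theorem WeightLimit.eq_of_equation {m : ℕ → ℕ} {σ : ℕ → Measure ℝ}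
    {ν : GeneralizedSignedMeasure} {C : ℝ} (h : WeightLimit m σ ν C) {η : ℝ}
    (hη : ‖ν.integral fun _ => 1‖ + 30 * C + 1 ≤ η) {f g : ℂ} (hf : InWindow η f)
    (hg : InWindow η g) (ef : ((η : ℂ) * Complex.I) * f = -1 + f * limitTransform ν f)
    (eg : ((η : ℂ) * Complex.I) * g = -1 + g * limitTransform ν g) : f = g := by
  have hC := h.nonneg
  have hN : 0 ≤ ‖ν.integral fun _ => 1‖ := norm_nonneg _
  have hη1 : 1 ≤ η := by linarith
  have hη0 : 0 < η := by linarith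
  have e : ((η : ℂ) * Complex.I) * (f - g) =
      (f - g) * limitTransform ν f + g * (limitTransform ν f - limitTransform ν g) := by
    rw [mul_sub, ef, eg]
    ring
  have e1 : ‖((η : ℂ) * Complex.I) * (f - g)‖ = η * ‖f - g‖ := by
    simp [abs_of_pos hη0]
  have hfi := (hf.im_pos hη0).ne'
  have hgi := (hg.im_pos hη0).ne'
  have h1 : ‖limitTransform ν f‖ ≤ ‖ν.integral fun _ => 1‖ + 33 / 2 * C := by
    have a1 := h.norm_limitTransform_le hfi
    have a2 := hf.norm_le hη1
    have a3 := hf.norm_div_le hη0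
    have a4 : 2 * C * ‖f‖ ^ 3 / |f.im| = 2 * C * ‖f‖ ^ 2 * (‖f‖ / |f.im|) := by ring
    have a5 : 2 * C * ‖f‖ ^ 2 * (‖f‖ / |f.im|) ≤ 2 * C * (3 / 2) ^ 2 * 3 := by gcongr
    have a6 : 2 * C * ‖f‖ ≤ 2 * C * (3 / 2) := by gcongr
    rw [a4] at a1
    linarith
  have h2 : ‖limitTransform ν f - limitTransform ν g‖ ≤ 9 * ‖f - g‖ * C := by
    refine (h.norm_limitTransform_sub_le hfi hgi).trans ?_
    have a3 := hf.norm_div_le hη0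
    have a4 := hg.norm_div_le hη0
    calc _ ≤ 3 * 3 * ‖f - g‖ * C := by gcongr
      _ = _ := by ring
  have h3 : η * ‖f - g‖ ≤ ‖f - g‖ * (‖ν.integral fun _ => 1‖ + 33 / 2 * C) +
      3 / 2 * (9 * ‖f - g‖ * C) := by
    rw [← e1, e]
    refine (norm_add_le _ _).trans ?_
    rw [norm_mul, norm_mul]
    have := hg.norm_le hη1
    gcongr
  have h4 : ‖f - g‖ ≤ 0 := by
    have := norm_nonneg (f - g)
    nlinarith
  exact sub_eq_zero.1 (norm_le_zero_iff.1 h4)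

theorem im_inv_ofReal_sub (η x : ℝ) :
    (((x : ℂ) - (η : ℂ) * Complex.I)⁻¹).im = η / (x ^ 2 + η ^ 2) := by
  rw [Complex.inv_im, Complex.normSq_apply]
  simp
  ring

theorem norm_inv_ofReal_sub_mul_I (η x : ℝ) :
    ‖((x : ℂ) - (η : ℂ) * Complex.I)⁻¹‖ = (√(x ^ 2 + η ^ 2))⁻¹ := by
  rw [norm_inv, Complex.norm_def, Complex.normSq_apply]
  congr 2
  simp
  ring

/-! ### Non-negative measures, possibly infinite, with integrable resolvent kernels. -/

section Candidate

variable {M : Measure ℝ}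
  (hint : ∀ z : ℂ, z.im ≠ 0 → Integrable (fun x : ℝ => ((x : ℂ) - z)⁻¹) M)
include hint

theorem integrable_poissonKernel {η : ℝ} (hη : 0 < η) :
    Integrable (fun x : ℝ => η / (x ^ 2 + η ^ 2)) M := by
  have := (hint (η * Complex.I) (by simpa using hη.ne')).im
  exact this.congr (Eventually.of_forall fun x => im_inv_ofReal_sub η x)

theorem im_stieltjesTransform {η : ℝ} (hη : 0 < η) :
    (stieltjesTransform M (η * Complex.I)).im = ∫ x : ℝ, η / (x ^ 2 + η ^ 2) ∂M := by
  have h1 := hint (η * Complex.I) (by simpa using hη.ne')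
  rw [stieltjesTransform_eq]
  have := integral_im h1
  simp only [RCLike.im_to_complex, im_inv_ofReal_sub] at this
  exact this.symm

/-- The kernel at `η = 1` dominates all later ones, so the limit holds even when the mass is
infinite. -/
theorem tendsto_stieltjesTransform_axis_zero :
    Tendsto (fun η : ℝ => stieltjesTransform M (η * Complex.I)) atTop (𝓝 0) := by
  simp only [stieltjesTransform_eq]
  have h0 : (0 : ℂ) = ∫ _ : ℝ, (0 : ℂ) ∂M := by simp
  rw [h0]
  refine tendsto_integral_filter_of_dominated_convergence
    (fun x : ℝ => ‖((x : ℂ) - ((1 : ℝ) : ℂ) * Complex.I)⁻¹‖) ?_ ?_ ?_ ?_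
  · filter_upwards [eventually_gt_atTop 0] with η hη
    exact (hint (η * Complex.I) (by simpa using hη.ne')).aestronglyMeasurable
  · filter_upwards [eventually_ge_atTop 1] with η hη
    refine Eventually.of_forall fun x => ?_
    rw [norm_inv_ofReal_sub_mul_I, norm_inv_ofReal_sub_mul_I]
    gcongr
  · exact (hint (((1 : ℝ) : ℂ) * Complex.I) (by simp)).norm
  · refine Eventually.of_forall fun x => ?_
    rw [tendsto_zero_iff_norm_tendsto_zero]
    simp only [norm_inv_ofReal_sub_mul_I]
    refine tendsto_inv_atTop_zero.comp ?_
    refine tendsto_atTop_mono (fun η => ?_) tendsto_id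
    exact Real.le_sqrt_of_sq_le (by simp; positivity)

/-- For `η ≥ 1` one has `η / (x² + η²) ≥ η⁻¹ / (x² + 1)`; the integral of the right side is positive
as `M ≠ 0`. -/
theorem exists_im_stieltjesTransform_ge (hM : M ≠ 0) :
    ∃ c : ℝ, 0 < c ∧ ∀ η : ℝ, 1 ≤ η → c / η ≤ (stieltjesTransform M (η * Complex.I)).im := by
  refine ⟨∫ x : ℝ, 1 / (x ^ 2 + 1 ^ 2) ∂M, ?_, fun η hη => ?_⟩
  · have hi := integrable_poissonKernel hint one_pos
    have hnn : (0 : ℝ → ℝ) ≤ fun x => 1 / (x ^ 2 + 1 ^ 2) := fun x => by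
      simp only [Pi.zero_apply]
      positivity
    rcases (integral_nonneg hnn).lt_or_eq with h | h
    · exact h
    · exfalso
      have h1 := (integral_eq_zero_iff_of_nonneg hnn hi).1 h.symm
      apply hM
      rw [← Measure.measure_univ_eq_zero]
      have h2 : ∀ᵐ _ ∂M, False := by
        filter_upwards [h1] with x hx
        have : (0 : ℝ) < 1 / (x ^ 2 + 1 ^ 2) := by positivity
        simp only [Pi.zero_apply] at hx
        linarith
      simpa [ae_iff] using h2
  · have hη0 : 0 < η := by linarith
    rw [im_stieltjesTransform hint hη0, ← integral_div]
    refine integral_mono ((integrable_poissonKernel hint one_pos).div_const η)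
      (integrable_poissonKernel hint hη0) fun x => ?_
    simp only
    rw [div_div, div_le_div_iff₀ (by positivity) (by positivity)]
    have : x ^ 2 ≤ η ^ 2 * x ^ 2 := le_mul_of_one_le_left (sq_nonneg x) (one_le_pow₀ hη)
    nlinarith

/-- On `[-k, k]` the Poisson kernel at height `k` is at least `1/(2k)` and its integral is at most
`B/k`, so every such interval has mass at most `2 B`. -/
theorem isFiniteMeasure_of_eventually_norm_le {B : ℝ}
    (hB : ∀ᶠ η : ℝ in atTop, η * ‖stieltjesTransform M (η * Complex.I)‖ ≤ B) :
    IsFiniteMeasure M := by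
  have hmono : Monotone fun k : ℕ => Set.Icc (-(k : ℝ)) k := fun a b hab =>
    Set.Icc_subset_Icc (by simpa using hab) (by simpa using hab)
  have hU : (⋃ k : ℕ, Set.Icc (-(k : ℝ)) k) = Set.univ := by
    refine Set.eq_univ_of_forall fun x => ?_
    obtain ⟨k, hk⟩ := exists_nat_ge |x|
    exact Set.mem_iUnion.2 ⟨k, abs_le.1 hk⟩
  have hlim := tendsto_measure_iUnion_atTop (μ := M) hmono
  rw [hU] at hlim
  have hle : M Set.univ ≤ ENNReal.ofReal (2 * B) := by
    refine le_of_tendsto hlim ?_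
    filter_upwards [tendsto_natCast_atTop_atTop.eventually hB, eventually_ge_atTop 1]
      with k hk hk1
    have hk0 : (0 : ℝ) < k := by exact_mod_cast hk1
    have hi := integrable_poissonKernel hint hk0
    have hnn : ∀ x : ℝ, 0 ≤ (k : ℝ) / (x ^ 2 + k ^ 2) := fun x => by positivity
    have h1 : ∫ x : ℝ, (k : ℝ) / (x ^ 2 + k ^ 2) ∂M ≤ B / k := by
      rw [← im_stieltjesTransform hint hk0, le_div_iff₀ hk0, mul_comm]
      refine le_trans ?_ hk
      gcongr
      exact (le_abs_self _).trans (Complex.abs_im_le_norm _)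
    have hsub : Set.Icc (-(k : ℝ)) k ⊆
        {x | ENNReal.ofReal (1 / (2 * k)) ≤ ENNReal.ofReal ((k : ℝ) / (x ^ 2 + k ^ 2))} := by
      intro x hx
      refine ENNReal.ofReal_le_ofReal ?_
      rw [div_le_div_iff₀ (by positivity) (by positivity)]
      have : x ^ 2 ≤ (k : ℝ) ^ 2 := sq_le_sq' hx.1 hx.2
      nlinarith
    have h2 := mul_meas_ge_le_lintegral₀ hi.aemeasurable.ennreal_ofReal
      (ENNReal.ofReal (1 / (2 * k)))
    rw [← ofReal_integral_eq_lintegral_ofReal hi (Eventually.of_forall hnn)] at h2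
    have h3 : ENNReal.ofReal (1 / (2 * k)) * M (Set.Icc (-(k : ℝ)) k) ≤
        ENNReal.ofReal (B / k) :=
      (mul_le_mul_right (measure_mono hsub) _).trans (h2.trans (ENNReal.ofReal_le_ofReal h1))
    have h4 : (0 : ℝ) < 1 / (2 * k) := by positivity
    have h5 : M (Set.Icc (-(k : ℝ)) k) =
        ENNReal.ofReal (2 * k) * (ENNReal.ofReal (1 / (2 * k)) * M (Set.Icc (-(k : ℝ)) k)) := by
      rw [← mul_assoc, ← ENNReal.ofReal_mul (by positivity), mul_one_div_cancel (by positivity),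
        ENNReal.ofReal_one, one_mul]
    calc M (Set.Icc (-(k : ℝ)) k)
        ≤ ENNReal.ofReal (2 * k) * ENNReal.ofReal (B / k) := by
          rw [h5]
          exact mul_le_mul_right h3 _
      _ = ENNReal.ofReal (2 * B) := by
          rw [← ENNReal.ofReal_mul (by positivity)]
          congr 1
          field_simp
  exact ⟨hle.trans_lt ENNReal.ofReal_lt_top⟩

end Candidate

/-- A bootstrap on the transform `s` along the axis. A priori only `s → 0` and `Im s ≥ c/η` are
known. Inserted into the equation they give `‖1 + iη s‖ ≤ o(1) + o(1) · η ‖s‖`, so `η ‖s‖` is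
bounded and `M` is finite; the same inequality then gives `-iη s → 1`, which is the total mass. -/
theorem WeightLimit.isProbabilityMeasure_and_inWindow {m : ℕ → ℕ} {σ : ℕ → Measure ℝ}
    {ν : GeneralizedSignedMeasure} {C : ℝ} (h : WeightLimit m σ ν C) {M : Measure ℝ}
    (hint : ∀ z : ℂ, z.im ≠ 0 → Integrable (fun x : ℝ => ((x : ℂ) - z)⁻¹) M)
    (hsol : SolvesLimitEquation ν (stieltjesTransform M)) :
    IsProbabilityMeasure M ∧
      ∀ᶠ η : ℝ in atTop, InWindow η (stieltjesTransform M (η * Complex.I)) := by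
  have hC := h.nonneg
  have hM : M ≠ 0 := by
    rintro rfl
    have := hsol Complex.I (by simp)
    simp [stieltjesTransform_eq] at this
  obtain ⟨c, hc, hcge⟩ := exists_im_stieltjesTransform_ge hint hM
  set s : ℝ → ℂ := fun η => stieltjesTransform M (η * Complex.I) with hs
  have hs0 : Tendsto (fun η => ‖s η‖) atTop (𝓝 0) :=
    tendsto_zero_iff_norm_tendsto_zero.1 (tendsto_stieltjesTransform_axis_zero hint)
  set K := ‖ν.integral fun _ => 1‖ + 2 * C with hK
  have hK0 : 0 ≤ K := by positivity
  have heq : ∀ η : ℝ, 1 ≤ η →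
      1 + ((η : ℂ) * Complex.I) * s η = s η * limitTransform ν (s η) := by
    intro η hη
    have := hsol (η * Complex.I) (by simp; linarith)
    rw [this]
    simp only [limitTransform, hs]
    ring
  have hkey : ∀ᶠ η : ℝ in atTop, ‖1 + ((η : ℂ) * Complex.I) * s η‖ ≤
      K * ‖s η‖ + 2 * C / c * ‖s η‖ ^ 3 * (η * ‖s η‖) := by
    filter_upwards [eventually_ge_atTop 1, hs0.eventually (gt_mem_nhds one_pos)] with η hη h1
    have hη0 : 0 < η := by linarith
    have him : c / η ≤ (s η).im := hcge η hη
    have him0 : 0 < (s η).im := lt_of_lt_of_le (by positivity) him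
    rw [heq η hη, norm_mul]
    have h2 := h.norm_limitTransform_le him0.ne'
    have h3 : 2 * C * ‖s η‖ ^ 3 / |(s η).im| ≤ 2 * C / c * ‖s η‖ ^ 3 * η := by
      rw [abs_of_pos him0]
      calc 2 * C * ‖s η‖ ^ 3 / (s η).im ≤ 2 * C * ‖s η‖ ^ 3 / (c / η) := by gcongr
        _ = _ := by field_simp
    have h4 : 2 * C * ‖s η‖ ≤ 2 * C := by nlinarith
    calc ‖s η‖ * ‖limitTransform ν (s η)‖ ≤ ‖s η‖ * (K + 2 * C / c * ‖s η‖ ^ 3 * η) := by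
          gcongr
          linarith
      _ = _ := by ring
  -- Eventually `η ‖s‖ ≤ 1 + 1 + η ‖s‖ / 2`, whence the constant 4.
  have hbound : ∀ᶠ η : ℝ in atTop, η * ‖s η‖ ≤ 4 := by
    have hsm : Tendsto (fun η => 2 * C / c * ‖s η‖ ^ 3) atTop (𝓝 0) := by
      simpa using (hs0.pow 3).const_mul (2 * C / c)
    have hsm' : Tendsto (fun η => K * ‖s η‖) atTop (𝓝 0) := by
      simpa using hs0.const_mul K
    filter_upwards [hkey, eventually_ge_atTop 1, hsm.eventually (gt_mem_nhds one_half_pos),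
      hsm'.eventually (gt_mem_nhds one_pos)] with η h1 h2 h3 h4
    have h5 : η * ‖s η‖ = ‖((η : ℂ) * Complex.I) * s η‖ := by
      simp [abs_of_pos (lt_of_lt_of_le one_pos h2)]
    have h6 := norm_sub_le (1 + ((η : ℂ) * Complex.I) * s η) 1
    rw [add_sub_cancel_left, ← h5, norm_one] at h6
    have h7 : 0 ≤ η * ‖s η‖ := by positivity
    nlinarith
  have hfin := isFiniteMeasure_of_eventually_norm_le hint hbound
  have hzero : Tendsto (fun η : ℝ => 1 + ((η : ℂ) * Complex.I) * s η) atTop (𝓝 0) := by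
    refine squeeze_zero_norm' (a := fun η => K * ‖s η‖ + 2 * C / c * ‖s η‖ ^ 3 * 4) ?_ ?_
    · filter_upwards [hkey, hbound] with η h1 h2
      refine h1.trans ?_
      gcongr
    · simpa using (hs0.const_mul K).add (((hs0.pow 3).const_mul (2 * C / c)).mul_const 4)
  refine ⟨⟨?_⟩, ?_⟩
  · have h1 := tendsto_stieltjesTransform_mass M
    have h2 : Tendsto (fun η : ℝ => -((η : ℂ) * Complex.I) * s η) atTop (𝓝 1) := by
      have := hzero.const_sub 1
      rw [sub_zero] at this
      refine this.congr fun η => ?_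
      ring
    have h3 : M.real Set.univ = 1 := by exact_mod_cast tendsto_nhds_unique h1 h2
    rw [← ENNReal.ofReal_toReal (measure_ne_top M Set.univ)]
    rw [Measure.real] at h3
    rw [h3, ENNReal.ofReal_one]
  · have h1 := (tendsto_zero_iff_norm_tendsto_zero.1 hzero).eventually
      (gt_mem_nhds one_half_pos)
    filter_upwards [h1, eventually_gt_atTop 0] with η h2 h3
    exact InWindow.of_norm_le h3 h2.le

theorem WeightLimit.eq_of_solvesLimitEquation {m : ℕ → ℕ} {σ : ℕ → Measure ℝ}
    {ν : GeneralizedSignedMeasure} {C : ℝ} (h : WeightLimit m σ ν C) {M N : Measure ℝ}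
    (hM : ∀ z : ℂ, z.im ≠ 0 → Integrable (fun x : ℝ => ((x : ℂ) - z)⁻¹) M)
    (hN : ∀ z : ℂ, z.im ≠ 0 → Integrable (fun x : ℝ => ((x : ℂ) - z)⁻¹) N)
    (hMs : SolvesLimitEquation ν (stieltjesTransform M))
    (hNs : SolvesLimitEquation ν (stieltjesTransform N)) : M = N := by
  obtain ⟨hM1, hM2⟩ := h.isProbabilityMeasure_and_inWindow hM hMs
  obtain ⟨hN1, hN2⟩ := h.isProbabilityMeasure_and_inWindow hN hNs
  obtain ⟨η₁, hη₁⟩ := eventually_atTop.1 (hM2.and hN2)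
  set η₂ := max η₁ (max (‖ν.integral fun _ => 1‖ + 30 * C + 1) 1) with hη₂
  have hη₂0 : 0 < η₂ := lt_of_lt_of_le one_pos ((le_max_right _ _).trans (le_max_right _ _))
  refine ext_of_stieltjesTransform_eq hη₂0 (by simp) fun η hη => ?_
  have h1 := hη₁ η ((le_max_left _ _).trans hη)
  have him : ((η : ℂ) * Complex.I).im ≠ 0 := by simpa using (hη₂0.trans_le hη).ne'
  exact h.eq_of_equation (((le_max_left _ _).trans (le_max_right _ _)).trans hη) h1.1 h1.2
    (hMs _ him) (hNs _ him)

end Uniqueness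

/-! ### From the asymptotic hypotheses to bounds at fixed size. -/

section Hypotheses

theorem integrable_and_mul_integral_le {X : Type*} [MeasurableSpace X] {σ : Measure X} {c C : ℝ}
    (hc : 0 < c) {f : X → ℝ} (hf : Measurable f) (hnn : ∀ a, 0 ≤ f a)
    (h : ENNReal.ofReal c * ∫⁻ a, ENNReal.ofReal (f a) ∂σ ≤ ENNReal.ofReal C) :
    Integrable f σ ∧ c * ∫ a, f a ∂σ ≤ max C 0 := by
  have hfin : ∫⁻ a, ENNReal.ofReal (f a) ∂σ ≠ ∞ := by
    intro htop
    rw [htop, ENNReal.mul_top (by simpa using hc)] at h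
    exact absurd h (by simp)
  have hint : Integrable f σ := by
    refine ⟨hf.aestronglyMeasurable, ?_⟩
    rw [hasFiniteIntegral_iff_ofReal (Eventually.of_forall hnn)]
    exact hfin.lt_top
  refine ⟨hint, ?_⟩
  rw [← ofReal_integral_eq_lintegral_ofReal hint (Eventually.of_forall hnn),
    ← ENNReal.ofReal_mul hc.le] at h
  have h1 : ENNReal.ofReal C = ENNReal.ofReal (max C 0) := by simp
  rw [h1] at h
  exact (ENNReal.ofReal_le_ofReal_iff (le_max_right _ _)).1 h

theorem hsNorm_smul_one {n : ℕ} (c : ℝ) :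
    hsNorm (c • (1 : Matrix (Fin n) (Fin n) ℝ)) = |c| * √n := by
  have : ∑ i : Fin n, ∑ j : Fin n, (c • (1 : Matrix (Fin n) (Fin n) ℝ)) i j ^ 2 = c ^ 2 * n := by
    simp [Matrix.one_apply, mul_comm]
  rw [hsNorm, this, Real.sqrt_mul (sq_nonneg c), Real.sqrt_sq_eq_abs]

variable {m : ℕ → ℕ} {Ω : ℕ → Type*} [∀ n, MeasurableSpace (Ω n)] {P : ∀ n, Measure (Ω n)}
  {y : ∀ n, Fin (m n) → Ω n → Fin n → ℝ}

/-- For `m = 0` the matrix inside the norm is `-I/n`, whose Hilbert–Schmidt norm equals `n^{-1/2}`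
and is not `o(n^{-1/2})`. -/
theorem eventually_one_le_of_isLittleO
    (hQ : (fun n : ℕ => hsNorm (((m n : ℝ)⁻¹ • (∑ α, secondMomentMatrix (P n) (y n α)))
        - (n : ℝ)⁻¹ • (1 : Matrix (Fin n) (Fin n) ℝ)))
      =o[atTop] fun n : ℕ => (n : ℝ) ^ (-(1 / 2) : ℝ)) : ∀ᶠ n in atTop, 1 ≤ m n := by
  filter_upwards [hQ.bound one_half_pos, eventually_ge_atTop 1] with n hn h1
  by_contra hm
  have hm0 : m n = 0 := by omega
  have hn0 : (0 : ℝ) < n := by exact_mod_cast h1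
  have hz : (∑ α, secondMomentMatrix (P n) (y n α)) = 0 := by
    have : IsEmpty (Fin (m n)) := by rw [hm0]; infer_instance
    exact Finset.sum_of_isEmpty _
  rw [hz, smul_zero, zero_sub, ← neg_smul, hsNorm_smul_one, abs_neg, abs_of_pos (inv_pos.2 hn0),
    Real.rpow_neg hn0.le, ← Real.sqrt_eq_rpow] at hn
  have hs : 0 < √(n : ℝ) := Real.sqrt_pos.2 hn0
  have e : (n : ℝ)⁻¹ * √n = (√n)⁻¹ := by
    rw [← Real.mul_self_sqrt hn0.le, mul_inv, Real.sqrt_mul_self hs.le]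
    field_simp
  rw [e, Real.norm_of_nonneg (inv_nonneg.2 hs.le)] at hn
  have := inv_pos.2 hs
  linarith

/-- Uniformity over all matrices follows from the condition on single sequences: at each `n` a
violating matrix is chosen if there is one, and the hypothesis is applied to the sequence so
obtained. -/
theorem eventually_evariance_le
    (hy_conc : ∀ D : ∀ n, Matrix (Fin n) (Fin n) ℝ, (∀ n, 1 ≤ n → opNorm (D n) = 1) →
      Tendsto (fun n => ⨆ α, evariance (fun ω => (D n *ᵥ y n α ω) ⬝ᵥ y n α ω) (P n))
        atTop (𝓝 0)) {ε : ℝ≥0∞} (hε : 0 < ε) :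
    ∀ᶠ n in atTop, ∀ D : Matrix (Fin n) (Fin n) ℝ, opNorm D = 1 → ∀ α,
      evariance (fun ω => (D *ᵥ y n α ω) ⬝ᵥ y n α ω) (P n) ≤ ε := by
  classical
  let bad : ∀ n, Matrix (Fin n) (Fin n) ℝ → Prop := fun n D => opNorm D = 1 ∧
    ∃ α, ε < evariance (fun ω => (D *ᵥ y n α ω) ⬝ᵥ y n α ω) (P n)
  let D : ∀ n, Matrix (Fin n) (Fin n) ℝ := fun n => if h : ∃ D, bad n D then h.choose else 1
  have hD : ∀ n, 1 ≤ n → opNorm (D n) = 1 := by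
    intro n hn
    by_cases h : ∃ D, bad n D
    · simp only [D, dif_pos h]
      exact h.choose_spec.1
    · simp only [D, dif_neg h]
      exact opNorm_one hn
  filter_upwards [(hy_conc D hD).eventually (ge_mem_nhds hε)] with n hn E hE α
  by_contra hlt
  have h : ∃ D, bad n D := ⟨E, hE, α, not_le.1 hlt⟩
  obtain ⟨β, hβ⟩ := h.choose_spec.2
  have hDn : D n = h.choose := dif_pos h
  rw [← hDn] at hβ
  exact absurd ((le_iSup (fun α => evariance (fun ω => (D n *ᵥ y n α ω) ⬝ᵥ y n α ω) (P n)) β).trans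
    hn) (not_le.2 hβ)

theorem integral_dotProduct_eq_trace {X : Type*} [MeasurableSpace X] {μ : Measure X} {n : ℕ}
    {Y : X → Fin n → ℝ} (hY : Measurable Y) (hi : Integrable (fun ω => Y ω ⬝ᵥ Y ω) μ) :
    ∫ ω, Y ω ⬝ᵥ Y ω ∂μ = (secondMomentMatrix μ Y).trace := by
  simp only [dotProduct, Matrix.trace, Matrix.diag_apply, secondMomentMatrix, Matrix.of_apply]
  refine integral_finsetSum _ fun i _ => ?_
  refine hi.mono' (by fun_prop) (Eventually.of_forall fun ω => ?_)
  rw [Real.norm_of_nonneg (mul_self_nonneg _)]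
  exact Finset.single_le_sum (f := fun i => Y ω i * Y ω i) (fun i _ => mul_self_nonneg _)
    (Finset.mem_univ i)

theorem continuous_quadratic {n : ℕ} (D : Matrix (Fin n) (Fin n) ℝ) :
    Continuous fun v : Fin n → ℝ => (D *ᵥ v) ⬝ᵥ v := by
  simp only [Matrix.mulVec, dotProduct]
  fun_prop

/-- By homogeneity; the zero matrix cannot be normalized and is treated apart. -/
theorem variance_quadratic_le {X : Type*} [MeasurableSpace X] {μ : Measure X} {n : ℕ}
    {Y : X → Fin n → ℝ} {τ : ℝ} (hτ : 0 ≤ τ)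
    (h : ∀ D : Matrix (Fin n) (Fin n) ℝ, opNorm D = 1 →
      evariance (fun ω => (D *ᵥ Y ω) ⬝ᵥ Y ω) μ ≤ ENNReal.ofReal τ)
    (D : Matrix (Fin n) (Fin n) ℝ) (hD : opNorm D ≤ 1) :
    variance (fun ω => (D *ᵥ Y ω) ⬝ᵥ Y ω) μ ≤ τ := by
  rcases eq_or_ne (opNorm D) 0 with h0 | h0
  · have hD0 := opNorm_eq_zero h0
    have : (fun ω => (D *ᵥ Y ω) ⬝ᵥ Y ω) = fun _ => (0 : ℝ) := by
      ext ω
      simp [hD0]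
    rw [this]
    have hz : variance (fun _ : X => (0 : ℝ)) μ = 0 := variance_zero μ
    rw [hz]
    exact hτ
  · set r := opNorm D with hr
    have hr0 : 0 < r := lt_of_le_of_ne (opNorm_nonneg D) (Ne.symm h0)
    set E := r⁻¹ • D with hE
    have hE1 : opNorm E = 1 := by
      rw [hE, opNorm_smul, abs_of_pos (inv_pos.2 hr0), ← hr, inv_mul_cancel₀ h0]
    have hDE : (fun ω => (D *ᵥ Y ω) ⬝ᵥ Y ω) = fun ω => r * ((E *ᵥ Y ω) ⬝ᵥ Y ω) := by
      ext ω
      rw [hE, Matrix.smul_mulVec, smul_dotProduct, smul_eq_mul, ← mul_assoc,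
        mul_inv_cancel₀ h0, one_mul]
    have h1 : variance (fun ω => (E *ᵥ Y ω) ⬝ᵥ Y ω) μ ≤ τ := ENNReal.toReal_le_of_le_ofReal hτ
      (h E hE1)
    rw [hDE, variance_const_mul]
    have h2 := variance_nonneg (fun ω => (E *ᵥ Y ω) ⬝ᵥ Y ω) μ
    have h3 : r ^ 2 ≤ 1 := pow_le_one₀ hr0.le hD
    nlinarith

variable {σ : ℕ → Measure ℝ} {ν : GeneralizedSignedMeasure}

theorem eventually_moment_le {p : ℕ} (hm : ∀ᶠ n in atTop, 1 ≤ m n)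
    (hσ : ∃ C : ℝ, ∀ n, 1 ≤ n →
      ENNReal.ofReal (m n / n : ℝ) * ∫⁻ x, ENNReal.ofReal (|x| ^ (p + 1)) ∂(σ n)
        ≤ ENNReal.ofReal C) :
    ∃ C : ℝ, ∀ᶠ n in atTop, Integrable (fun a => |a| ^ (p + 1)) (σ n) ∧
      (m n / n : ℝ) * ∫ a, |a| ^ (p + 1) ∂σ n ≤ C := by
  obtain ⟨C, hC⟩ := hσ
  refine ⟨max C 0, ?_⟩
  filter_upwards [hm, eventually_ge_atTop 1] with n h1 h2
  have h3 : (0 : ℝ) < m n / n := by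
    have a : (0 : ℝ) < m n := by exact_mod_cast h1
    have b : (0 : ℝ) < n := by exact_mod_cast h2
    positivity
  exact integrable_and_mul_integral_le h3 (by fun_prop) (fun a => by positivity) (hC n h2)

theorem exists_weightLimit [∀ n, IsProbabilityMeasure (σ n)] (hm : ∀ᶠ n in atTop, 1 ≤ m n)
    (hσ_weak : WeaklyConvergesTo (fun n => scaledSignedMeasure (m n) n (σ n)) ν)
    (hσ_moment : ∀ p ∈ ({1, 2, 3} : Set ℕ), ∃ C : ℝ, ∀ n, 1 ≤ n →
      ENNReal.ofReal (m n / n : ℝ) * ∫⁻ x, ENNReal.ofReal (|x| ^ (p + 1)) ∂(σ n)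
        ≤ ENNReal.ofReal C) : ∃ C, WeightLimit m σ ν C := by
  obtain ⟨C1, hC1⟩ := eventually_moment_le hm (hσ_moment 1 (by simp))
  obtain ⟨C2, hC2⟩ := eventually_moment_le hm (hσ_moment 2 (by simp))
  simp only [Nat.reduceAdd, sq_abs] at hC1 hC2
  exact ⟨max 0 (max C1 C2),
    { nonneg := le_max_left _ _
      integrable_id := hC1.mono fun n h =>
        ((memLp_two_iff_integrable_sq (by fun_prop)).2 h.1).integrable one_le_two
      integrable_sq := hC1.mono fun n h => h.1
      integrable_cube := hC2.mono fun n h => h.1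
      sq_le := hC1.mono fun n h => h.2.trans ((le_max_left _ _).trans (le_max_right _ _))
      cube_le := hC2.mono fun n h => h.2.trans ((le_max_right _ _).trans (le_max_right _ _))
      weak := hσ_weak }⟩

theorem WeightLimit.exists_mean_le {C : ℝ} (h : WeightLimit m σ ν C) :
    ∃ K : ℝ, ∀ᶠ n in atTop, |(m n / n : ℝ) * ∫ a, a ∂σ n| ≤ K := by
  refine ⟨‖ν.integral fun _ => 1‖ + 1, ?_⟩
  filter_upwards [h.tendsto_mean.norm.eventually (gt_mem_nhds (lt_add_one _))] with n hn
  refine le_trans (le_of_eq ?_) hn.le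
  rw [integral_complex_ofReal, ← Real.norm_eq_abs, ← Complex.norm_real]
  push_cast
  rfl

/-- The constant `C` is fixed before `τ`, so the range `η ≥ 20 C` stays the same while `τ`, which
governs the errors, is made arbitrarily small. -/
theorem WeightLimit.exists_sampleBounds [∀ n, IsProbabilityMeasure (P n)] {C₀ : ℝ}
    (h : WeightLimit m σ ν C₀) (hy_meas : ∀ n α, Measurable (y n α))
    (hy_conc : ∀ D : ∀ n, Matrix (Fin n) (Fin n) ℝ, (∀ n, 1 ≤ n → opNorm (D n) = 1) →
      Tendsto (fun n => ⨆ α, evariance (fun ω => (D n *ᵥ y n α ω) ⬝ᵥ y n α ω) (P n))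
        atTop (𝓝 0))
    (hQ_norm : ∃ C : ℝ, ∀ᶠ n : ℕ in atTop, ∀ α,
      opNorm (secondMomentMatrix (P n) (y n α)) ≤ C / n)
    (hQ_trace : ∀ ε > 0, ∀ᶠ n : ℕ in atTop, ∀ α,
      |(secondMomentMatrix (P n) (y n α)).trace - 1| ≤ ε)
    (hQ_mean : (fun n : ℕ => hsNorm (((m n : ℝ)⁻¹ • (∑ α, secondMomentMatrix (P n) (y n α)))
        - (n : ℝ)⁻¹ • (1 : Matrix (Fin n) (Fin n) ℝ)))
      =o[atTop] fun n : ℕ => (n : ℝ) ^ (-(1 / 2) : ℝ)) :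
    ∃ C, ∀ τ, 0 < τ → τ ≤ 1 → ∀ᶠ n in atTop, SampleBounds (σ n)
      (fun α => (P n).map (y n α)) (fun α => secondMomentMatrix (P n) (y n α)) C τ := by
  obtain ⟨K, hK⟩ := h.exists_mean_le
  obtain ⟨Cq, hCq⟩ := hQ_norm
  set C := max 1 (max C₀ (max K Cq)) with hC
  have hC0 : C₀ ≤ C := (le_max_left _ _).trans (le_max_right _ _)
  have hCK : K ≤ C := (le_max_left _ _).trans ((le_max_right _ _).trans (le_max_right _ _))
  have hCq' : Cq ≤ C := (le_max_right _ _).trans ((le_max_right _ _).trans (le_max_right _ _))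
  refine ⟨C, fun τ hτ hτ1 => ?_⟩
  have hτ4 : 0 < τ / 4 := by positivity
  filter_upwards [eventually_ge_atTop 1, eventually_one_le_of_isLittleO hQ_mean, h.integrable_sq,
    h.sq_le, hK, hCq, hQ_trace (τ / 4) hτ4, hQ_mean.bound hτ,
    eventually_evariance_le hy_conc (ENNReal.ofReal_pos.2 hτ4)]
    with n hn hm hsq hsq' hmean hq htr hB hconc
  have hn0 : (0 : ℝ) < n := by exact_mod_cast hn
  have hvar := fun α => variance_quadratic_le hτ4.le fun D hD => hconc D hD α
  have hs_meas : ∀ α, Measurable fun ω => y n α ω ⬝ᵥ y n α ω := fun α => by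
    have := (continuous_quadratic (1 : Matrix (Fin n) (Fin n) ℝ)).measurable.comp (hy_meas n α)
    simpa only [Function.comp_def, one_mulVec] using this
  have hL2 : ∀ α, MemLp (fun ω => y n α ω ⬝ᵥ y n α ω) 2 (P n) := by
    -- The extended variance is finite, and this is what yields square integrability of `|y|²`.
    intro α
    rw [← evariance_lt_top_iff_memLp (hs_meas α).aestronglyMeasurable]
    have := hconc 1 (opNorm_one hn) α
    simp only [one_mulVec] at this
    exact this.trans_lt ENNReal.ofReal_lt_top
  have hsc : Measurable fun v : Fin n → ℝ => (v ⬝ᵥ v) ^ 2 := by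
    simp only [dotProduct]
    fun_prop
  exact
    { one_le_n := hn
      one_le_m := hm
      one_le_C := le_max_left _ _
      nonneg := hτ.le
      le_one := hτ1
      integrable_sq := hsq
      weight_sq := hsq'.trans hC0
      weight_mean := hmean.trans hCK
      integrable_vector := fun α => by
        rw [integrable_map_measure hsc.aestronglyMeasurable (hy_meas n α).aemeasurable]
        exact (hL2 α).integrable_sq
      vector_sq := fun α => by
        rw [integral_map (hy_meas n α).aemeasurable hsc.aestronglyMeasurable]
        -- With `τ/4` in place of `τ`, `E |y|⁴ = Var |y|² + (tr Q)² ≤ 1/4 + (5/4)² < 4`.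
        have h1 := variance_eq_sub (hL2 α)
        have h2 := hvar α 1 (opNorm_one hn).le
        simp only [one_mulVec] at h2
        rw [integral_dotProduct_eq_trace (hy_meas n α) ((hL2 α).integrable one_le_two)] at h1
        simp only [Pi.pow_apply] at h1
        have h3 := abs_le.1 (htr α)
        nlinarith
      second_moment := fun α i j => by
        rw [integral_map (hy_meas n α).aemeasurable (by fun_prop)]
        rfl
      concentration := fun α D hD => by
        have hDm := (continuous_quadratic D).measurable
        rw [integral_map (hy_meas n α).aemeasurable hDm.aestronglyMeasurable,
          integral_map (hy_meas n α).aemeasurable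
            ((hDm.sub_const _).pow_const 2).aestronglyMeasurable]
        exact (variance_eq_integral (hDm.comp (hy_meas n α)).aemeasurable).symm.le.trans
          ((hvar α D hD).trans (by linarith))
      opNorm_le := fun α => (hq α).trans (by gcongr)
      trace_le := fun α => (htr α).trans (by linarith)
      mean_le := by
        rw [Real.norm_of_nonneg (Real.rpow_nonneg hn0.le _), Real.rpow_neg hn0.le,
          ← Real.sqrt_eq_rpow, ← div_eq_mul_inv] at hB
        exact (le_abs_self _).trans hB }

theorem map_prod_eq_sampleLaw {X : Type*} [MeasurableSpace X] {p : Measure X}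
    [IsProbabilityMeasure p] {m n : ℕ} {ξ : Fin m → X → ℝ} {Y : Fin m → X → Fin n → ℝ}
    {σ : Measure ℝ} [IsProbabilityMeasure σ]
    (hξ : ∀ α, Measurable (ξ α)) (hY : ∀ α, Measurable (Y α)) (hξi : iIndepFun ξ p)
    (hYi : iIndepFun Y p)
    (hi : IndepFun (fun ω α => ξ α ω) (fun ω α => Y α ω) p) (hlaw : ∀ α, p.map (ξ α) = σ) :
    p.map (fun ω α => (ξ α ω, Y α ω)) = sampleLaw σ fun α => p.map (Y α) := by
  have hpY : ∀ α, IsProbabilityMeasure (p.map (Y α)) := fun α =>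
    Measure.isProbabilityMeasure_map (hY α).aemeasurable
  have hξm : Measurable fun ω α => ξ α ω := measurable_pi_lambda _ hξ
  have hYm : Measurable fun ω α => Y α ω := measurable_pi_lambda _ hY
  have h1 := (indepFun_iff_map_prod_eq_prod_map_map hξm.aemeasurable hYm.aemeasurable).1 hi
  rw [hξi.map_fun_eq_pi_map fun α => (hξ α).aemeasurable,
    hYi.map_fun_eq_pi_map fun α => (hY α).aemeasurable] at h1
  simp only [hlaw] at h1
  have h2 := measurePreserving_arrowProdEquivProdArrow ℝ (Fin n → ℝ) (Fin m)
    (fun _ => σ) (fun α => p.map (Y α))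
  have h3 := h2.symm.map_eq
  rw [← h1, Measure.map_map (MeasurableEquiv.measurable _) (hξm.prodMk hYm)] at h3
  exact h3

end Hypotheses

/-! ### Convergence of the mean trace and of the normalized trace. -/

section Limit

open scoped Matrix.Norms.L2Operator

/-- For fixed `τ` the terms with `n` vanish as `n → ∞`; what remains is continuous in `τ` and zero
at `τ = 0`. -/
theorem exists_equationError_lt (C : ℝ) {ε : ℝ} (hε : 0 < ε) :
    ∃ τ, 0 < τ ∧ τ ≤ 1 ∧ ∀ᶠ n in atTop, 6 * C * equationError C τ n < ε := by
  have h1 : Tendsto (fun τ : ℝ => 6 * C * (4 * C * √(15 * τ + 0) + 3 * C * τ + 0)) (𝓝 0) (𝓝 0) := by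
    have : Continuous fun τ : ℝ => 6 * C * (4 * C * √(15 * τ + 0) + 3 * C * τ + 0) := by
      fun_prop
    simpa using this.tendsto 0
  obtain ⟨τ, hτ, h2, h3⟩ := (((h1.eventually (gt_mem_nhds hε)).filter_mono
    nhdsWithin_le_nhds).and (Ioc_mem_nhdsGT one_pos)).exists (f := 𝓝[>] (0 : ℝ))
  refine ⟨τ, h2, h3, ?_⟩
  have h4 : Tendsto (fun n : ℕ => 6 * C * equationError C τ n) atTop
      (𝓝 (6 * C * (4 * C * √(15 * τ + 0) + 3 * C * τ + 0))) := by
    have hn := tendsto_natCast_atTop_atTop (R := ℝ)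
    have a1 := (Real.continuous_sqrt.tendsto _).comp
      ((hn.const_div_atTop (40 * C ^ 3)).const_add (15 * τ))
    have a2 := (Real.tendsto_sqrt_atTop.comp hn).const_div_atTop (6 * C ^ 3)
    exact (((a1.const_mul (4 * C)).add_const (3 * C * τ)).add a2).const_mul (6 * C)
  exact h4.eventually (gt_mem_nhds hτ)

variable {m : ℕ → ℕ} {σ : ℕ → Measure ℝ} {μ : ∀ n, Fin (m n) → Measure (Fin n → ℝ)}
  {Q : ∀ n, Fin (m n) → Matrix (Fin n) (Fin n) ℝ}
  [∀ n, IsProbabilityMeasure (σ n)] [∀ n α, IsProbabilityMeasure (μ n α)]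
  {ν : GeneralizedSignedMeasure} {C₀ C : ℝ}

/-- The weight transform is evaluated at the moving point `f (ψ k)`; its Lipschitz bound, uniform in
`n`, allows replacing that point by `w`, where weak convergence applies. -/
theorem WeightLimit.equation_of_tendsto (h : WeightLimit m σ ν C₀)
    (hS : ∀ τ, 0 < τ → τ ≤ 1 → ∀ᶠ n in atTop, SampleBounds (σ n) (μ n) (Q n) C τ) {η : ℝ}
    (hη : 20 * C ≤ η) {ψ : ℕ → ℕ} (hψ : Tendsto ψ atTop atTop) {w : ℂ}
    (hw : w.im ≠ 0)
    (hlim : Tendsto (fun k => meanTrace (σ (ψ k)) (μ (ψ k)) η 1) atTop (𝓝 w)) :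
    ((η : ℂ) * Complex.I) * w = -1 + w * limitTransform ν w := by
  set f : ℕ → ℂ := fun n => meanTrace (σ n) (μ n) η 1 with hf
  have hb := hS 1 one_pos le_rfl
  have hratio : Tendsto (fun k => ‖f (ψ k)‖ / |(f (ψ k)).im|) atTop (𝓝 (‖w‖ / |w.im|)) :=
    hlim.norm.div ((Complex.continuous_im.tendsto _).comp hlim).abs (abs_ne_zero.2 hw)
  have hdiff : Tendsto (fun k => weightTransform (m (ψ k)) (ψ k) (σ (ψ k)) (f (ψ k)) -
      weightTransform (m (ψ k)) (ψ k) (σ (ψ k)) w) atTop (𝓝 0) := by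
    refine squeeze_zero_norm' (a := fun k => ‖f (ψ k)‖ / |(f (ψ k)).im| * (‖w‖ / |w.im|) *
      ‖f (ψ k) - w‖ * C₀) ?_ ?_
    · filter_upwards [hψ.eventually h.integrable_id, hψ.eventually h.integrable_sq,
        hψ.eventually h.sq_le, hψ.eventually hb] with k h1 h2 h3 h4
      exact norm_weightTransform_sub_le h1 h2 h3 (h4.im_meanTrace_pos hη).ne' hw
    · have h1 : Tendsto (fun k => ‖f (ψ k) - w‖) atTop (𝓝 0) :=
        tendsto_iff_norm_sub_tendsto_zero.1 hlim
      simpa using ((hratio.mul_const (‖w‖ / |w.im|)).mul h1).mul_const C₀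
  have hκ : Tendsto (fun k => weightTransform (m (ψ k)) (ψ k) (σ (ψ k)) (f (ψ k))) atTop
      (𝓝 (limitTransform ν w)) := by
    simpa using hdiff.add ((h.tendsto_weightTransform hw).comp hψ)
  have h1 : Tendsto (fun k => 1 + ((η : ℂ) * Complex.I) * f (ψ k) -
      weightTransform (m (ψ k)) (ψ k) (σ (ψ k)) (f (ψ k)) * f (ψ k)) atTop
      (𝓝 (1 + ((η : ℂ) * Complex.I) * w - limitTransform ν w * w)) :=
    ((hlim.const_mul _).const_add 1).sub (hκ.mul hlim)
  have h2 : Tendsto (fun k => 1 + ((η : ℂ) * Complex.I) * f (ψ k) -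
      weightTransform (m (ψ k)) (ψ k) (σ (ψ k)) (f (ψ k)) * f (ψ k)) atTop (𝓝 0) := by
    rw [Metric.tendsto_nhds]
    intro ε hε
    obtain ⟨τ, hτ, hτ1, hev⟩ := exists_equationError_lt C hε
    filter_upwards [hψ.eventually (hS τ hτ hτ1), hψ.eventually hev] with k h3 h4
    rw [dist_zero_right]
    exact (h3.norm_meanTrace_equation_le hη).trans_lt h4
  have h3 := tendsto_nhds_unique h1 h2
  linear_combination h3

/-- The mean traces stay in a compact window in which every cluster point solves the equation, and
the contraction leaves room for only one. -/
theorem WeightLimit.exists_tendsto_meanTrace (h : WeightLimit m σ ν C₀)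
    (hS : ∀ τ, 0 < τ → τ ≤ 1 → ∀ᶠ n in atTop, SampleBounds (σ n) (μ n) (Q n) C τ) {η : ℝ}
    (hη : 20 * C ≤ η) (hη' : ‖ν.integral fun _ => 1‖ + 30 * C₀ + 1 ≤ η) :
    ∃ w : ℂ, Tendsto (fun n => meanTrace (σ n) (μ n) η 1) atTop (𝓝 w) ∧ InWindow η w ∧
      ((η : ℂ) * Complex.I) * w = -1 + w * limitTransform ν w ∧
      ‖1 + ((η : ℂ) * Complex.I) * w‖ ≤ 10 * C / η := by
  have hη1 : 1 ≤ η := by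
    have := h.nonneg
    have := norm_nonneg (ν.integral fun _ => 1)
    linarith
  have hη0 : 0 < η := by linarith
  set K : Set ℂ := Metric.closedBall 0 (3 / (2 * η)) ∩ {w | 1 / (2 * η) ≤ w.im} with hK
  have hKc : IsCompact K := (isCompact_closedBall _ _).inter_right
    (isClosed_le continuous_const Complex.continuous_im)
  have hKw : ∀ w ∈ K, InWindow η w := fun w hw => ⟨by simpa using hw.1, hw.2⟩
  have hb := hS 1 one_pos le_rfl
  have hmem : ∀ᶠ n in atTop, meanTrace (σ n) (μ n) η 1 ∈ K := by
    filter_upwards [hb] with n hn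
    refine ⟨?_, hn.half_le_im_meanTrace hη⟩
    rw [mem_closedBall_zero_iff]
    refine (hn.norm_meanTrace_one_le hη0).trans ?_
    rw [div_le_div_iff₀ hη0 (by positivity)]
    linarith
  have heq : ∀ w ∈ K, MapClusterPt w atTop (fun n => meanTrace (σ n) (μ n) η 1) →
      ((η : ℂ) * Complex.I) * w = -1 + w * limitTransform ν w := by
    intro w hw hcl
    obtain ⟨ψ, hψ, hlim⟩ := hcl.tendsto_subseq
    exact h.equation_of_tendsto hS hη hψ.tendsto_atTop ((hKw w hw).im_pos hη0).ne' hlim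
  obtain ⟨w, hw, hcl⟩ := hKc.exists_mapClusterPt_of_frequently hmem.frequently
  have hlim : Tendsto (fun n => meanTrace (σ n) (μ n) η 1) atTop (𝓝 w) := by
    refine hKc.tendsto_nhds_of_unique_mapClusterPt hmem fun w' hw' hcl' => ?_
    exact h.eq_of_equation hη' (hKw w' hw') (hKw w hw) (heq w' hw' hcl') (heq w hw hcl)
  refine ⟨w, hlim, hKw w hw, heq w hw hcl, ?_⟩
  refine le_of_tendsto ((hlim.const_mul ((η : ℂ) * Complex.I)).const_add 1).norm ?_
  filter_upwards [hb] with n hn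
  exact hn.norm_one_add_meanTrace_le hη1

theorem tendsto_sampleLaw_normalizedTrace
    (hb : ∀ᶠ n in atTop, SampleBounds (σ n) (μ n) (Q n) C 1) {η : ℝ} (hη : 1 ≤ η) {w : ℂ}
    (hlim : Tendsto (fun n => meanTrace (σ n) (μ n) η 1) atTop (𝓝 w)) {δ : ℝ} (hδ : 0 < δ) :
    Tendsto (fun n => sampleLaw (σ n) (μ n)
      {x | δ ≤ ‖(n : ℂ)⁻¹ * (sampleResolvent η x).trace - w‖}) atTop (𝓝 0) := by
  have hη0 : 0 < η := by linarith
  have hup : Tendsto (fun n : ℕ => ENNReal.ofReal (4 * C / n / (δ / 2) ^ 2)) atTop (𝓝 0) := by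
    have h1 := ((tendsto_natCast_atTop_atTop (R := ℝ)).const_div_atTop (4 * C)).div_const
      ((δ / 2) ^ 2)
    rw [zero_div] at h1
    simpa using ENNReal.tendsto_ofReal h1
  refine tendsto_of_tendsto_of_tendsto_of_le_of_le' tendsto_const_nhds hup
    (Eventually.of_forall fun _ => zero_le) ?_
  filter_upwards [hb, Metric.tendsto_nhds.1 hlim (δ / 2) (by positivity)] with n hn hd
  rw [dist_eq_norm] at hd
  set g : Sample (m n) n → ℝ := fun x =>
    ‖(n : ℂ)⁻¹ * (sampleResolvent η x).trace - meanTrace (σ n) (μ n) η 1‖ with hg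
  have hgc : Continuous fun x : Sample (m n) n =>
      (n : ℂ)⁻¹ * (sampleResolvent η x).trace - meanTrace (σ n) (μ n) η 1 := by
    have := continuous_trace_sampleResolvent_mul (m := m n) hη0.ne' (1 : Matrix (Fin n) (Fin n) ℂ)
    simp only [Matrix.mul_one] at this
    fun_prop
  have hbd : ∀ x, g x ≤ (n : ℝ)⁻¹ * (n * (1 / η * ‖(1 : Matrix (Fin n) (Fin n) ℂ)‖)) +
      ‖meanTrace (σ n) (μ n) η 1‖ := by
    intro x
    refine (norm_sub_le _ _).trans ?_
    rw [norm_mul, norm_inv, Complex.norm_natCast]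
    have := norm_trace_sampleResolvent_mul_le hη0 (1 : Matrix (Fin n) (Fin n) ℂ) x
    rw [Matrix.mul_one] at this
    gcongr
  have hint : Integrable (fun x => g x ^ 2) (sampleLaw (σ n) (μ n)) := by
    refine Integrable.of_bound (hgc.norm.pow 2).aestronglyMeasurable
      (((n : ℝ)⁻¹ * (n * (1 / η * ‖(1 : Matrix (Fin n) (Fin n) ℂ)‖)) +
      ‖meanTrace (σ n) (μ n) η 1‖) ^ 2) (Eventually.of_forall fun x => ?_)
    rw [Real.norm_of_nonneg (sq_nonneg _)]
    exact pow_le_pow_left₀ (norm_nonneg _) (hbd x) 2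
  have hsub : {x : Sample (m n) n | δ ≤ ‖(n : ℂ)⁻¹ * (sampleResolvent η x).trace - w‖} ⊆
      {x | (δ / 2) ^ 2 ≤ g x ^ 2} := by
    intro x hx
    have h1 : δ ≤ ‖(n : ℂ)⁻¹ * (sampleResolvent η x).trace - w‖ := hx
    have h2 := norm_sub_le_norm_sub_add_norm_sub ((n : ℂ)⁻¹ * (sampleResolvent η x).trace)
      (meanTrace (σ n) (μ n) η 1) w
    exact pow_le_pow_left₀ (by positivity) (show δ / 2 ≤ ‖(n : ℂ)⁻¹ * (sampleResolvent η x).trace -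
      meanTrace (σ n) (μ n) η 1‖ by linarith) 2
  have hcheb := mul_meas_ge_le_integral_of_nonneg (μ := sampleLaw (σ n) (μ n))
    (f := fun x => g x ^ 2) (Eventually.of_forall fun x => sq_nonneg (g x)) hint ((δ / 2) ^ 2)
  have hfin : (sampleLaw (σ n) (μ n)).real {x | (δ / 2) ^ 2 ≤ g x ^ 2} ≤
      4 * C / n / (δ / 2) ^ 2 := by
    rw [le_div_iff₀ (by positivity), mul_comm]
    exact hcheb.trans (hn.integral_norm_normalizedTrace_sub_sq_le hη)
  calc _ ≤ sampleLaw (σ n) (μ n) {x | (δ / 2) ^ 2 ≤ g x ^ 2} := measure_mono hsub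
    _ = ENNReal.ofReal ((sampleLaw (σ n) (μ n)).real {x | (δ / 2) ^ 2 ≤ g x ^ 2}) := by
        rw [Measure.real, ENNReal.ofReal_toReal (measure_ne_top _ _)]
    _ ≤ _ := ENNReal.ofReal_le_ofReal hfin

theorem isProbabilityMeasure_empiricalSpectralDistribution {n : ℕ} (hn : 1 ≤ n)
    {A : Matrix (Fin n) (Fin n) ℝ} (hA : A.IsHermitian) :
    IsProbabilityMeasure (empiricalSpectralDistribution hA) := by
  refine ⟨?_⟩
  have hn0 : (n : ℝ≥0∞) ≠ 0 := by exact_mod_cast (by omega : n ≠ 0)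
  simp [empiricalSpectralDistribution, ENNReal.inv_mul_cancel hn0]

theorem stieltjesTransform_empiricalSpectralDistribution {n : ℕ}
    {A : Matrix (Fin n) (Fin n) ℝ} (hA : A.IsHermitian) {η : ℝ} (hη : η ≠ 0) :
    stieltjesTransform (empiricalSpectralDistribution hA) (η * Complex.I) =
      (n : ℂ)⁻¹ * (resolventAt η A).trace := by
  rw [stieltjesTransform_eq, empiricalSpectralDistribution, integral_smul_measure,
    integral_finsetSum_measure fun i _ => integrable_inv_ofReal_sub _ (by simpa using hη),
    trace_resolventAt hA hη]
  simp

/-- Finitely many bad events of total probability below `δ` cannot cover `B n`. The probability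
spaces for different `n` are unrelated, so this selection of points takes the place of an almost
surely convergent subsequence. -/
theorem exists_mem_of_tendsto_measure_zero {Ω : ℕ → Type*} [∀ n, MeasurableSpace (Ω n)]
    {P : ∀ n, Measure (Ω n)} {B : ∀ n, Set (Ω n)} {δ : ℝ≥0∞} (hδ : 0 < δ)
    (hB : ∃ᶠ n in atTop, δ ≤ P n (B n)) {bad : ℕ → ∀ n, Set (Ω n)}
    (hbad : ∀ i, Tendsto (fun n => P n (bad i n)) atTop (𝓝 0)) (s : Finset ℕ) :
    ∃ n, 1 ≤ n ∧ ∃ ω ∈ B n, ∀ i ∈ s, ω ∉ bad i n := by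
  have h1 : Tendsto (fun n => ∑ i ∈ s, P n (bad i n)) atTop (𝓝 0) := by
    simpa using tendsto_finsetSum s fun i _ => hbad i
  obtain ⟨n, hn, h2, h3⟩ :=
    (hB.and_eventually ((h1.eventually (gt_mem_nhds hδ)).and (eventually_ge_atTop 1))).exists
  refine ⟨n, h3, ?_⟩
  by_contra hcon
  push Not at hcon
  have h4 : B n ⊆ ⋃ i ∈ s, bad i n := fun ω hω => by simpa using hcon ω hω
  exact absurd (hn.trans ((measure_mono h4).trans (measure_biUnion_finset_le s _))) (not_le.2 h2)

end Limit

/-! ### Analytic continuation, weak convergence and the main theorem. -/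

section MainTheorem

theorem stieltjesTransform_im_pos (N : Measure ℝ) [IsProbabilityMeasure N] {z : ℂ}
    (hz : 0 < z.im) : 0 < (stieltjesTransform N z).im := by
  have hi := integrable_inv_ofReal_sub N hz.ne'
  have him : ∀ x : ℝ, (((x : ℂ) - z)⁻¹).im = z.im / Complex.normSq ((x : ℂ) - z) := by
    intro x
    rw [Complex.inv_im]
    simp
  have hpos : ∀ x : ℝ, 0 < (((x : ℂ) - z)⁻¹).im := fun x => by
    rw [him]
    exact div_pos hz (Complex.normSq_pos.2 (ofReal_sub_ne_zero hz.ne' x))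
  have h1 : (stieltjesTransform N z).im = ∫ x : ℝ, (((x : ℂ) - z)⁻¹).im ∂N := by
    rw [stieltjesTransform_eq]
    exact (integral_im hi).symm
  rw [h1, integral_pos_iff_support_of_nonneg (fun x => (hpos x).le) hi.im]
  have : Function.support (fun x : ℝ => (((x : ℂ) - z)⁻¹).im) = Set.univ :=
    Set.eq_univ_of_forall fun x => (hpos x).ne'
  rw [this]
  simp

theorem differentiableAt_stieltjesTransform (N : Measure ℝ) [IsFiniteMeasure N] {z : ℂ}
    (hz : z.im ≠ 0) : DifferentiableAt ℂ (stieltjesTransform N) z := by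
  refine (hasDerivAt_resolventTransform z ?_).differentiableAt
  rintro ⟨x, -, rfl⟩
  simp at hz

/-- The transform maps the upper half-plane into itself, where the limit transform is holomorphic,
so both sides of the equation are holomorphic there and the identity theorem applies. Conjugation
symmetry covers the lower half-plane. -/
theorem WeightLimit.solvesLimitEquation_of_frequently {m : ℕ → ℕ} {σ : ℕ → Measure ℝ}
    {ν : GeneralizedSignedMeasure} {C : ℝ} (h : WeightLimit m σ ν C) (N : Measure ℝ)
    [IsProbabilityMeasure N] {z₀ : ℂ} (hz₀ : 0 < z₀.im)
    (hfreq : ∃ᶠ z in 𝓝[≠] z₀, z * stieltjesTransform N z =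
      -1 + stieltjesTransform N z * limitTransform ν (stieltjesTransform N z)) :
    SolvesLimitEquation ν (stieltjesTransform N) := by
  set s := stieltjesTransform N with hs
  set U : Set ℂ := {z | 0 < z.im} with hU
  set g : ℂ → ℂ := fun z => z * s z - (-1 + s z * limitTransform ν (s z)) with hg
  have hUo : IsOpen U := isOpen_lt continuous_const Complex.continuous_im
  have hd : DifferentiableOn ℂ g U := by
    intro z hz
    have h1 : DifferentiableAt ℂ s z := differentiableAt_stieltjesTransform N (ne_of_gt hz)
    have h2 : DifferentiableAt ℂ (limitTransform ν) (s z) :=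
      h.differentiableAt_limitTransform (stieltjesTransform_im_pos N hz).ne'
    have h3 : DifferentiableAt ℂ (fun z => limitTransform ν (s z)) z := h2.comp z h1
    exact ((differentiableAt_id.mul h1).sub ((h1.mul h3).const_add _)).differentiableWithinAt
  have hzero := (hd.analyticOnNhd hUo).eqOn_zero_of_preconnected_of_frequently_eq_zero
    (convex_halfSpace_im_gt 0).isPreconnected hz₀ (hfreq.mono fun z hz => sub_eq_zero.2 hz)
  have hup : ∀ z : ℂ, 0 < z.im → z * s z = -1 + s z * limitTransform ν (s z) :=
    fun z hz => sub_eq_zero.1 (hzero hz)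
  intro z hz
  change z * s z = -1 + s z * limitTransform ν (s z)
  rcases lt_or_gt_of_ne hz with hneg | hpos
  · have h1 := hup (starRingEnd ℂ z) (by simpa using hneg)
    have h2 : s (starRingEnd ℂ z) = starRingEnd ℂ (s z) := stieltjesTransform_conj N z
    have h3 : (s z).im ≠ 0 := by
      have := stieltjesTransform_im_pos N (z := starRingEnd ℂ z) (by simpa using hneg)
      rw [← hs, h2] at this
      simp only [Complex.conj_im] at this
      linarith
    rw [h2, h.limitTransform_conj h3] at h1
    have h4 := congrArg (starRingEnd ℂ) h1
    simpa using h4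
  · exact hup z hpos

/-- Continuity along the axis and density of the rationals. Beyond `η₀ + 1` every rational near `η`
still exceeds `η₀`. -/
theorem eq_of_stieltjesTransform_rat_eq {M N : Measure ℝ} [IsProbabilityMeasure M]
    [IsProbabilityMeasure N] {η₀ : ℝ} (h0 : 0 < η₀)
    (h : ∀ q : ℚ, η₀ ≤ q → stieltjesTransform M (((q : ℝ) : ℂ) * Complex.I) =
      stieltjesTransform N (((q : ℝ) : ℂ) * Complex.I)) : M = N := by
  refine ext_of_stieltjesTransform_eq (η₀ := η₀ + 1) (by linarith) (by simp) fun η hη => ?_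
  have hη0 : η ∈ Set.Ioi (0 : ℝ) := by
    simp only [Set.mem_Ioi]
    linarith
  have hfreq : ∃ᶠ x : ℝ in 𝓝 η, x ∈ Set.range ((↑) : ℚ → ℝ) :=
    mem_closure_iff_frequently.1 (Rat.denseRange_cast η)
  have hc1 := (continuousOn_stieltjesTransform_axis M).continuousAt (Ioi_mem_nhds hη0)
  have hc2 := (continuousOn_stieltjesTransform_axis N).continuousAt (Ioi_mem_nhds hη0)
  by_contra hne
  have hev := (hc1.ne_iff_eventually_ne hc2).1 hne
  obtain ⟨x, ⟨q, rfl⟩, h1, h2⟩ :=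
    (hfreq.and_eventually (hev.and (lt_mem_nhds (show η₀ < η by linarith)))).exists
  exact h1 (h q h2.le)

variable {m : ℕ → ℕ} {Ω : ℕ → Type*} [∀ n, MeasurableSpace (Ω n)] {P : ∀ n, Measure (Ω n)}
  {A : ∀ n, Ω n → Matrix (Fin n) (Fin n) ℝ} (hA : ∀ n ω, (A n ω).IsHermitian)
include hA

/-- If the Stieltjes transforms of the empirical spectral distributions converge in probability at
the points `q I`, then along some realizations in any given family of events whose probabilities do
not tend to `0` the empirical spectral distributions converge weakly. -/
theorem exists_realizations {f : ℝ → ℂ} {η₀ : ℝ} (h0 : 0 < η₀)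
    (hconv : ∀ η : ℝ, η₀ ≤ η → ∀ δ > 0, Tendsto (fun n => P n
      {ω | δ ≤ ‖stieltjesTransform (empiricalSpectralDistribution (hA n ω)) (η * Complex.I) -
        f η‖}) atTop (𝓝 0))
    (hf : ∀ ε > 0, ∃ q : ℚ, η₀ ≤ q ∧ ‖1 + (((q : ℝ) : ℂ) * Complex.I) * f q‖ < ε)
    {B : ∀ n, Set (Ω n)} {δ : ℝ≥0∞} (hδ : 0 < δ) (hB : ∃ᶠ n in atTop, δ ≤ P n (B n)) :
    ∃ (N : ProbabilityMeasure ℝ) (k : ℕ → ℕ) (ω : ∀ j, Ω (k j))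
      (μ : ℕ → ProbabilityMeasure ℝ), (∀ j, ω j ∈ B (k j)) ∧
      (∀ j, (μ j : Measure ℝ) = empiricalSpectralDistribution (hA (k j) (ω j))) ∧
      Tendsto μ atTop (𝓝 N) ∧
      ∀ q : ℚ, η₀ ≤ q → stieltjesTransform N (((q : ℝ) : ℂ) * Complex.I) = f q := by
  obtain ⟨q₀, hq₀⟩ := exists_rat_gt η₀
  have : Nonempty {q : ℚ // η₀ ≤ q} := ⟨⟨q₀, hq₀.le⟩⟩
  obtain ⟨e, he⟩ := exists_surjective_nat {q : ℚ // η₀ ≤ q}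
  -- With `e` enumerating the rationals above `η₀`, the `j`-th realization has its transform within
  -- `1/(j+1)` of `f` at the first `j + 1` of them: a diagonal choice.
  have hsel := fun j : ℕ => exists_mem_of_tendsto_measure_zero hδ hB
    (fun i => hconv ((e i : ℚ) : ℝ) (e i).2 (1 / ((j : ℝ) + 1)) (by positivity))
    (Finset.range (j + 1))
  choose k hk ω hω hgood using hsel
  let μ : ℕ → ProbabilityMeasure ℝ := fun j => ⟨empiricalSpectralDistribution (hA (k j) (ω j)),
    isProbabilityMeasure_empiricalSpectralDistribution (hk j) (hA (k j) (ω j))⟩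
  have hlim : ∀ q : ℚ, η₀ ≤ q → Tendsto (fun j =>
      stieltjesTransform (μ j) (((q : ℝ) : ℂ) * Complex.I)) atTop (𝓝 (f q)) := by
    intro q hq
    obtain ⟨i, hi⟩ := he ⟨q, hq⟩
    rw [tendsto_iff_norm_sub_tendsto_zero]
    refine squeeze_zero' (Eventually.of_forall fun _ => norm_nonneg _) ?_
      tendsto_one_div_add_atTop_nhds_zero_nat
    filter_upwards [eventually_ge_atTop i] with j hj
    have h1 := hgood j i (Finset.mem_range.2 (by omega))
    rw [hi] at h1
    exact (not_le.1 h1).le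
  obtain ⟨N, φ, hφ, hN, hNf⟩ := exists_subseq_tendsto_of_stieltjesTransform h0 hlim hf
  exact ⟨N, k ∘ φ, fun j => ω (φ j), μ ∘ φ, fun j => hω _, fun j => rfl, hN, hNf⟩

/-- Whole spaces as events produce the limit `N`. If convergence in probability failed for some `φ`,
realizations taken inside the failure events would converge weakly to a measure with the same
transform at rational points, hence to `N`, against the choice of the events. -/
theorem exists_weakLimit [∀ n, IsProbabilityMeasure (P n)] {f : ℝ → ℂ} {η₀ : ℝ} (h0 : 0 < η₀)
    (hconv : ∀ η : ℝ, η₀ ≤ η → ∀ δ > 0, Tendsto (fun n => P n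
      {ω | δ ≤ ‖stieltjesTransform (empiricalSpectralDistribution (hA n ω)) (η * Complex.I) -
        f η‖}) atTop (𝓝 0))
    (hf : ∀ ε > 0, ∃ q : ℚ, η₀ ≤ q ∧ ‖1 + (((q : ℝ) : ℂ) * Complex.I) * f q‖ < ε) :
    ∃ N : ProbabilityMeasure ℝ,
      (∀ q : ℚ, η₀ ≤ q → stieltjesTransform N (((q : ℝ) : ℂ) * Complex.I) = f q) ∧
      ∀ φ : ℝ →ᵇ ℝ, ∀ ε > 0, Tendsto (fun n => P n {ω | ε ≤
        |∫ x, φ x ∂(empiricalSpectralDistribution (hA n ω)) - ∫ x, φ x ∂N|}) atTop (𝓝 0) := by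
  obtain ⟨N, -, -, -, -, -, -, hN⟩ := exists_realizations hA h0 hconv hf (B := fun _ => Set.univ)
    one_pos (Eventually.of_forall fun n => by simp).frequently
  refine ⟨N, hN, fun φ ε hε => ?_⟩
  rw [ENNReal.tendsto_nhds_zero]
  by_contra hcon
  push Not at hcon
  obtain ⟨δ, hδ, hfr⟩ := hcon
  obtain ⟨N', k, ω, μ, hω, hμ, hlim, hN'⟩ := exists_realizations hA h0 hconv hf hδ
    (hfr.mono fun n hn => hn.le)
  have hNN : (N' : Measure ℝ) = N := eq_of_stieltjesTransform_rat_eq h0 fun q hq => by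
    rw [hN' q hq, hN q hq]
  have h1 := ProbabilityMeasure.tendsto_iff_forall_integral_tendsto.1 hlim φ
  rw [hNN] at h1
  have h2 : ∀ j, ε ≤ |∫ x, φ x ∂(μ j : Measure ℝ) - ∫ x, φ x ∂(N : Measure ℝ)| := fun j => by
    rw [hμ j]
    exact hω j
  obtain ⟨j, hj⟩ := (Metric.tendsto_nhds.1 h1 ε hε).exists
  rw [Real.dist_eq] at hj
  exact absurd (h2 j) (not_le.2 hj)

end MainTheorem

end

theorem theoremt
    (m : ℕ → ℕ)
    {Ω : ℕ → Type*} [∀ n, MeasurableSpace (Ω n)]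
    (P : ∀ n, Measure (Ω n)) [∀ n, IsProbabilityMeasure (P n)]
    -- the weights and the vectors; the laws of the weights
    (ξ : ∀ n, Fin (m n) → Ω n → ℝ) (y : ∀ n, Fin (m n) → Ω n → Fin n → ℝ)
    (σ : ℕ → Measure ℝ) [∀ n, IsProbabilityMeasure (σ n)]
    (ν : GeneralizedSignedMeasure)
    (hξ_meas : ∀ n α, Measurable (ξ n α)) (hy_meas : ∀ n α, Measurable (y n α))
    -- all the weights and all the vectors are mutually independent
    (hξ_indep : ∀ n, iIndepFun (ξ n) (P n))
    (hy_indep : ∀ n, iIndepFun (y n) (P n))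
    (hξy_indep : ∀ n, IndepFun (fun ω α => ξ n α ω) (fun ω α => y n α ω) (P n))
    -- concentration of quadratic forms
    (hy_conc : ∀ D : ∀ n, Matrix (Fin n) (Fin n) ℝ, (∀ n, 1 ≤ n → opNorm (D n) = 1) →
      Tendsto (fun n => ⨆ α, evariance (fun ω => (D n *ᵥ y n α ω) ⬝ᵥ y n α ω) (P n))
        atTop (𝓝 0))
    -- the weights: common law, weak convergence, moment bounds
    (hξ_law : ∀ n α, (P n).map (ξ n α) = σ n)
    (hσ_weak : WeaklyConvergesTo (fun n => scaledSignedMeasure (m n) n (σ n)) ν)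
    (hσ_moment : ∀ p ∈ ({1, 2, 3} : Set ℕ), ∃ C : ℝ, ∀ n, 1 ≤ n →
      ENNReal.ofReal (m n / n : ℝ) * ∫⁻ x, ENNReal.ofReal (|x| ^ (p + 1)) ∂(σ n)
        ≤ ENNReal.ofReal C)
    -- the covariance matrices
    (hQ_norm : ∃ C : ℝ, ∀ᶠ n : ℕ in atTop, ∀ α,
      opNorm (secondMomentMatrix (P n) (y n α)) ≤ C / n)
    (hQ_trace : ∀ ε > 0, ∀ᶠ n : ℕ in atTop, ∀ α,
      |(secondMomentMatrix (P n) (y n α)).trace - 1| ≤ ε)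
    (hQ_mean : (fun n : ℕ => hsNorm (((m n : ℝ)⁻¹ • (∑ α, secondMomentMatrix (P n) (y n α)))
        - (n : ℝ)⁻¹ • (1 : Matrix (Fin n) (Fin n) ℝ)))
      =o[atTop] fun n : ℕ => (n : ℝ) ^ (-(1 / 2) : ℝ)) :
    ∃ N : Measure ℝ, IsProbabilityMeasure N ∧
      -- weak convergence in probability of the empirical spectral distributions
      (∀ φ : ℝ →ᵇ ℝ, ∀ ε > 0, Tendsto (fun n => P n {ω | ε ≤
          |∫ x, φ x ∂(empiricalSpectralDistribution
              (weightedGram_isHermitian (fun α => ξ n α ω) (fun α => y n α ω)))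
            - ∫ x, φ x ∂N|}) atTop (𝓝 0)) ∧
      -- the Stieltjes transform of the limit solves the equation
      SolvesLimitEquation ν (stieltjesTransform N) ∧
      -- uniqueness among the Stieltjes transforms of non-negative measures
      ∀ M : Measure ℝ, (∀ z : ℂ, z.im ≠ 0 → Integrable (fun x : ℝ => ((x : ℂ) - z)⁻¹) M) →
        SolvesLimitEquation ν (stieltjesTransform M) →
        ∀ z : ℂ, z.im ≠ 0 → stieltjesTransform M z = stieltjesTransform N z := by
  obtain ⟨C₀, hW⟩ := exists_weightLimit (eventually_one_le_of_isLittleO hQ_mean) hσ_weak hσ_moment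
  obtain ⟨C, hS⟩ := hW.exists_sampleBounds hy_meas hy_conc hQ_norm hQ_trace hQ_mean
  have hprob : ∀ n α, IsProbabilityMeasure ((P n).map (y n α)) := fun n α =>
    Measure.isProbabilityMeasure_map (hy_meas n α).aemeasurable
  -- The second entry is the threshold of the approximate equation, the third that of the
  -- contraction.
  set η₀ := max 1 (max (20 * C) (‖ν.integral fun _ => 1‖ + 30 * C₀ + 1)) with hη₀
  have h1 : 1 ≤ η₀ := le_max_left _ _
  have h0 : 0 < η₀ := by linarith
  have hex : ∀ η : ℝ, ∃ w : ℂ, η₀ ≤ η →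
      Tendsto (fun n => meanTrace (σ n) (fun α => (P n).map (y n α)) η 1) atTop (𝓝 w) ∧
      ((η : ℂ) * Complex.I) * w = -1 + w * limitTransform ν w ∧
      ‖1 + ((η : ℂ) * Complex.I) * w‖ ≤ 10 * C / η := by
    intro η
    by_cases hη : η₀ ≤ η
    · obtain ⟨w, a1, -, a2, a3⟩ := hW.exists_tendsto_meanTrace hS
        (((le_max_left _ _).trans (le_max_right _ _)).trans hη)
        (((le_max_right _ _).trans (le_max_right _ _)).trans hη)
      exact ⟨w, fun _ => ⟨a1, a2, a3⟩⟩
    · exact ⟨0, fun h => absurd h hη⟩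
  choose f hf using hex
  have hA := fun n ω => weightedGram_isHermitian (fun α => ξ n α ω) (fun α => y n α ω)
  have hconv : ∀ η : ℝ, η₀ ≤ η → ∀ δ > 0, Tendsto (fun n => P n
      {ω | δ ≤ ‖stieltjesTransform (empiricalSpectralDistribution (hA n ω)) (η * Complex.I) -
        f η‖}) atTop (𝓝 0) := by
    intro η hη δ hδ
    have hη1 : 1 ≤ η := h1.trans hη
    have hη0 : η ≠ 0 := by linarith
    refine (tendsto_sampleLaw_normalizedTrace (hS 1 one_pos le_rfl) hη1 (hf η hη).1 hδ).congr
      fun n => ?_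
    have hX : Measurable fun ω α => (ξ n α ω, y n α ω) :=
      measurable_pi_lambda _ fun α => (hξ_meas n α).prodMk (hy_meas n α)
    have hcont : Continuous fun x : Sample (m n) n =>
        ‖(n : ℂ)⁻¹ * (sampleResolvent η x).trace - f η‖ :=
      ((continuous_const.mul (continuous_sampleResolvent hη0).matrix_trace).sub
        continuous_const).norm
    -- Mutual independence identifies the joint law of weights and vectors with the product law
    -- under which the estimates were made.
    rw [← map_prod_eq_sampleLaw (hξ_meas n) (hy_meas n) (hξ_indep n) (hy_indep n) (hξy_indep n)
      (hξ_law n), Measure.map_apply hX (measurableSet_le measurable_const hcont.measurable)]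
    congr 1
    ext ω
    simp only [Set.mem_preimage, Set.mem_ofPred_eq,
      stieltjesTransform_empiricalSpectralDistribution (hA n ω) hη0]
    rfl
  have hmass : ∀ ε > 0, ∃ q : ℚ, η₀ ≤ q ∧ ‖1 + (((q : ℝ) : ℂ) * Complex.I) * f q‖ < ε := by
    intro ε hε
    obtain ⟨q, hq⟩ := exists_rat_gt (max η₀ (10 * C / ε))
    have hq0 : η₀ ≤ q := (le_max_left _ _).trans hq.le
    refine ⟨q, hq0, (hf q hq0).2.2.trans_lt ?_⟩
    have h2 := (le_max_right _ _).trans_lt hq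
    rw [div_lt_iff₀ hε] at h2
    rw [div_lt_iff₀ (by linarith)]
    linarith
  obtain ⟨N, hN, hweak⟩ := exists_weakLimit hA h0 hconv hmass
  have hsol : SolvesLimitEquation ν (stieltjesTransform N) := by
    -- The point `(η₀ + 1) i` is an accumulation point of the `q i` with `q` rational and above
    -- `η₀`, where the equation is already known.
    refine hW.solvesLimitEquation_of_frequently N (z₀ := ((η₀ + 1 : ℝ) : ℂ) * Complex.I)
      (by simp; linarith) ?_
    have hcont : Continuous fun x : ℝ => (x : ℂ) * Complex.I := by fun_prop
    have hinj : Function.Injective fun x : ℝ => (x : ℂ) * Complex.I := fun a b hab => by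
      simpa using hab
    have htend : Tendsto (fun x : ℝ => (x : ℂ) * Complex.I) (𝓝[≠] (η₀ + 1))
        (𝓝[≠] (((η₀ + 1 : ℝ) : ℂ) * Complex.I)) :=
      hcont.continuousAt.continuousWithinAt.tendsto_nhdsWithin fun x hx => hinj.ne hx
    refine htend.frequently ?_
    have hfreq : ∃ᶠ x : ℝ in 𝓝[≠] (η₀ + 1), x ∈ Set.range ((↑) : ℚ → ℝ) :=
      mem_closure_ne_iff_frequently_within.1
        ((Rat.denseRange_cast.sdiff_singleton (η₀ + 1)) (η₀ + 1))
    refine (hfreq.and_eventually (eventually_nhdsWithin_of_eventually_nhds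
      (lt_mem_nhds (show η₀ < η₀ + 1 by linarith)))).mono ?_
    rintro x ⟨⟨q, rfl⟩, hq⟩
    rw [hN q hq.le]
    exact (hf q hq.le).2.1
  refine ⟨N, inferInstance, hweak, hsol, fun M hM hMs z _ => ?_⟩
  rw [hW.eq_of_solvesLimitEquation hM (fun z hz => integrable_inv_ofReal_sub N hz) hMs hsol]
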